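/- Let $X$ be a compact complex manifold (Hausdorff, of pure dimension), let $i_*:H^1(X,\mathbb R)\to H^1(X,\mathcal O_X)$ be induced by the inclusion of the real constants, let $\mathrm{Pic}^0(X)=H^1(X,\mathcal O_X)/H^1(X,\mathbb Z)$, and let $V$ be the maximal complex subspace of $i_*H^1(X,\mathbb R)$. A deformation of a holomorphic vector bundle $\mathcal E_0$ of constant rank on $X$ over a pointed complex manifold $(U,o)$ is a holomorphic vector bundle $\mathcal E$ on $X\times U$ with $\mathcal E|_{X\times\{o\}}\cong\mathcal E_0$; put $\mathcal E_t=\mathcal E|_{X\times\{t\}}$. A smooth hermitian metric $g$ on $\mathcal E$ is called Ricci-flat if the curvature forms $\Theta^t=\partial_X\bar\partial_X\log\det (g|_{\mathcal E_t})$ satisfy $\Theta^t=\Theta^o$ for all $t\in U$, and the deformation $\mathcal E$ is called Ricci-flat if it carries such a metric. $\mathcal E_0$ is called Ricci-rigid if every Ricci-flat deformation of $\mathcal E_0$ over a germ $(\mathbb C^k,0)$, $k\ge 0$, is trivial, i.e. isomorphic to $\mathrm{pr}_1^*\mathcal E_0$ over a neighbourhood of $0$. Suppose that there is a Ricci-rigid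 holomorphic vector bundle of rank $n\ge 1$ on $X$. Then: (1) every germ at $0$ of a holomorphic map $f:\mathbb C\to\mathrm{Pic}^0(X)$ whose values lie in $i_*H^1(X,\mathbb R)/H^1(X,\mathbb Z)$ is constant; (2) for every connected (Hausdorff, second countable) complex manifold $U$, every $o\in U$ and every holomorphic vector bundle $\mathcal E$ on $X\times U$, of any rank, the deformation $\mathcal E$ of $\mathcal E_o$ is Ricci-flat if and only if $\det\mathcal E_t\cong\det\mathcal E_o$ for all $t\in U$; moreover, for every given hermitian metric $g^0$ on $\mathcal E_o$, this is also equivalent to the existence of a Ricci-flat metric $g$ on $\mathcal E$ with $g|_{\mathcal E_o}=g^0$; (3) $V=0$. -/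

import Mathlib

open scoped Manifold ContDiff Topology Matrix ComplexOrder

noncomputable section

namespace RicciDeform

/-! ## Čech cohomology in degree one -/

/-- A presheaf on `X` consisting of `A`-valued functions: `sec W` is the set of functions (with
arbitrary values outside of `W`) whose restriction to the open set `W` is a section. -/
structure FunSheaf (R A X : Type*) [CommRing R] [AddCommGroup A] [Module R A]
    [TopologicalSpace X] where
  sec : Set X → Submodule R (X → A)
  anti : ∀ {V W : Set X}, V ⊆ W → sec W ≤ sec V

/-- An open cover of `X` indexed by the points of `X`, the set `U x` being a neighbourhood of `x`.
These covers are cofinal among all open covers. -/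
def IsPointCover {X : Type*} [TopologicalSpace X] (U : X → Set X) : Prop :=
  ∀ x, IsOpen (U x) ∧ x ∈ U x

theorem IsPointCover.inter {X : Type*} [TopologicalSpace X] {U V : X → Set X}
    (hU : IsPointCover U) (hV : IsPointCover V) : IsPointCover (fun x => U x ∩ V x) :=
  fun x => ⟨(hU x).1.inter (hV x).1, (hU x).2, (hV x).2⟩

namespace FunSheaf

variable {R A X : Type*} [CommRing R] [AddCommGroup A] [Module R A] [TopologicalSpace X]

/-- Čech 1-cocycles, on some cover: `c x y` matters only on `U x ∩ U y`. -/
def cocycles (S : FunSheaf R A X) : Submodule R (X → X → X → A) where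
  carrier := {c | ∃ U : X → Set X, IsPointCover U ∧
    (∀ x y, c x y ∈ S.sec (U x ∩ U y)) ∧
    ∀ x y z, ∀ p ∈ U x ∩ U y ∩ U z, c x y p + c y z p = c x z p}
  zero_mem' := ⟨fun _ => Set.univ, fun _ => ⟨isOpen_univ, trivial⟩,
    fun _ _ => Submodule.zero_mem _, fun _ _ _ _ _ => by simp⟩
  add_mem' := by
    rintro c d ⟨U, hU, hc, hc'⟩ ⟨V, hV, hd, hd'⟩
    refine ⟨fun x => U x ∩ V x, hU.inter hV, fun x y => ?_, fun x y z p hp => ?_⟩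
    · exact Submodule.add_mem _
        (S.anti (Set.inter_subset_inter Set.inter_subset_left Set.inter_subset_left) (hc x y))
        (S.anti (Set.inter_subset_inter Set.inter_subset_right Set.inter_subset_right) (hd x y))
    · have h1 := hc' x y z p ⟨⟨hp.1.1.1, hp.1.2.1⟩, hp.2.1⟩
      have h2 := hd' x y z p ⟨⟨hp.1.1.2, hp.1.2.2⟩, hp.2.2⟩
      simp only [Pi.add_apply]
      rw [← h1, ← h2]
      abel
  smul_mem' := by
    rintro r c ⟨U, hU, hc, hc'⟩
    refine ⟨U, hU, fun x y => Submodule.smul_mem _ r (hc x y), fun x y z p hp => ?_⟩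
    simp only [Pi.smul_apply]
    rw [← hc' x y z p hp, smul_add]

/-- Families which on some (possibly finer) cover are Čech 1-coboundaries. -/
def coboundaries (S : FunSheaf R A X) : Submodule R (X → X → X → A) where
  carrier := {c | ∃ U : X → Set X, IsPointCover U ∧ ∃ f : X → X → A,
    (∀ x, f x ∈ S.sec (U x)) ∧ ∀ x y, ∀ p ∈ U x ∩ U y, c x y p = f y p - f x p}
  zero_mem' := ⟨fun _ => Set.univ, fun _ => ⟨isOpen_univ, trivial⟩, 0,
    fun _ => Submodule.zero_mem _, fun _ _ _ _ => by simp⟩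
  add_mem' := by
    rintro c d ⟨U, hU, f, hf, hc⟩ ⟨V, hV, g, hg, hd⟩
    refine ⟨fun x => U x ∩ V x, hU.inter hV, f + g, fun x => ?_, fun x y p hp => ?_⟩
    · exact Submodule.add_mem _ (S.anti (fun p hp => hp.1) (hf x))
        (S.anti (fun p hp => hp.2) (hg x))
    · simp only [Pi.add_apply]
      rw [hc x y p ⟨hp.1.1, hp.2.1⟩, hd x y p ⟨hp.1.2, hp.2.2⟩]
      abel
  smul_mem' := by
    rintro r c ⟨U, hU, f, hf, hc⟩
    refine ⟨U, hU, r • f, fun x => Submodule.smul_mem _ r (hf x), fun x y p hp => ?_⟩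
    simp only [Pi.smul_apply]
    rw [hc x y p hp, smul_sub]

/-- The first Čech cohomology group (the limit over all covers): cocycles on arbitrarily fine
covers, two of them being identified if they differ by a coboundary on a common refinement. -/
abbrev H1 (S : FunSheaf R A X) : Type _ :=
  S.cocycles ⧸ S.coboundaries.comap S.cocycles.subtype

variable {R' A' : Type*} [CommRing R'] [AddCommGroup A'] [Module R' A'] {σ : R →+* R'}

/-- The map on cocycles induced by a (semilinear) map of coefficients. -/
def cocyclesMap (S : FunSheaf R A X) (T : FunSheaf R' A' X) (φ : A →ₛₗ[σ] A')
    (hφ : ∀ W, ∀ f ∈ S.sec W, (fun p => φ (f p)) ∈ T.sec W) : S.cocycles →ₛₗ[σ] T.cocycles where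
  toFun c := ⟨fun x y p => φ (c.1 x y p), by
    obtain ⟨c, U, hU, hc, hc'⟩ := c
    exact ⟨U, hU, fun x y => hφ _ _ (hc x y), fun x y z p hp => by
      rw [← map_add, hc' x y z p hp]⟩⟩
  map_add' c d := by ext; simp
  map_smul' r c := by ext; simp

/-- The map on `H1` induced by a (semilinear) map of coefficients. -/
def H1map (S : FunSheaf R A X) (T : FunSheaf R' A' X) (φ : A →ₛₗ[σ] A')
    (hφ : ∀ W, ∀ f ∈ S.sec W, (fun p => φ (f p)) ∈ T.sec W) : S.H1 →ₛₗ[σ] T.H1 :=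
  Submodule.mapQ _ _ (cocyclesMap S T φ hφ) (by
    rintro c ⟨U, hU, f, hf, hc⟩
    refine ⟨U, hU, fun x p => φ (f x p), fun x => hφ _ _ (hf x), fun x y p hp => ?_⟩
    have h := hc x y p hp
    simp only [Submodule.subtype_apply] at h
    simp [cocyclesMap, h])

end FunSheaf

/-- The constant sheaf: locally constant `A`-valued functions. -/
def constSheaf (A X : Type*) [CommRing A] [TopologicalSpace X] : FunSheaf A A X where
  sec W :=
    { carrier := {f | ∀ p ∈ W, ∀ᶠ q in 𝓝 p, f q = f p}
      zero_mem' := fun _ _ => by simp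
      add_mem' := fun {f g} hf hg p hp => by
        filter_upwards [hf p hp, hg p hp] with q h1 h2
        simp [h1, h2]
      smul_mem' := fun r f hf p hp => by
        filter_upwards [hf p hp] with q h1
        simp [h1] }
  anti h _ hf p hp := hf p (h hp)

section Manifold

variable (m : ℕ) (X : Type*) [TopologicalSpace X] [ChartedSpace (EuclideanSpace ℂ (Fin m)) X]

/-- The structure sheaf `𝓞_X` of holomorphic functions on the complex manifold `X`. -/
def holSheaf : FunSheaf ℂ ℂ X where
  sec W :=
    { carrier := {f | ContMDiffOn 𝓘(ℂ, EuclideanSpace ℂ (Fin m)) 𝓘(ℂ, ℂ) ω f W}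
      zero_mem' := contMDiffOn_const
      add_mem' := fun hf hg => ContMDiffOn.add hf hg
      smul_mem' := fun r f hf =>
        show ContMDiffOn _ _ ω (fun p => r * f p) W from ContMDiffOn.mul contMDiffOn_const hf }
  anti h _ hf := ContMDiffOn.mono hf h

theorem contMDiffOn_of_locallyConst {W : Set X} {f : X → ℂ}
    (hf : ∀ p ∈ W, ∀ᶠ q in 𝓝 p, f q = f p) :
    ContMDiffOn 𝓘(ℂ, EuclideanSpace ℂ (Fin m)) 𝓘(ℂ, ℂ) ω f W := fun p hp =>
  ((contMDiffAt_const (c := f p)).congr_of_eventuallyEq (hf p hp)).contMDiffWithinAt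

/-- `H¹(X, 𝓞_X)`. -/
abbrev H1O : Type _ := (holSheaf m X).H1

/-- `i_* : H¹(X, ℝ) → H¹(X, 𝓞_X)`, induced by the inclusion of the real constants. -/
def realToH1O : (constSheaf ℝ X).H1 →ₛₗ[algebraMap ℝ ℂ] H1O m X :=
  FunSheaf.H1map (constSheaf ℝ X) (holSheaf m X)
    { toFun := fun r => (r : ℂ)
      map_add' := fun _ _ => by simp
      map_smul' := fun _ _ => by simp }
    (fun _ _ hf => contMDiffOn_of_locallyConst m X fun p hp => by
      filter_upwards [hf p hp] with q h
      simp [h])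

/-- `H¹(X, ℤ) → H¹(X, 𝓞_X)`, induced by the inclusion of the integral constants. -/
def intToH1O : (constSheaf ℤ X).H1 →ₛₗ[Int.castRingHom ℂ] H1O m X :=
  FunSheaf.H1map (constSheaf ℤ X) (holSheaf m X)
    { toFun := fun r => (r : ℂ)
      map_add' := fun _ _ => by simp
      map_smul' := fun _ _ => by simp }
    (fun _ _ hf => contMDiffOn_of_locallyConst m X fun p hp => by
      filter_upwards [hf p hp] with q h
      simp [h])

/-- `Pic⁰(X) = H¹(X, 𝓞_X) / H¹(X, ℤ)`. -/
abbrev Pic0 : Type _ := H1O m X ⧸ (intToH1O m X).toAddMonoidHom.range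

/-- The subgroup `i_* H¹(X, ℝ) / H¹(X, ℤ)` of `Pic⁰(X)`. -/
def realTorus : AddSubgroup (Pic0 m X) :=
  (realToH1O m X).toAddMonoidHom.range.map (QuotientAddGroup.mk' _)

/-- The maximal complex subspace `V` of the real subspace `i_* H¹(X, ℝ)` of `H¹(X, 𝓞_X)`. -/
def maxComplexSubspace : Submodule ℂ (H1O m X) :=
  sSup {S | (S : Set (H1O m X)) ⊆ Set.range (realToH1O m X)}

variable {m X}

/-- Holomorphy at `0` of a map from `ℂ` to `Pic⁰(X)`, which carries the complex structure making
the quotient map `H¹(X, 𝓞_X) → Pic⁰(X)` locally biholomorphic: near `0` the map lifts to a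
holomorphic map to the (finite-dimensional) complex vector space `H¹(X, 𝓞_X)`, that is, one all
of whose linear coordinates are holomorphic at `0`. -/
def IsHolGerm (f : ℂ → Pic0 m X) : Prop :=
  ∃ F : ℂ → H1O m X, (∀ ℓ : Module.Dual ℂ (H1O m X), AnalyticAt ℂ (fun t => ℓ (F t)) 0) ∧
    ∀ᶠ t in 𝓝 (0 : ℂ), f t = QuotientAddGroup.mk (F t)

end Manifold

/-! ## Holomorphic vector bundles -/

section Bundle

variable {E H : Type*} [NormedAddCommGroup E] [NormedSpace ℂ E] [TopologicalSpace H]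
  {I : ModelWithCorners ℂ E H} {M : Type*} [TopologicalSpace M] [ChartedSpace H M]
  {E' H' : Type*} [NormedAddCommGroup E'] [NormedSpace ℂ E'] [TopologicalSpace H']
  {I' : ModelWithCorners ℂ E' H'} {M' : Type*} [TopologicalSpace M'] [ChartedSpace H' M']
  {n : ℕ}

/-- A holomorphic vector bundle of rank `n`, given by its transition functions with respect to
trivializations over an open cover indexed by the points of `M`: the coordinates of a vector
with respect to the trivializations over `U i` and `U j` are related by `s_i = trans i j * s_j`. -/
structure HolBundle (I : ModelWithCorners ℂ E H) (M : Type*) [TopologicalSpace M]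
    [ChartedSpace H M] (n : ℕ) where
  U : M → Set M
  cover : IsPointCover U
  trans : M → M → M → Matrix (Fin n) (Fin n) ℂ
  hol : ∀ i j a b, ContMDiffOn I 𝓘(ℂ, ℂ) ω (fun p => trans i j p a b) (U i ∩ U j)
  self : ∀ i, ∀ p ∈ U i, trans i i p = 1
  cocycle : ∀ i j k, ∀ p ∈ U i ∩ U j ∩ U k, trans i j p * trans j k p = trans i k p

namespace HolBundle

/-- `A` and `B` are isomorphic as holomorphic vector bundles over the open set `W`; `h i` is the
matrix of the isomorphism in the trivializations of index `i` of `A` and `B`. -/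
def IsoOn (A B : HolBundle I M n) (W : Set M) : Prop :=
  ∃ h : M → M → Matrix (Fin n) (Fin n) ℂ,
    (∀ i a b, ContMDiffOn I 𝓘(ℂ, ℂ) ω (fun p => h i p a b) (A.U i ∩ B.U i ∩ W)) ∧
    (∀ i, ∀ p ∈ A.U i ∩ B.U i ∩ W, IsUnit (h i p)) ∧
    ∀ i j, ∀ p ∈ (A.U i ∩ B.U i) ∩ (A.U j ∩ B.U j) ∩ W,
      h i p * A.trans i j p = B.trans i j p * h j p

/-- Isomorphic holomorphic vector bundles. -/
def Iso (A B : HolBundle I M n) : Prop := A.IsoOn B Set.univ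

/-- Pullback along a holomorphic map. -/
def pullback (A : HolBundle I M n) (f : M' → M) (hf : ContMDiff I' I ω f) :
    HolBundle I' M' n where
  U i := f ⁻¹' A.U (f i)
  cover i := ⟨(A.cover (f i)).1.preimage hf.continuous, (A.cover (f i)).2⟩
  trans i j p := A.trans (f i) (f j) (f p)
  hol i j a b := (A.hol (f i) (f j) a b).comp hf.contMDiffOn (fun _ hp => hp)
  self i p hp := A.self (f i) (f p) hp
  cocycle i j k p hp := A.cocycle (f i) (f j) (f k) (f p) hp

/-- The determinant line bundle. -/
def det (A : HolBundle I M n) : HolBundle I M 1 where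
  U := A.U
  cover := A.cover
  trans i j p := Matrix.of fun _ _ => (A.trans i j p).det
  hol i j _ _ := by
    simp only [Matrix.of_apply, Matrix.det_apply']
    refine contMDiffOn_finsetSum fun s _ => ContMDiffOn.mul contMDiffOn_const ?_
    exact contMDiffOn_finsetProd fun a _ => A.hol i j (s a) a
  self i p hp := by
    ext a b
    obtain rfl := Subsingleton.elim a b
    simp [A.self i p hp]
  cocycle i j k p hp := by
    ext a b
    simp [← A.cocycle i j k p hp, Matrix.mul_apply, Matrix.det_mul]

end HolBundle

/-- A smooth hermitian metric on a holomorphic vector bundle; `gram i p` is the positive definite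
Gram matrix at `p` in the trivialization over `U i`: `g(v, w) = v_iᴴ * gram i p * w_i`.
Smoothness is taken with respect to the underlying real manifold, with real model `J`. -/
structure HermMetric (J : ModelWithCorners ℝ E H) (A : HolBundle I M n) where
  gram : M → M → Matrix (Fin n) (Fin n) ℂ
  smooth : ∀ i a b, ContMDiffOn J 𝓘(ℝ, ℂ) ∞ (fun p => gram i p a b) (A.U i)
  posDef : ∀ i, ∀ p ∈ A.U i, (gram i p).PosDef
  compat : ∀ i j, ∀ p ∈ A.U i ∩ A.U j,
    gram j p = (A.trans i j p)ᴴ * gram i p * A.trans i j p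

/-- Two metrics on the same bundle agree. -/
def HermMetric.Agree {J : ModelWithCorners ℝ E H} {A : HolBundle I M n}
    (g g' : HermMetric J A) : Prop :=
  ∀ i, ∀ p ∈ A.U i, g.gram i p = g'.gram i p

end Bundle

/-! ## Curvature -/

section Curvature

variable {m : ℕ}

/-- `∂φ/∂z_a`. -/
def dz (a : Fin m) (φ : EuclideanSpace ℂ (Fin m) → ℂ) (z : EuclideanSpace ℂ (Fin m)) : ℂ :=
  (fderiv ℝ φ z (EuclideanSpace.single a 1) - Complex.I * fderiv ℝ φ z (EuclideanSpace.single a Complex.I)) / 2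

/-- `∂φ/∂z̄_a`. -/
def dzbar (a : Fin m) (φ : EuclideanSpace ℂ (Fin m) → ℂ) (z : EuclideanSpace ℂ (Fin m)) : ℂ :=
  (fderiv ℝ φ z (EuclideanSpace.single a 1) + Complex.I * fderiv ℝ φ z (EuclideanSpace.single a Complex.I)) / 2

/-- The coefficients of the (1,1)-form `∂∂̄φ = ∑ (∂²φ/∂z_a∂z̄_b) dz_a ∧ dz̄_b` at `z`. -/
def ddbar (φ : EuclideanSpace ℂ (Fin m) → ℂ) (z : EuclideanSpace ℂ (Fin m)) : Matrix (Fin m) (Fin m) ℂ :=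
  Matrix.of fun a b => dz a (fun w => dzbar b φ w) z

variable {X : Type*} [TopologicalSpace X] [ChartedSpace (EuclideanSpace ℂ (Fin m)) X] {n : ℕ}

/-- The curvature form `Θ = ∂∂̄ log det g` at the point `x`, written in the preferred chart at `x`
(it does not depend on the trivialization; the one of index `x` is used). -/
def curvature {A : HolBundle 𝓘(ℂ, EuclideanSpace ℂ (Fin m)) X n} (g : HermMetric 𝓘(ℝ, EuclideanSpace ℂ (Fin m)) A) (x : X) :
    Matrix (Fin m) (Fin m) ℂ :=
  ddbar (fun z => ((Real.log (g.gram x ((chartAt (EuclideanSpace ℂ (Fin m)) x).symm z)).det.re : ℝ) : ℂ))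
    (chartAt (EuclideanSpace ℂ (Fin m)) x x)

end Curvature

/-! ## Deformations -/

section Deformation

variable {m k n : ℕ} {X U : Type*} [TopologicalSpace X] [ChartedSpace (EuclideanSpace ℂ (Fin m)) X]
  [TopologicalSpace U] [ChartedSpace (EuclideanSpace ℂ (Fin k)) U]

/-- A family of holomorphic vector bundles on `X` parametrized by `U`: a holomorphic vector bundle
on `X × U`. With a base point `o : U` it is a deformation of the bundle over `X × {o}`. -/
abbrev Family (m k : ℕ) (X U : Type*) [TopologicalSpace X] [ChartedSpace (EuclideanSpace ℂ (Fin m)) X]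
    [TopologicalSpace U] [ChartedSpace (EuclideanSpace ℂ (Fin k)) U] (n : ℕ) : Type _ :=
  HolBundle (𝓘(ℂ, EuclideanSpace ℂ (Fin m)).prod 𝓘(ℂ, EuclideanSpace ℂ (Fin k))) (X × U) n

/-- Hermitian metrics on a family, smooth on `X × U`. -/
abbrev FamilyMetric (A : Family m k X U n) : Type _ :=
  HermMetric (𝓘(ℝ, EuclideanSpace ℂ (Fin m)).prod 𝓘(ℝ, EuclideanSpace ℂ (Fin k))) A

/-- The member `𝓔_t` of the family `𝓔`. -/
def Family.fiber (A : Family m k X U n) (t : U) : HolBundle 𝓘(ℂ, EuclideanSpace ℂ (Fin m)) X n :=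
  A.pullback (fun x => (x, t)) (contMDiff_id.prodMk contMDiff_const)

/-- The metric induced on the member `𝓔_t`. -/
def FamilyMetric.fiber {A : Family m k X U n} (g : FamilyMetric A) (t : U) :
    HermMetric 𝓘(ℝ, EuclideanSpace ℂ (Fin m)) (Family.fiber A t) where
  gram i p := g.gram (i, t) (p, t)
  smooth i a b := (g.smooth (i, t) a b).comp
    (contMDiff_id.prodMk contMDiff_const).contMDiffOn (fun _ hp => hp)
  posDef i p hp := g.posDef (i, t) (p, t) hp
  compat i j p hp := g.compat (i, t) (j, t) (p, t) hp

/-- `(𝓔, g)` is Ricci-flat with respect to the base point `o`: `Θ^t = Θ^o` for all `t`. -/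
def FamilyMetric.RicciFlat {A : Family m k X U n} (g : FamilyMetric A) (o : U) : Prop :=
  ∀ t x, curvature (FamilyMetric.fiber g t) x = curvature (FamilyMetric.fiber g o) x

/-- The determinant is preserved: `det 𝓔_t ≅ det 𝓔_o` for all `t`. -/
def Family.PreservesDet (A : Family m k X U n) (o : U) : Prop :=
  ∀ t, (Family.fiber A t).det.Iso (Family.fiber A o).det

/-- The constant family `pr₁^* 𝓔₀`. -/
def HolBundle.const (A : HolBundle 𝓘(ℂ, EuclideanSpace ℂ (Fin m)) X n) (k : ℕ) (U : Type*) [TopologicalSpace U]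
    [ChartedSpace (EuclideanSpace ℂ (Fin k)) U] : Family m k X U n :=
  A.pullback Prod.fst contMDiff_fst

/-- `𝓔₀` is Ricci-rigid: every small (that is, over a germ `(ℂᵏ, 0)`) Ricci-flat deformation of
`𝓔₀` is trivial, that is, isomorphic to the constant family over some neighbourhood of `0`. -/
def HolBundle.RicciRigid (A₀ : HolBundle 𝓘(ℂ, EuclideanSpace ℂ (Fin m)) X n) : Prop :=
  ∀ (k : ℕ) (U : TopologicalSpace.Opens (EuclideanSpace ℂ (Fin k))) (h0 : (0 : EuclideanSpace ℂ (Fin k)) ∈ U)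
    (A : Family m k X U n), (Family.fiber A ⟨0, h0⟩).Iso A₀ →
    (∃ g : FamilyMetric A, FamilyMetric.RicciFlat g ⟨0, h0⟩) →
    ∃ W : Set U, IsOpen W ∧ ⟨0, h0⟩ ∈ W ∧
      HolBundle.IsoOn A (A₀.const k U) (Set.univ ×ˢ W)

end Deformation

end RicciDeform

end

noncomputable section

namespace RicciDeform

/-! ## Separately holomorphic functions -/

section Separate

open Metric

theorem norm_slope_sub_deriv_le {G : ℂ → ℂ} {R M : ℝ} (hR : 0 < R)
    (hG : DifferentiableOn ℂ G (ball 0 R)) (hM : ∀ ζ ∈ ball (0 : ℂ) R, ‖G ζ‖ ≤ M) {h : ℂ}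
    (hh : h ∈ ball (0 : ℂ) R) (h0 : h ≠ 0) :
    ‖(G h - G 0) / h - deriv G 0‖ ≤ 4 * M / R ^ 2 * ‖h‖ := by
  have h00 : (0 : ℂ) ∈ ball (0 : ℂ) R := mem_ball_self hR
  have hmap : Set.MapsTo G (ball 0 R) (closedBall (G 0) (2 * M)) := fun ζ hζ => by
    rw [mem_closedBall, dist_eq_norm]
    linarith [norm_sub_le (G ζ) (G 0), hM ζ hζ, hM 0 h00]
  -- The Schwarz lemma is used twice: once to bound the slope function by `2M/R`, and once for the
  -- slope function itself, whose oscillation about its value at `0` is at most `4M/R`.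
  have hd : DifferentiableOn ℂ (dslope G 0) (ball 0 R) :=
    (Complex.differentiableOn_dslope (isOpen_ball.mem_nhds h00)).2 hG
  have hb : ∀ ζ ∈ ball (0 : ℂ) R, ‖dslope G 0 ζ‖ ≤ 2 * M / R := fun ζ hζ =>
    Complex.norm_dslope_le_div_of_mapsTo_ball hG hmap hζ
  have hmap2 : Set.MapsTo (dslope G 0) (ball 0 R) (closedBall (dslope G 0 0) (4 * M / R)) :=
    fun ζ hζ => by
      rw [mem_closedBall, dist_eq_norm]
      have : 4 * M / R = 2 * M / R + 2 * M / R := by ring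
      linarith [norm_sub_le (dslope G 0 ζ) (dslope G 0 0), hb ζ hζ, hb 0 h00]
  have key := Complex.dist_le_div_mul_dist_of_mapsTo_ball hd hmap2 hh
  rw [dist_eq_norm, dist_zero_right, dslope_same, dslope_of_ne _ h0, slope_def_field, sub_zero]
    at key
  calc _ ≤ _ := key
    _ = _ := by field_simp

variable {E : Type*} [NormedAddCommGroup E] [NormedSpace ℂ E] {N : ℕ}

/-- Continuous functions which are holomorphic along the directions `b i`. -/
structure SepHol (b : Fin N → E) (f : E → ℂ) (Ω : Set E) : Prop where
  cont : ContinuousOn f Ω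
  diff : ∀ z ∈ Ω, ∀ i, DifferentiableAt ℂ (fun ζ : ℂ => f (z + ζ • b i)) 0

/-- The derivative in the direction `e`. -/
def partialDeriv (e : E) (f : E → ℂ) (z : E) : ℂ := deriv (fun ζ : ℂ => f (z + ζ • e)) 0

theorem differentiableAt_line {f : E → ℂ} {z e : E} {ζ : ℂ}
    (h : DifferentiableAt ℂ (fun ξ : ℂ => f ((z + ζ • e) + ξ • e)) 0) :
    HasDerivAt (fun ξ : ℂ => f (z + ξ • e)) (partialDeriv e f (z + ζ • e)) ζ := by
  have h1 := h.hasDerivAt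
  have h2 : HasDerivAt (fun ξ : ℂ => ξ - ζ) 1 ζ := (hasDerivAt_id ζ).sub_const ζ
  have h3 := HasDerivAt.comp_of_eq ζ h1 h2 (by simp)
  rw [mul_one] at h3
  convert! h3 using 1
  ext ξ
  simp only [Function.comp]
  congr 1
  module

theorem mem_ball_of_lines {z a e : E} {ρ r : ℝ} {ζ ξ : ℂ} (hr : r * (‖a‖ + ‖e‖) < ρ)
    (hζ : ‖ζ‖ ≤ r) (hξ : ‖ξ‖ ≤ r) : z + ζ • a + ξ • e ∈ ball z ρ := by
  rw [mem_ball, dist_eq_norm]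
  have : z + ζ • a + ξ • e - z = ζ • a + ξ • e := by abel
  rw [this]
  calc _ ≤ ‖ζ • a‖ + ‖ξ • e‖ := norm_add_le _ _
    _ = ‖ζ‖ * ‖a‖ + ‖ξ‖ * ‖e‖ := by rw [norm_smul, norm_smul]
    _ ≤ r * ‖a‖ + r * ‖e‖ := by gcongr
    _ < ρ := by linarith

theorem exists_pos_mul_lt' {ρ : ℝ} (hρ : 0 < ρ) {K : ℝ} (hK : 0 ≤ K) : ∃ r > 0, r * K < ρ := by
  refine ⟨ρ / (K + 1), by positivity, ?_⟩
  rw [div_mul_eq_mul_div, div_lt_iff₀ (by positivity)]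
  nlinarith

namespace SepHol

variable {b : Fin N → E} {f : E → ℂ} {Ω : Set E}

/-- Cauchy's estimate for the difference of `f` on two parallel discs: by compactness of the disc
and continuity of `f`, this difference is uniformly small once the centres are close. -/
theorem continuousOn_partialDeriv (hf : SepHol b f Ω) (hΩ : IsOpen Ω) (i : Fin N) :
    ContinuousOn (partialDeriv (b i) f) Ω := by
  intro z₀ hz₀
  refine ContinuousAt.continuousWithinAt ?_
  obtain ⟨ρ, hρ, hρΩ⟩ := Metric.isOpen_iff.1 hΩ z₀ hz₀
  obtain ⟨r, hr, hrρ⟩ := exists_pos_mul_lt' (half_pos hρ) (norm_nonneg (b i))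
  have hmem : ∀ z ∈ ball z₀ (ρ / 2), ∀ ζ : ℂ, ‖ζ‖ ≤ r → z + ζ • b i ∈ Ω := fun z hz ζ hζ => by
    refine hρΩ ?_
    rw [mem_ball, dist_eq_norm] at hz ⊢
    calc _ = ‖(z - z₀) + ζ • b i‖ := by congr 1; abel
      _ ≤ ‖z - z₀‖ + ‖ζ‖ * ‖b i‖ := by rw [← norm_smul]; exact norm_add_le _ _
      _ ≤ ‖z - z₀‖ + r * ‖b i‖ := by gcongr
      _ < ρ := by linarith
  rw [Metric.continuousAt_iff']
  intro ε hε
  have hev : ∀ᶠ z in 𝓝 z₀, ∀ ζ ∈ closedBall (0 : ℂ) r,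
      ‖f (z + ζ • b i) - f (z₀ + ζ • b i)‖ < ε / 2 * r := by
    refine (isCompact_closedBall (0 : ℂ) r).eventually_forall_of_forall_eventually fun ζ hζ => ?_
    have hc : ContinuousAt f (z₀ + ζ • b i) :=
      (hf.cont _ (hmem z₀ (mem_ball_self (half_pos hρ)) ζ (by simpa using hζ))).continuousAt
        (hΩ.mem_nhds (hmem z₀ (mem_ball_self (half_pos hρ)) ζ (by simpa using hζ)))
    have h1 : ContinuousAt (fun q : E × ℂ => f (q.1 + q.2 • b i)) (z₀, ζ) :=
      ContinuousAt.comp (f := fun q : E × ℂ => q.1 + q.2 • b i) (g := f) hc (by fun_prop)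
    have h2 : ContinuousAt (fun q : E × ℂ => f (z₀ + q.2 • b i)) (z₀, ζ) :=
      ContinuousAt.comp (f := fun q : E × ℂ => z₀ + q.2 • b i) (g := f) hc (by fun_prop)
    have h3 := (h1.sub h2).norm
    have h4 : ‖f (z₀ + ζ • b i) - f (z₀ + ζ • b i)‖ < ε / 2 * r := by simp; positivity
    exact h3.eventually (gt_mem_nhds h4)
  filter_upwards [hev, ball_mem_nhds z₀ (half_pos hρ)] with z hz hzb
  have hd : ∀ w ∈ ball z₀ (ρ / 2), ∀ ζ ∈ closedBall (0 : ℂ) r,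
      DifferentiableAt ℂ (fun ξ : ℂ => f (w + ξ • b i)) ζ := fun w hw ζ hζ =>
    (differentiableAt_line (hf.diff _ (hmem w hw ζ (by simpa using hζ)) i)).differentiableAt
  have h0 : (0 : ℂ) ∈ closedBall (0 : ℂ) r := by simp [hr.le]
  have hz₀b := mem_ball_self (x := z₀) (half_pos hρ)
  have hder := Complex.norm_deriv_le_of_forall_mem_sphere_norm_le (c := 0) (R := r)
    (C := ε / 2 * r) (f := fun ζ : ℂ => f (z + ζ • b i) - f (z₀ + ζ • b i)) hr
    (DifferentiableOn.diffContOnCl_ball (U := closedBall 0 r)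
      (fun ζ hζ => ((hd z hzb ζ hζ).sub (hd z₀ hz₀b ζ hζ)).differentiableWithinAt) subset_rfl)
    (fun ζ hζ => (hz ζ (sphere_subset_closedBall hζ)).le)
  rw [deriv_fun_sub (hd z hzb 0 h0) (hd z₀ hz₀b 0 h0)] at hder
  rw [dist_eq_norm]
  refine lt_of_le_of_lt hder ?_
  rw [mul_div_cancel_right₀ _ hr.ne']
  linarith

/-- Along a line in direction `b j`, the partial derivative is a uniform limit of difference
quotients in direction `b i`, which are holomorphic on that line. The rate of convergence is uniform
because `f` is locally bounded. -/
theorem partialDeriv (hf : SepHol b f Ω) (hΩ : IsOpen Ω) (i : Fin N) :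
    SepHol b (partialDeriv (b i) f) Ω := by
  refine ⟨hf.continuousOn_partialDeriv hΩ i, fun z hz j => ?_⟩
  have hcz : ContinuousAt f z := (hf.cont z hz).continuousAt (hΩ.mem_nhds hz)
  obtain ⟨ρ, hρ, hρM⟩ : ∃ ρ > 0, ∀ w ∈ ball z ρ, w ∈ Ω ∧ ‖f w‖ ≤ ‖f z‖ + 1 := by
    have h1 : ∀ᶠ w in 𝓝 z, ‖f w‖ ≤ ‖f z‖ + 1 :=
      (hcz.norm.eventually (gt_mem_nhds (lt_add_one _))).mono fun w hw => hw.le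
    exact Metric.eventually_nhds_iff_ball.1 ((hΩ.eventually_mem hz).and h1)
  obtain ⟨r, hr, hrρ⟩ := exists_pos_mul_lt' hρ (add_nonneg (norm_nonneg (b j)) (norm_nonneg (b i)))
  have hmem : ∀ ζ ξ : ℂ, ‖ζ‖ ≤ r → ‖ξ‖ ≤ r → z + ζ • b j + ξ • b i ∈ ball z ρ :=
    fun ζ ξ hζ hξ => mem_ball_of_lines hrρ hζ hξ
  have hlim : TendstoLocallyUniformlyOn
      (fun (h : ℂ) (ζ : ℂ) => (f (z + ζ • b j + h • b i) - f (z + ζ • b j)) / h)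
      (fun ζ : ℂ => RicciDeform.partialDeriv (b i) f (z + ζ • b j)) (𝓝[≠] 0) (ball 0 r) := by
    apply TendstoUniformlyOn.tendstoLocallyUniformlyOn
    rw [Metric.tendstoUniformlyOn_iff]
    intro ε hε
    have hsmall : ∀ᶠ h : ℂ in 𝓝 0, 4 * (‖f z‖ + 1) / r ^ 2 * ‖h‖ < ε := by
      have : ContinuousAt (fun h : ℂ => 4 * (‖f z‖ + 1) / r ^ 2 * ‖h‖) 0 := by fun_prop
      exact this.eventually (gt_mem_nhds (by simpa using hε))
    filter_upwards [nhdsWithin_le_nhds hsmall, nhdsWithin_le_nhds (ball_mem_nhds (0 : ℂ) hr),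
      self_mem_nhdsWithin] with h hh hhr h0 ζ hζ
    rw [dist_comm, dist_eq_norm]
    refine lt_of_le_of_lt ?_ hh
    have := norm_slope_sub_deriv_le (G := fun ξ : ℂ => f (z + ζ • b j + ξ • b i)) hr
      (fun ξ hξ => (differentiableAt_line (hf.diff _ (hρM _ (hmem ζ ξ (mem_ball_zero_iff.1 hζ).le
        (mem_ball_zero_iff.1 hξ).le)).1 i)).differentiableAt.differentiableWithinAt)
      (fun ξ hξ => (hρM _ (hmem ζ ξ (mem_ball_zero_iff.1 hζ).le (mem_ball_zero_iff.1 hξ).le)).2) hhr h0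
    simpa [RicciDeform.partialDeriv] using this
  have hdiff := hlim.differentiableOn (by
    filter_upwards [nhdsWithin_le_nhds (ball_mem_nhds (0 : ℂ) hr)] with h hh
    intro ζ hζ
    have hd1 : DifferentiableAt ℂ (fun ζ : ℂ => f (z + ζ • b j + h • b i)) ζ := by
      have h1 := (differentiableAt_line (z := z + h • b i) (e := b j) (ζ := ζ) (f := f) (hf.diff _ (by
        have := (hρM _ (hmem ζ h (mem_ball_zero_iff.1 hζ).le (mem_ball_zero_iff.1 hh).le)).1
        rwa [add_right_comm] at this) j)).differentiableAt
      simpa only [add_right_comm] using h1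
    have hd2 : DifferentiableAt ℂ (fun ζ : ℂ => f (z + ζ • b j)) ζ :=
      (differentiableAt_line (hf.diff _ (by
        have := (hρM _ (hmem ζ 0 (mem_ball_zero_iff.1 hζ).le (by simpa using hr.le))).1
        simpa using this) j)).differentiableAt
    exact ((hd1.sub hd2).div_const h).differentiableWithinAt) isOpen_ball
  exact hdiff.differentiableAt (isOpen_ball.mem_nhds (mem_ball_self hr))

end SepHol

namespace SepHol

variable [FiniteDimensional ℂ E] {f : E → ℂ} {Ω : Set E}

/-- The classical argument for continuous partial derivatives: the increment `h` is travelled one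
coordinate at a time, with the mean value inequality on each piece. -/
theorem hasFDerivAt (b : Module.Basis (Fin N) ℂ E) (hf : SepHol b f Ω) (hΩ : IsOpen Ω) {z : E}
    (hz : z ∈ Ω) : HasFDerivAt f
      (∑ i, RicciDeform.partialDeriv (b i) f z • (b.coord i).toContinuousLinearMap) z := by
  set c : Fin N → E →L[ℂ] ℂ := fun i => (b.coord i).toContinuousLinearMap with hc
  have hcr : ∀ i h, c i h = b.repr h i := fun i h => rfl
  set K : ℝ := ∑ i, ‖c i‖ with hK
  set L : ℝ := ∑ i, ‖c i‖ * ‖b i‖ with hL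
  rw [hasFDerivAt_iff_isLittleO_nhds_zero, Asymptotics.isLittleO_iff]
  intro ε hε
  obtain ⟨ε', hε', hεK⟩ := exists_pos_mul_lt' hε (show 0 ≤ K by positivity)
  have hev : ∀ᶠ w in 𝓝 z, w ∈ Ω ∧ ∀ i,
      ‖RicciDeform.partialDeriv (b i) f w - RicciDeform.partialDeriv (b i) f z‖ ≤ ε' := by
    refine (hΩ.eventually_mem hz).and (Filter.eventually_all.2 fun i => ?_)
    have h1 := ((hf.continuousOn_partialDeriv hΩ i z hz).continuousAt (hΩ.mem_nhds hz))
    have h2 := (Metric.continuousAt_iff'.1 h1) ε' hε'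
    exact h2.mono fun w hw => by rw [← dist_eq_norm]; exact hw.le
  obtain ⟨ρ, hρ, hρ'⟩ := Metric.eventually_nhds_iff_ball.1 hev
  obtain ⟨r, hr, hrρ⟩ := exists_pos_mul_lt' hρ (show 0 ≤ L by positivity)
  filter_upwards [ball_mem_nhds (0 : E) hr] with h hh
  rw [mem_ball_zero_iff] at hh
  -- Corners of the coordinate path from `0` to `h`: `s n` contains the first `n` components of `h`.
  let s : ℕ → E := fun n => ∑ i : Fin N, if (i : ℕ) < n then c i h • b i else 0
  have hs0 : s 0 = 0 := by simp [s]
  have hsN : s N = h := by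
    simp only [s, Fin.is_lt, if_true, hcr]
    exact b.sum_repr h
  have hsucc : ∀ j : Fin N, s (j + 1) = s j + c j h • b j := fun j => by
    simp only [s]
    rw [← Finset.sum_erase_add _ _ (Finset.mem_univ j), ← Finset.sum_erase_add (a := j) (s := Finset.univ) (f := fun i : Fin N => if (i : ℕ) < (j : ℕ) then c i h • b i else 0) (h := Finset.mem_univ j)]
    simp only [lt_add_iff_pos_right, zero_lt_one, if_true, lt_irrefl, if_false, add_zero]
    congr 1
    refine Finset.sum_congr rfl fun i hi => ?_
    have hij : (i : ℕ) ≠ j := fun h => (Finset.mem_erase.1 hi).1 (Fin.ext h)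
    have : (i : ℕ) < j + 1 ↔ (i : ℕ) < j := by omega
    simp [this]
  have hci : ∀ i, ‖c i h‖ ≤ ‖c i‖ * ‖h‖ := fun i => (c i).le_opNorm h
  have hmem : ∀ (j : Fin N) (ζ : ℂ), ‖ζ‖ ≤ ‖c j h‖ → z + s j + ζ • b j ∈ ball z ρ := by
    intro j ζ hζ
    rw [mem_ball, dist_eq_norm, add_assoc, add_sub_cancel_left]
    have h1 : s j + ζ • b j = ∑ i : Fin N, if (i : ℕ) < j then c i h • b i else if i = j then ζ • b j else 0 := by
      simp only [s]
      have : ζ • b j = ∑ i : Fin N, if i = j then ζ • b j else 0 := by simp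
      rw [this, ← Finset.sum_add_distrib]
      refine Finset.sum_congr rfl fun i _ => ?_
      by_cases hij : i = j
      · subst hij; simp
      · simp [hij]
    rw [h1]
    calc _ ≤ ∑ i : Fin N, ‖c i‖ * ‖h‖ * ‖b i‖ := by
          refine norm_sum_le_of_le _ fun i _ => ?_
          split_ifs with h2 h3
          · rw [norm_smul]; gcongr; exact hci i
          · subst h3; rw [norm_smul]; gcongr; exact hζ.trans (hci i)
          · rw [norm_zero]; positivity
      _ = ‖h‖ * L := by rw [hL, Finset.mul_sum]; exact Finset.sum_congr rfl fun i _ => by ring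
      _ ≤ r * L := by gcongr
      _ < ρ := hrρ
  have hstep : ∀ j : Fin N, ‖f (z + s (j + 1)) - f (z + s j) -
      c j h * RicciDeform.partialDeriv (b j) f z‖ ≤ ε' * ‖c j h‖ := by
    intro j
    have hder : ∀ ζ ∈ closedBall (0 : ℂ) ‖c j h‖, HasDerivWithinAt
        (fun ζ : ℂ => f (z + s j + ζ • b j) - ζ * RicciDeform.partialDeriv (b j) f z)
        (RicciDeform.partialDeriv (b j) f (z + s j + ζ • b j) -
          RicciDeform.partialDeriv (b j) f z) (closedBall 0 ‖c j h‖) ζ := fun ζ hζ => by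
      have h1 := differentiableAt_line (f := f) (hf.diff _
        (hρ' _ (hmem j ζ (by simpa using hζ))).1 j)
      have h2 := (hasDerivAt_id ζ).mul_const (RicciDeform.partialDeriv (b j) f z)
      rw [one_mul] at h2
      exact (h1.sub h2).hasDerivWithinAt
    have hbd : ∀ ζ ∈ closedBall (0 : ℂ) ‖c j h‖,
        ‖RicciDeform.partialDeriv (b j) f (z + s j + ζ • b j) -
          RicciDeform.partialDeriv (b j) f z‖ ≤ ε' := fun ζ hζ =>
      (hρ' _ (hmem j ζ (by simpa using hζ))).2 j
    have := (convex_closedBall (0 : ℂ) ‖c j h‖).norm_image_sub_le_of_norm_hasDerivWithin_le hder hbd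
      (x := 0) (y := c j h) (by simp) (by simp)
    rw [hsucc]
    simp only [zero_smul, add_zero, zero_mul, sub_zero] at this
    rw [← add_assoc]
    convert! this using 2
    ring
  have htel : f (z + h) - f z = ∑ j : Fin N, (f (z + s (j + 1)) - f (z + s j)) := by
    rw [← Finset.sum_range (fun j => f (z + s (j + 1)) - f (z + s j)),
      Finset.sum_range_sub (fun j => f (z + s j)), hsN, hs0, add_zero]
  rw [htel, sum_apply, ← Finset.sum_sub_distrib]
  calc _ ≤ ∑ j, ε' * (‖c j‖ * ‖h‖) := by
        refine norm_sum_le_of_le _ fun j _ => ?_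
        have h1 := hstep j
        have h2 : (RicciDeform.partialDeriv (b j) f z • (b.coord j).toContinuousLinearMap) h
          = c j h * RicciDeform.partialDeriv (b j) f z := by
            simp [hc, mul_comm]
        rw [h2]
        exact h1.trans (by gcongr; exact hci j)
    _ = ε' * K * ‖h‖ := by rw [hK, Finset.mul_sum, Finset.sum_mul]; exact Finset.sum_congr rfl fun i _ => by ring
    _ ≤ ε * ‖h‖ := by gcongr

/-- The induction quantifies over all `f`, since its hypothesis is applied to the partial
derivatives, which are again separately holomorphic. -/
theorem contDiffOn_nat (b : Module.Basis (Fin N) ℂ E) (hΩ : IsOpen Ω) (n : ℕ) :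
    ∀ f : E → ℂ, SepHol b f Ω → ContDiffOn ℂ n f Ω := by
  induction n with
  | zero => exact fun f hf => contDiffOn_zero.2 hf.cont
  | succ n ih =>
    intro f hf
    rw [Nat.cast_add, Nat.cast_one, contDiffOn_succ_iff_fderiv_of_isOpen hΩ]
    refine ⟨fun z hz => (hf.hasFDerivAt b hΩ hz).differentiableAt.differentiableWithinAt,
      fun h => absurd h (by exact_mod_cast WithTop.coe_ne_top), ?_⟩
    have h1 : ContDiffOn ℂ n (fun z => ∑ i, RicciDeform.partialDeriv (b i) f z •
        (b.coord i).toContinuousLinearMap) Ω :=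
      ContDiffOn.sum fun i _ => (ih _ (hf.partialDeriv hΩ i)).smul contDiffOn_const
    exact h1.congr fun z hz => (hf.hasFDerivAt b hΩ hz).fderiv

/-- **Osgood's lemma**: a continuous separately holomorphic function is smooth. -/
theorem contDiffOn (b : Module.Basis (Fin N) ℂ E) (hΩ : IsOpen Ω) (hf : SepHol b f Ω) :
    ContDiffOn ℂ ∞ f Ω :=
  contDiffOn_infty.2 fun n => contDiffOn_nat b hΩ n f hf

end SepHol

end Separate

/-! ## A Harnack estimate for approximate global holomorphic functions -/

section Harnack

open Metric

theorem norm_sub_le_norm_add_conj {a z : ℂ} (ha : 0 ≤ a.re) (hz : 0 ≤ z.re) :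
    ‖z - a‖ ≤ ‖z + star a‖ := by
  rw [← abs_norm, ← abs_norm (z + _), ← sq_le_sq, ← Complex.normSq_eq_norm_sq,
    ← Complex.normSq_eq_norm_sq, Complex.normSq_apply, Complex.normSq_apply]
  simp
  nlinarith [mul_nonneg ha hz]

/-- The Cayley transform `(F - a) / (F + ā)` with `a = F 0` maps into the unit disc and vanishes at
`0`. On the disc of radius `3/2` the Schwarz lemma bounds it by `2/3` at `1`, and `5 = (1 + 2/3) /
(1 - 2/3)`. -/
theorem re_le_of_nonneg_re {F : ℂ → ℂ} (hF : DifferentiableOn ℂ F (ball 0 (3 / 2)))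
    (hpos : ∀ ζ ∈ ball (0 : ℂ) (3 / 2), 0 ≤ (F ζ).re) (h0 : 0 < (F 0).re) :
    (F 1).re ≤ 5 * (F 0).re := by
  set a := F 0 with ha
  have hne : ∀ ζ ∈ ball (0 : ℂ) (3 / 2), F ζ + star a ≠ 0 := fun ζ hζ h => by
    have := congrArg Complex.re h
    simp at this
    linarith [hpos ζ hζ]
  have hd : DifferentiableOn ℂ (fun ζ => (F ζ - a) / (F ζ + star a)) (ball 0 (3 / 2)) :=
    (hF.sub_const a).div (hF.add_const _) hne
  have hm : Set.MapsTo (fun ζ => (F ζ - a) / (F ζ + star a)) (ball 0 (3 / 2))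
      (closedBall ((F 0 - a) / (F 0 + star a)) 1) := fun ζ hζ => by
    rw [← ha, sub_self, zero_div, mem_closedBall, dist_zero_right, norm_div]
    exact div_le_one_of_le₀ (norm_sub_le_norm_add_conj h0.le (hpos ζ hζ)) (norm_nonneg _)
  have h1 : (1 : ℂ) ∈ ball (0 : ℂ) (3 / 2) := by simp; norm_num
  have key := Complex.dist_le_div_mul_dist_of_mapsTo_ball hd hm h1
  simp only [← ha, sub_self, zero_div, dist_zero_right, norm_div, norm_one, mul_one] at key
  rw [div_le_iff₀ (norm_pos_iff.2 (hne 1 h1))] at key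
  have h2 : ‖F 1 - a‖ ^ 2 ≤ (1 / (3 / 2) * ‖F 1 + star a‖) ^ 2 :=
    pow_le_pow_left₀ (norm_nonneg _) key 2
  rw [mul_pow, ← Complex.normSq_eq_norm_sq, ← Complex.normSq_eq_norm_sq, Complex.normSq_apply,
    Complex.normSq_apply] at h2
  simp at h2
  have h3 := hpos 1 h1
  by_contra! h4
  -- Numerator and denominator of the Cayley transform have the same imaginary part, so the squared
  -- inequality passes to the real parts alone.
  have h6 : ((F 1).re - a.re) * ((F 1).re - a.re) ≤
      4 / 9 * (((F 1).re + a.re) * ((F 1).re + a.re)) := by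
    nlinarith [mul_self_nonneg ((F 1).im - a.im)]
  nlinarith

variable {E : Type*} [NormedAddCommGroup E] [NormedSpace ℂ E]

/-- **Harnack's inequality** for real parts of holomorphic functions on a ball. -/
theorem sub_re_le_of_re_le {f : E → ℂ} {c p q : E} {R A : ℝ} (hf : DifferentiableOn ℂ f (ball c R))
    (hA : ∀ z ∈ ball c R, (f z).re ≤ A) (hp : p ∈ ball c (R / 4)) (hq : q ∈ ball c (R / 4)) :
    A - (f p).re ≤ 5 * (A - (f q).re) := by
  -- The quarter radius is what makes the complex line through `q` and `p` usable up to `|ζ| < 3/2`: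
  -- `R/4 + (3/2)(R/2) = R`.
  have hmem : ∀ ζ ∈ ball (0 : ℂ) (3 / 2), q + ζ • (p - q) ∈ ball c R := fun ζ hζ => by
    rw [mem_ball_zero_iff] at hζ
    rw [mem_ball, dist_eq_norm] at hp hq ⊢
    have h1 : ‖p - q‖ ≤ ‖p - c‖ + ‖q - c‖ := by
      have := norm_sub_le (p - c) (q - c)
      rwa [sub_sub_sub_cancel_right] at this
    calc ‖q + ζ • (p - q) - c‖ = ‖(q - c) + ζ • (p - q)‖ := by congr 1; abel
      _ ≤ ‖q - c‖ + ‖ζ‖ * ‖p - q‖ := by rw [← norm_smul]; exact norm_add_le _ _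
      _ ≤ ‖q - c‖ + 3 / 2 * ‖p - q‖ := by gcongr
      _ < R := by linarith
  have hG : DifferentiableOn ℂ (fun ζ : ℂ => f (q + ζ • (p - q))) (ball 0 (3 / 2)) :=
    hf.comp (by fun_prop) hmem
  -- The shift by `ε/4` makes the real part strictly positive at the centre; it costs `5ε/4 - ε/4 =
  -- ε`.
  refine le_of_forall_pos_le_add fun ε hε => ?_
  have := re_le_of_nonneg_re (F := fun ζ : ℂ => ((A + ε / 4 : ℝ) : ℂ) - f (q + ζ • (p - q)))
    (hG.const_sub _) (fun ζ hζ => by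
      have := hA _ (hmem ζ hζ)
      rw [Complex.sub_re, Complex.ofReal_re]
      linarith) (by
      have := hA _ (hmem 0 (by simp))
      rw [Complex.sub_re, Complex.ofReal_re]
      linarith)
  simp only [Complex.sub_re, Complex.ofReal_re, one_smul, zero_smul, add_zero,
    add_sub_cancel] at this
  linarith

variable {X : Type*} [TopologicalSpace X] [ChartedSpace E X]

/-- The ball of radius `r` about `x` in the preferred chart at `x`. -/
def chartBall (E : Type*) [NormedAddCommGroup E] [NormedSpace ℂ E] {X : Type*} [TopologicalSpace X]
    [ChartedSpace E X] (x : X) (r : ℝ) : Set X :=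
  (chartAt E x).symm '' ball (chartAt E x x) r

theorem isOpen_chartBall {x : X} {r : ℝ} (h : ball (chartAt E x x) r ⊆ (chartAt E x).target) :
    IsOpen (chartBall E x r) :=
  (chartAt E x).isOpen_image_symm_of_subset_target isOpen_ball h

theorem mem_chartBall_self {x : X} {r : ℝ} (hr : 0 < r) : x ∈ chartBall E x r :=
  ⟨chartAt E x x, mem_ball_self hr, (chartAt E x).left_inv (mem_chart_source E x)⟩

theorem chartBall_mono {x : X} {r s : ℝ} (h : r ≤ s) : chartBall E x r ⊆ chartBall E x s :=
  Set.image_mono (ball_subset_ball h)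

/-- Families of holomorphic functions on chart balls which agree up to `ε` on overlaps. -/
structure AlmostGlobal (F : Finset X) (r : X → ℝ) (f : X → X → ℂ) (ε : ℝ) : Prop where
  hol : ∀ x ∈ F, DifferentiableOn ℂ (fun z => f x ((chartAt E x).symm z))
    (ball (chartAt E x x) (r x))
  close : ∀ x ∈ F, ∀ y ∈ F, ∀ p ∈ chartBall E x (r x) ∩ chartBall E y (r y), ‖f x p - f y p‖ ≤ ε

theorem AlmostGlobal.const_mul {F : Finset X} {r : X → ℝ} {f : X → X → ℂ} {ε : ℝ}
    (h : AlmostGlobal (E := E) F r f ε) {a : ℂ} (ha : ‖a‖ = 1) :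
    AlmostGlobal (E := E) F r (fun x p => a * f x p) ε :=
  ⟨fun x hx => (h.hol x hx).const_mul a, fun x hx y hy p hp => by
    rw [← mul_sub, norm_mul, ha, one_mul]
    exact h.close x hx y hy p hp⟩

/-- Deviations from an upper bound of the real part are comparable at `p` and `q`, uniformly for
all almost global functions. -/
def Comparable (E : Type*) [NormedAddCommGroup E] [NormedSpace ℂ E] {X : Type*} [TopologicalSpace X]
    [ChartedSpace E X] (F : Finset X) (r : X → ℝ) (C : ℝ) (p q : X) : Prop :=
  ∀ (f : X → X → ℂ) (ε A : ℝ), 0 ≤ ε → AlmostGlobal (E := E) F r f ε →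
    (∀ x ∈ F, ∀ p ∈ chartBall E x (r x), (f x p).re ≤ A) →
    ∀ x ∈ F, ∀ y ∈ F, p ∈ chartBall E x (r x) → q ∈ chartBall E y (r y) →
      A - (f x p).re ≤ C * (A - (f y q).re) + C * ε

variable {F : Finset X} {r : X → ℝ}

/-- Harnack gives the factor `5` for the member of index `z`. Passing from the members of indices
`x` and `y` to it costs `ε` at `p` and `5ε` at `q`, whence the constant `6`. -/
theorem comparable_of_mem {z p q : X} (hz : z ∈ F) (hr : 0 < r z)
    (hp : p ∈ chartBall E z (r z / 4)) (hq : q ∈ chartBall E z (r z / 4)) :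
    Comparable E F r 6 p q := by
  intro f ε A hε hf hA x hx y hy hpx hqy
  obtain ⟨p', hp', rfl⟩ := hp
  obtain ⟨q', hq', rfl⟩ := hq
  have hle : r z / 4 ≤ r z := by linarith
  have hpz : (chartAt E z).symm p' ∈ chartBall E z (r z) := ⟨p', ball_subset_ball hle hp', rfl⟩
  have hqz : (chartAt E z).symm q' ∈ chartBall E z (r z) := ⟨q', ball_subset_ball hle hq', rfl⟩
  have h1 := sub_re_le_of_re_le (hf.hol z hz) (fun w hw => hA z hz _ ⟨w, hw, rfl⟩) hp' hq'
  have h2 := (Complex.abs_re_le_norm _).trans (hf.close x hx z hz _ ⟨hpx, hpz⟩)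
  have h3 := (Complex.abs_re_le_norm _).trans (hf.close y hy z hz _ ⟨hqy, hqz⟩)
  rw [Complex.sub_re, abs_le] at h2 h3
  linarith [hA y hy _ hqy]

theorem Comparable.trans (hcov : ∀ p, ∃ x ∈ F, p ∈ chartBall E x (r x)) {C C' : ℝ}
    (hC : 0 ≤ C) {p q s : X} (h : Comparable E F r C p q)
    (h' : Comparable E F r C' q s) : Comparable E F r (C * C' + C) p s := by
  intro f ε A hε hf hA x hx y hy hpx hsy
  obtain ⟨z, hz, hqz⟩ := hcov q
  have h1 := h f ε A hε hf hA x hx z hz hpx hqz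
  have h2 := h' f ε A hε hf hA z hz y hy hqz hsy
  have h3 := mul_le_mul_of_nonneg_left h2 hC
  have h4 := mul_nonneg hC (sub_nonneg.2 (hA y hy s hsy))
  nlinarith

/-- A Harnack chain in topological form: the points comparable to `p` form a clopen set, because any
two points of one quarter ball are comparable with constant `6`. -/
theorem exists_comparable
    (hball : ∀ x ∈ F, 0 < r x ∧ ball (chartAt E x x) (r x) ⊆ (chartAt E x).target)
    (hcov : ∀ p, ∃ x ∈ F, p ∈ chartBall E x (r x / 4)) {p q : X} (hq : q ∈ connectedComponent p) :
    ∃ C, 0 ≤ C ∧ Comparable E F r C p q := by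
  have hcov' : ∀ p, ∃ x ∈ F, p ∈ chartBall E x (r x) := fun p => by
    obtain ⟨x, hx, hp⟩ := hcov p
    exact ⟨x, hx, chartBall_mono (by linarith [(hball x hx).1]) hp⟩
  have hnear : ∀ q : X, ∃ V ∈ 𝓝 q, ∀ s ∈ V, ∀ s' ∈ V, Comparable E F r 6 s s' := fun q => by
    obtain ⟨z, hz, hqz⟩ := hcov q
    have hsub : ball (chartAt E z z) (r z / 4) ⊆ (chartAt E z).target :=
      (ball_subset_ball (by linarith [(hball z hz).1])).trans (hball z hz).2
    exact ⟨_, (isOpen_chartBall hsub).mem_nhds hqz,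
      fun s hs s' hs' => comparable_of_mem hz (hball z hz).1 hs hs'⟩
  set S : Set X := {q | ∃ C, 0 ≤ C ∧ Comparable E F r C p q} with hS
  have hstep : ∀ s s', s ∈ S → Comparable E F r 6 s s' → s' ∈ S := by
    rintro s s' ⟨C, hC, h⟩ h'
    exact ⟨C * 6 + C, by positivity, h.trans hcov' hC h'⟩
  have hclopen : IsClopen S := by
    constructor
    · refine ⟨isOpen_iff_mem_nhds.2 fun s hs => ?_⟩
      obtain ⟨V, hV, hV'⟩ := hnear s
      filter_upwards [hV] with s' hs' hs'S
      exact hs (hstep s' s hs'S (hV' _ hs' _ (mem_of_mem_nhds hV)))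
    · refine isOpen_iff_mem_nhds.2 fun s hs => ?_
      obtain ⟨V, hV, hV'⟩ := hnear s
      filter_upwards [hV] with s' hs'
      exact hstep s s' hs (hV' _ (mem_of_mem_nhds hV) _ hs')
  have hpS : p ∈ S := by
    obtain ⟨V, hV, hV'⟩ := hnear p
    exact ⟨6, by norm_num, hV' _ (mem_of_mem_nhds hV) _ (mem_of_mem_nhds hV)⟩
  exact hclopen.connectedComponent_subset hpS hq

/-- An approximate maximum principle. With `A` the supremum of all real parts, comparison with the
base point, where the value is `0`, gives `A ≤ C (A - Re f) + C ε` at every point. Approaching the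
supremum gives `A ≤ C ε`. -/
theorem exists_re_bound
    (hball : ∀ x ∈ F, 0 < r x ∧ ball (chartAt E x x) (r x) ⊆ (chartAt E x).target)
    (hcov : ∀ p, ∃ x ∈ F, p ∈ chartBall E x (r x / 4)) {β : X → X} (hβF : ∀ x ∈ F, β x ∈ F)
    (hβ : ∀ x, x ∈ connectedComponent (β x)) :
    ∃ C, 0 ≤ C ∧ ∀ (f : X → X → ℂ) (ε : ℝ), 0 ≤ ε → AlmostGlobal (E := E) F r f ε →
      (∃ M, ∀ x ∈ F, ∀ p ∈ chartBall E x (r x), ‖f x p‖ ≤ M) →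
      (∀ x ∈ F, f (β x) (β x) = 0) → ∀ x ∈ F, ∀ p ∈ chartBall E x (r x), (f x p).re ≤ C * ε := by
  have hcov' : ∀ p, ∃ x ∈ F, p ∈ chartBall E x (r x) := fun p => by
    obtain ⟨x, hx, hp⟩ := hcov p
    exact ⟨x, hx, chartBall_mono (by linarith [(hball x hx).1]) hp⟩
  choose K hK0 hK using fun x : X => exists_comparable hball hcov (hβ x)
  -- Summation turns the finitely many constants into one: each point lies in a quarter ball about
  -- some `x ∈ F` (factor `6`), and `x` is comparable to its base point (factor `K x`).
  set C : ℝ := ∑ x ∈ F, (K x * 6 + K x) with hC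
  have hC0 : 0 ≤ C := Finset.sum_nonneg fun x _ => by have := hK0 x; positivity
  refine ⟨C, hC0, fun f ε hε hf ⟨M, hM⟩ h0 x₀ hx₀ p₀ hp₀ => ?_⟩
  set S : Set ℝ := {a | ∃ x ∈ F, ∃ p ∈ chartBall E x (r x), (f x p).re = a} with hS
  have hbdd : BddAbove S := ⟨M, by
    rintro _ ⟨x, hx, p, hp, rfl⟩
    exact (Complex.re_le_norm _).trans (hM x hx p hp)⟩
  have hne : S.Nonempty := ⟨_, x₀, hx₀, p₀, hp₀, rfl⟩
  set A := sSup S with hA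
  have hfA : ∀ x ∈ F, ∀ p ∈ chartBall E x (r x), (f x p).re ≤ A := fun x hx p hp =>
    le_csSup hbdd ⟨x, hx, p, hp, rfl⟩
  have hkey : ∀ y ∈ F, ∀ p ∈ chartBall E y (r y), A ≤ C * (A - (f y p).re) + C * ε := by
    intro y hy p hp
    obtain ⟨x, hx, hpx⟩ := hcov p
    have h1 := (hK x).trans hcov' (hK0 x)
      (comparable_of_mem hx (hball x hx).1 (mem_chartBall_self (by linarith [(hball x hx).1])) hpx)
    have h2 := h1 f ε A hε hf hfA (β x) (hβF x hx) y hy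
      (mem_chartBall_self (hball _ (hβF x hx)).1) hp
    rw [h0 x hx, Complex.zero_re, sub_zero] at h2
    have h3 : K x * 6 + K x ≤ C := Finset.single_le_sum
      (f := fun x => K x * 6 + K x) (fun x _ => by have := hK0 x; positivity) hx
    have h4 := sub_nonneg.2 (hfA y hy p hp)
    calc A ≤ _ := h2
      _ ≤ _ := by gcongr
  have hA0 : A ≤ C * ε := by
    rcases hC0.eq_or_lt with h | h
    · have := hkey x₀ hx₀ p₀ hp₀
      rw [← h] at this ⊢
      linarith
    · have : A ≤ A - (A - C * ε) / C := csSup_le hne (by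
        rintro _ ⟨x, hx, p, hp, rfl⟩
        have h1 : (A - C * ε) / C ≤ A - (f x p).re := by
          rw [div_le_iff₀ h]
          linarith [hkey x hx p hp]
        linarith)
      have h2 : (A - C * ε) / C ≤ 0 := by linarith
      have := (div_le_iff₀ h).1 h2
      linarith
  exact (hfA x₀ hx₀ p₀ hp₀).trans hA0

/-- The one-sided bound on real parts is applied to `f`, `-f`, `i f` and `-i f`. -/
theorem exists_norm_bound
    (hball : ∀ x ∈ F, 0 < r x ∧ ball (chartAt E x x) (r x) ⊆ (chartAt E x).target)
    (hcov : ∀ p, ∃ x ∈ F, p ∈ chartBall E x (r x / 4)) {β : X → X} (hβF : ∀ x ∈ F, β x ∈ F)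
    (hβ : ∀ x, x ∈ connectedComponent (β x)) :
    ∃ C, 0 ≤ C ∧ ∀ (f : X → X → ℂ) (ε : ℝ), 0 ≤ ε → AlmostGlobal (E := E) F r f ε →
      (∃ M, ∀ x ∈ F, ∀ p ∈ chartBall E x (r x), ‖f x p‖ ≤ M) →
      (∀ x ∈ F, f (β x) (β x) = 0) → ∀ x ∈ F, ∀ p ∈ chartBall E x (r x), ‖f x p‖ ≤ C * ε := by
  obtain ⟨C, hC, h⟩ := exists_re_bound hball hcov hβF hβ
  refine ⟨C + C, by positivity, fun f ε hε hf ⟨M, hM⟩ h0 x hx p hp => ?_⟩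
  have key : ∀ a : ℂ, ‖a‖ = 1 → (a * f x p).re ≤ C * ε := fun a ha =>
    h (fun x p => a * f x p) ε hε (hf.const_mul ha)
      ⟨M, fun x hx p hp => by rw [norm_mul, ha, one_mul]; exact hM x hx p hp⟩
      (fun x hx => by simp [h0 x hx]) x hx p hp
  have h1 := key 1 (by simp)
  have h2 := key (-1) (by simp)
  have h3 := key Complex.I (by simp)
  have h4 := key (-Complex.I) (by simp)
  simp at h1 h2 h3 h4
  have h5 : |(f x p).re| ≤ C * ε := abs_le.2 ⟨by linarith, by linarith⟩
  have h6 : |(f x p).im| ≤ C * ε := abs_le.2 ⟨by linarith, by linarith⟩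
  linarith [Complex.norm_le_abs_re_add_abs_im (f x p)]

end Harnack

/-! ## Holomorphic dependence of normalized sections on parameters -/

section Parameters

open Metric

/-- The difference quotients form a Cauchy filter at `0`, so they converge by completeness; no
candidate for the derivative is needed. -/
theorem differentiableAt_of_slope_cauchy {f : ℂ → ℂ} {R K : ℝ} (hR : 0 < R)
    (h : ∀ a b : ℂ, a ≠ 0 → b ≠ 0 → ‖a‖ < R → ‖b‖ < R →
      ‖(f a - f 0) / a - (f b - f 0) / b‖ ≤ K * (‖a‖ + ‖b‖)) : DifferentiableAt ℂ f 0 := by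
  have hc : Cauchy (Filter.map (fun a : ℂ => (f a - f 0) / a) (𝓝[≠] 0)) := by
    rw [Metric.cauchy_iff]
    refine ⟨inferInstance, fun ε hε => ?_⟩
    obtain ⟨ρ, hρ, hρε⟩ := exists_pos_mul_lt' hε (show 0 ≤ 2 * |K| by positivity)
    refine ⟨_, Filter.image_mem_map (Filter.inter_mem self_mem_nhdsWithin
      (nhdsWithin_le_nhds (ball_mem_nhds (0 : ℂ) (lt_min hR hρ)))), ?_⟩
    rintro _ ⟨a, ⟨ha0, ha⟩, rfl⟩ _ ⟨b, ⟨hb0, hb⟩, rfl⟩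
    rw [mem_ball_zero_iff, lt_min_iff] at ha hb
    rw [dist_eq_norm]
    calc _ ≤ K * (‖a‖ + ‖b‖) := h a b ha0 hb0 ha.1 hb.1
      _ ≤ |K| * (ρ + ρ) := by gcongr; exacts [le_abs_self K, ha.2.le, hb.2.le]
      _ < ε := by linarith
  obtain ⟨l, hl⟩ := CompleteSpace.complete hc
  refine HasDerivAt.differentiableAt (f' := l) ?_
  rw [hasDerivAt_iff_tendsto_slope_zero]
  refine Filter.Tendsto.congr (fun a => ?_) hl
  simp [div_eq_inv_mul]

variable {T : Type*} [NormedAddCommGroup T] [NormedSpace ℂ T] {ι X : Type*}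

/-- Solutions `u t` of the gluing problem `u x = g x y * u y`, normalized by membership of `u t - 1`
in a space `𝒜` of families of functions for which an estimate in terms of the differences on the
overlaps is available; `t` varies in a small ball. -/
structure ParamGluing (D : ι → Set X) (𝒜 : Submodule ℂ (ι → X → ℂ)) (C : ℝ) (B : Set T)
    (g : ι → ι → X → T → ℂ) (u : T → ι → X → ℂ) : Prop where
  nonneg : 0 ≤ C
  bounded : ∀ f ∈ 𝒜, ∃ M, ∀ x, ∀ p ∈ D x, ‖f x p‖ ≤ M
  estimate : ∀ f ∈ 𝒜, ∀ η, 0 ≤ η → (∀ x y, ∀ p ∈ D x ∩ D y, ‖f x p - f y p‖ ≤ η) →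
    ∀ x, ∀ p ∈ D x, ‖f x p‖ ≤ C * η
  diff : ∀ x y, ∀ p ∈ D x ∩ D y, ∀ t ∈ B, DifferentiableAt ℂ (g x y p) t
  small : ∀ x y, ∀ p ∈ D x ∩ D y, ∀ t ∈ B, ‖g x y p t - 1‖ ≤ 1 / (2 * C + 1)
  sub_one_mem : ∀ t ∈ B, u t - 1 ∈ 𝒜
  glue : ∀ t ∈ B, ∀ x y, ∀ p ∈ D x ∩ D y, u t x p = g x y p t * u t y p

namespace ParamGluing

variable {D : ι → Set X} {𝒜 : Submodule ℂ (ι → X → ℂ)} {C : ℝ} {B : Set T}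
  {g : ι → ι → X → T → ℂ} {u : T → ι → X → ℂ}

theorem sub_mem (h : ParamGluing D 𝒜 C B g u) {s t : T} (hs : s ∈ B) (ht : t ∈ B) :
    u s - u t ∈ 𝒜 := by
  have := 𝒜.sub_mem (h.sub_one_mem s hs) (h.sub_one_mem t ht)
  rwa [sub_sub_sub_cancel_right] at this

/-- Replacing `f x - f y` by `f x - g x y * f y` changes the overlap error by at most `sup |f| / (2C
+ 1)`. After multiplication by `C` this is at most half of `sup |f|`, hence absorbed on the left;
boundedness makes that supremum finite. -/
theorem twisted_estimate (h : ParamGluing D 𝒜 C B g u) {t : T} (ht : t ∈ B) {f : ι → X → ℂ}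
    (hf : f ∈ 𝒜) {η : ℝ} (hη : 0 ≤ η)
    (hfη : ∀ x y, ∀ p ∈ D x ∩ D y, ‖f x p - g x y p t * f y p‖ ≤ η) :
    ∀ x, ∀ p ∈ D x, ‖f x p‖ ≤ 2 * C * η := by
  have hC := h.nonneg
  intro x₀ p₀ hp₀
  obtain ⟨M, hM⟩ := h.bounded f hf
  set S : Set ℝ := {a | ∃ x, ∃ p ∈ D x, ‖f x p‖ = a} with hS
  have hbdd : BddAbove S := ⟨M, by rintro _ ⟨x, p, hp, rfl⟩; exact hM x p hp⟩
  have hle : ∀ x, ∀ p ∈ D x, ‖f x p‖ ≤ sSup S := fun x p hp => le_csSup hbdd ⟨x, p, hp, rfl⟩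
  have hS0 : 0 ≤ sSup S := (norm_nonneg _).trans (hle x₀ p₀ hp₀)
  have h1 : ∀ x, ∀ p ∈ D x, ‖f x p‖ ≤ C * (η + 1 / (2 * C + 1) * sSup S) := by
    refine h.estimate f hf _ (by positivity) fun x y p hp => ?_
    have : f x p - f y p = (f x p - g x y p t * f y p) + (g x y p t - 1) * f y p := by ring
    rw [this]
    refine (norm_add_le _ _).trans (add_le_add (hfη x y p hp) ?_)
    rw [norm_mul]
    gcongr
    exacts [h.small x y p hp t ht, hle y p hp.2]
  have h2 : sSup S ≤ C * (η + 1 / (2 * C + 1) * sSup S) :=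
    csSup_le ⟨_, x₀, p₀, hp₀, rfl⟩ (by rintro _ ⟨x, p, hp, rfl⟩; exact h1 x p hp)
  have h3 : C * (1 / (2 * C + 1)) ≤ 1 / 2 := by
    rw [mul_one_div, div_le_div_iff₀ (by positivity) (by norm_num)]
    linarith
  have h4 : C * (1 / (2 * C + 1)) * sSup S ≤ 1 / 2 * sSup S := by gcongr
  have h5 := hle x₀ p₀ hp₀
  linarith

theorem norm_sub_one_le (h : ParamGluing D 𝒜 C B g u) {x y : ι} {p : X} (hp : p ∈ D x ∩ D y)
    {t : T} (ht : t ∈ B) : ‖g x y p t - 1‖ ≤ 1 := by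
  have hC := h.nonneg
  refine (h.small x y p hp t ht).trans ?_
  rw [div_le_one (by positivity)]
  linarith

/-- The twisted defect of `u t - 1` is `g - 1`, so the twisted estimate gives `|u t - 1| ≤ 2C / (2C
+ 1) ≤ 1`. -/
theorem norm_le_two (h : ParamGluing D 𝒜 C B g u) {t : T} (ht : t ∈ B) {x : ι} {p : X}
    (hp : p ∈ D x) : ‖u t x p‖ ≤ 2 := by
  have hC := h.nonneg
  have h1 := h.twisted_estimate ht (h.sub_one_mem t ht) (η := 1 / (2 * C + 1)) (by positivity)
    (fun x y p hp => by
      have : (u t - 1) x p - g x y p t * (u t - 1) y p = g x y p t - 1 := by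
        simp only [Pi.sub_apply, Pi.one_apply, h.glue t ht x y p hp]
        ring
      rw [this]
      exact h.small x y p hp t ht) x p hp
  have h2 : 2 * C * (1 / (2 * C + 1)) ≤ 1 := by
    rw [mul_one_div, div_le_one (by positivity)]
    linarith
  have h3 : u t x p = (u t - 1) x p + 1 := by simp
  rw [h3]
  refine (norm_add_le _ _).trans ?_
  rw [norm_one]
  linarith

theorem norm_transition_sub_le (h : ParamGluing D 𝒜 C B g u) {t : T} {ρ : ℝ}
    (hB : ball t ρ ⊆ B) {x y : ι} {p : X} (hp : p ∈ D x ∩ D y) {s : T} (hs : s ∈ ball t ρ) :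
    ‖g x y p s - g x y p t‖ ≤ 2 / ρ * ‖s - t‖ := by
  have hρ : 0 < ρ := pos_of_mem_ball hs
  have ht := hB (mem_ball_self hρ)
  have := Complex.dist_le_div_mul_dist_of_mapsTo_ball (f := g x y p) (c := t) (R₁ := ρ) (R₂ := 2)
    (fun s hs => (h.diff x y p hp s (hB hs)).differentiableWithinAt) (fun s hs => by
      rw [mem_closedBall, dist_eq_norm]
      have h1 := h.norm_sub_one_le hp (hB hs)
      have h2 := h.norm_sub_one_le hp ht
      have h3 := norm_sub_le (g x y p s - 1) (g x y p t - 1)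
      rw [sub_sub_sub_cancel_right] at h3
      linarith) hs
  rwa [dist_eq_norm, dist_eq_norm] at this

/-- The twisted defect of `u s - u t` with respect to `g t` is `(g s - g t) * u s`. The first factor
is controlled by the Schwarz lemma and the second by `2`, uniformly in the point of `X`. -/
theorem lipschitz (h : ParamGluing D 𝒜 C B g u) {t : T} {ρ : ℝ} (hB : ball t ρ ⊆ B) {s : T}
    (hs : s ∈ ball t ρ) {x : ι} {p : X} (hp : p ∈ D x) :
    ‖u s x p - u t x p‖ ≤ 2 * C * (4 / ρ * ‖s - t‖) := by
  have hρ : 0 < ρ := pos_of_mem_ball hs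
  have ht := hB (mem_ball_self hρ)
  refine h.twisted_estimate ht (h.sub_mem (hB hs) ht) (by positivity) (fun x y p hp => ?_) x p hp
  have : (u s - u t) x p - g x y p t * (u s - u t) y p = (g x y p s - g x y p t) * u s y p := by
    simp only [Pi.sub_apply, h.glue s (hB hs) x y p hp, h.glue t ht x y p hp]
    ring
  rw [this, norm_mul]
  calc _ ≤ 2 / ρ * ‖s - t‖ * 2 := by
        gcongr
        exacts [h.norm_transition_sub_le hB hp hs, h.norm_le_two (hB hs) hp.2]
    _ = _ := by ring

/-- The twisted estimate is applied to the difference of two difference quotients of `u`. With `γ`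
the difference quotients of the transition functions, its twisted defect is `(γ a - γ b) u_a + γ b
(u_a - u_b)`, which is `O(|a| + |b|)` by the quantitative slope bound and the Lipschitz bound. -/
theorem differentiableAt_line (h : ParamGluing D 𝒜 C B g u) (hB : IsOpen B) {t : T} (ht : t ∈ B)
    (e : T) {x : ι} {p : X} (hp : p ∈ D x) :
    DifferentiableAt ℂ (fun ζ : ℂ => u (t + ζ • e) x p) 0 := by
  have hC := h.nonneg
  obtain ⟨ρ, hρ, hρB⟩ := Metric.isOpen_iff.1 hB t ht
  obtain ⟨R, hR, hRρ⟩ := exists_pos_mul_lt' hρ (norm_nonneg e)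
  have hmem : ∀ a : ℂ, ‖a‖ < R → t + a • e ∈ ball t ρ := fun a ha => by
    rw [mem_ball, dist_eq_norm, add_sub_cancel_left, norm_smul]
    calc _ ≤ R * ‖e‖ := by gcongr
      _ < ρ := hRρ
  set γ : ι → ι → X → ℂ → ℂ := fun x y p a => (g x y p (t + a • e) - g x y p t) / a with hγ
  have hγ1 : ∀ x y, ∀ p ∈ D x ∩ D y, ∀ a b : ℂ, a ≠ 0 → b ≠ 0 → ‖a‖ < R → ‖b‖ < R →
      ‖γ x y p a - γ x y p b‖ ≤ 8 / R ^ 2 * (‖a‖ + ‖b‖) := by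
    intro x y p hp a b ha hb haR hbR
    have hd : DifferentiableOn ℂ (fun ζ : ℂ => g x y p (t + ζ • e)) (ball 0 R) := fun ζ hζ =>
      ((h.diff x y p hp _ (hρB (hmem ζ (mem_ball_zero_iff.1 hζ)))).comp ζ
        (f := fun ζ : ℂ => t + ζ • e) (by fun_prop)).differentiableWithinAt
    have hM : ∀ ζ ∈ ball (0 : ℂ) R, ‖g x y p (t + ζ • e)‖ ≤ 2 := fun ζ hζ => by
      have h1 := h.norm_sub_one_le hp (hρB (hmem ζ (mem_ball_zero_iff.1 hζ)))
      have h2 := norm_add_le (g x y p (t + ζ • e) - 1) 1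
      rw [sub_add_cancel, norm_one] at h2
      linarith
    have h1 := norm_slope_sub_deriv_le hR hd hM (mem_ball_zero_iff.2 haR) ha
    have h2 := norm_slope_sub_deriv_le hR hd hM (mem_ball_zero_iff.2 hbR) hb
    simp only [zero_smul, add_zero] at h1 h2
    have h3 := norm_sub_le (γ x y p a - deriv (fun ζ : ℂ => g x y p (t + ζ • e)) 0)
      (γ x y p b - deriv (fun ζ : ℂ => g x y p (t + ζ • e)) 0)
    rw [sub_sub_sub_cancel_right] at h3
    calc _ ≤ _ := h3
      _ ≤ 4 * 2 / R ^ 2 * ‖a‖ + 4 * 2 / R ^ 2 * ‖b‖ := add_le_add h1 h2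
      _ = _ := by ring
  have hγ2 : ∀ x y, ∀ p ∈ D x ∩ D y, ∀ a : ℂ, a ≠ 0 → ‖a‖ < R →
      ‖γ x y p a‖ ≤ 2 / ρ * ‖e‖ := by
    intro x y p hp a ha haR
    rw [hγ, norm_div, div_le_iff₀ (norm_pos_iff.2 ha)]
    have := h.norm_transition_sub_le hρB hp (hmem a haR)
    rw [add_sub_cancel_left, norm_smul] at this
    linarith
  have hlip : ∀ a : ℂ, ‖a‖ < R → ∀ x, ∀ p ∈ D x,
      ‖u (t + a • e) x p - u t x p‖ ≤ 2 * C * (4 / ρ * ‖e‖) * ‖a‖ := by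
    intro a ha x p hp
    have := h.lipschitz hρB (hmem a ha) hp
    rw [add_sub_cancel_left, norm_smul] at this
    linarith
  refine differentiableAt_of_slope_cauchy hR (K := 2 * C * (8 / R ^ 2 * 2 +
    2 / ρ * ‖e‖ * (2 * C * (4 / ρ * ‖e‖)))) fun a b ha hb haR hbR => ?_
  simp only [zero_smul, add_zero]
  have haB := hρB (hmem a haR)
  have hbB := hρB (hmem b hbR)
  have hq : (a⁻¹ • (u (t + a • e) - u t) - b⁻¹ • (u (t + b • e) - u t)) ∈ 𝒜 :=
    𝒜.sub_mem (𝒜.smul_mem _ (h.sub_mem haB ht)) (𝒜.smul_mem _ (h.sub_mem hbB ht))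
  have key := h.twisted_estimate ht hq (η := (8 / R ^ 2 * 2 +
    2 / ρ * ‖e‖ * (2 * C * (4 / ρ * ‖e‖))) * (‖a‖ + ‖b‖)) (by positivity) (fun x y p hp => by
      have : (a⁻¹ • (u (t + a • e) - u t) - b⁻¹ • (u (t + b • e) - u t)) x p -
          g x y p t * (a⁻¹ • (u (t + a • e) - u t) - b⁻¹ • (u (t + b • e) - u t)) y p =
          (γ x y p a - γ x y p b) * u (t + a • e) y p +
          γ x y p b * ((u (t + a • e) y p - u t y p) - (u (t + b • e) y p - u t y p)) := by
        simp only [Pi.sub_apply, Pi.smul_apply, smul_eq_mul, h.glue _ haB x y p hp,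
          h.glue _ hbB x y p hp, h.glue t ht x y p hp, hγ]
        field_simp
        ring
      rw [this]
      have h1 := hγ1 x y p hp a b ha hb haR hbR
      have h2 := hγ2 x y p hp b hb hbR
      have h3 := (norm_sub_le _ _).trans (add_le_add (hlip a haR y p hp.2) (hlip b hbR y p hp.2))
      calc _ ≤ _ := norm_add_le _ _
        _ ≤ 8 / R ^ 2 * (‖a‖ + ‖b‖) * 2 + 2 / ρ * ‖e‖ *
            (2 * C * (4 / ρ * ‖e‖) * ‖a‖ + 2 * C * (4 / ρ * ‖e‖) * ‖b‖) := by
          rw [norm_mul, norm_mul]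
          gcongr
          exact h.norm_le_two haB hp.2
        _ = _ := by ring) x p hp
  simp only [Pi.sub_apply, Pi.smul_apply, smul_eq_mul] at key
  rw [div_eq_inv_mul, div_eq_inv_mul]
  calc _ ≤ _ := key
    _ = _ := by ring

end ParamGluing

end Parameters

/-! ### From the a priori estimates to smoothness on `X × T`. -/

section Core

open Metric

variable {E : Type*} [NormedAddCommGroup E] [NormedSpace ℂ E] {X : Type*} [TopologicalSpace X]
  [ChartedSpace E X]

/-- Bounded families of holomorphic functions on the chart balls about the points of `F`, vanishing
at the base points `β x`. -/
def normalizedCochains (E : Type*) [NormedAddCommGroup E] [NormedSpace ℂ E] {X : Type*}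
    [TopologicalSpace X] [ChartedSpace E X] (F : Finset X) (r : X → ℝ) (β : X → X) :
    Submodule ℂ (X → X → ℂ) where
  carrier := {f | (∀ x ∈ F, DifferentiableOn ℂ (fun z => f x ((chartAt E x).symm z))
    (ball (chartAt E x x) (r x))) ∧ (∃ M, ∀ x ∈ F, ∀ p ∈ chartBall E x (r x), ‖f x p‖ ≤ M) ∧
    ∀ x ∈ F, f (β x) (β x) = 0}
  zero_mem' := ⟨fun _ _ => differentiableOn_const 0, ⟨0, by simp⟩, by simp⟩
  add_mem' := by
    rintro f f' ⟨h1, ⟨M, h2⟩, h3⟩ ⟨h1', ⟨M', h2'⟩, h3'⟩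
    exact ⟨fun x hx => (h1 x hx).add (h1' x hx), ⟨M + M', fun x hx p hp =>
      (norm_add_le _ _).trans (add_le_add (h2 x hx p hp) (h2' x hx p hp))⟩,
      fun x hx => by simp [h3 x hx, h3' x hx]⟩
  smul_mem' := by
    rintro c f ⟨h1, ⟨M, h2⟩, h3⟩
    refine ⟨fun x hx => (h1 x hx).const_smul c, ⟨‖c‖ * M, fun x hx p hp => ?_⟩,
      fun x hx => by simp [h3 x hx]⟩
    simp only [Pi.smul_apply, norm_smul]
    gcongr
    exact h2 x hx p hp

theorem exists_chart_radius {E : Type*} [NormedAddCommGroup E] {X : Type*} [TopologicalSpace X]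
    [ChartedSpace E X] {T : Type*} [NormedAddCommGroup T] {t₀ : T} {x : X} {N : Set (X × T)} (hN : N ∈ 𝓝 (x, t₀)) :
    ∃ r > 0, closedBall (chartAt E x x) r ⊆ (chartAt E x).target ∧
      ∀ z ∈ closedBall (chartAt E x x) r, ∀ t ∈ ball t₀ r, ((chartAt E x).symm z, t) ∈ N := by
  have hx : x ∈ (chartAt E x).source := mem_chart_source E x
  have hc : ContinuousAt (fun q : E × T => ((chartAt E x).symm q.1, q.2)) (chartAt E x x, t₀) := by
    refine ContinuousAt.prodMk (ContinuousAt.comp (f := Prod.fst) ?_ continuousAt_fst)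
      continuousAt_snd
    exact (chartAt E x).continuousAt_symm ((chartAt E x).map_source hx)
  have h1 : ∀ᶠ q : E × T in 𝓝 (chartAt E x x, t₀), ((chartAt E x).symm q.1, q.2) ∈ N :=
    hc.eventually_mem (by simpa only [(chartAt E x).left_inv hx] using hN)
  have h2 : ∀ᶠ q : E × T in 𝓝 (chartAt E x x, t₀), q.1 ∈ (chartAt E x).target :=
    continuousAt_fst.eventually ((chartAt E x).open_target.mem_nhds ((chartAt E x).map_source hx))
  obtain ⟨r, hr, h⟩ := Metric.eventually_nhds_iff_ball.1 (h1.and h2)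
  refine ⟨r / 2, by positivity, fun z hz => ?_, fun z hz t ht => ?_⟩
  · refine (h (z, t₀) ?_).2
    rw [← ball_prod_same]
    exact ⟨closedBall_subset_ball (by linarith) hz, mem_ball_self hr⟩
  · refine (h (z, t) ?_).1
    rw [← ball_prod_same]
    exact ⟨closedBall_subset_ball (by linarith) hz, ball_subset_ball (by linarith) ht⟩

variable [FiniteDimensional ℂ E] [CompactSpace X] [T2Space X]
  {T : Type*} [NormedAddCommGroup T] [NormedSpace ℂ T] [FiniteDimensional ℂ T]

/-- Sections of a family of line bundles, normalized at the base points, depend smoothly on the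
parameter. -/
theorem contDiffAt_of_transition {t₀ : T} {N : X → Set (X × T)} (hN : ∀ x, IsOpen (N x))
    (hmem : ∀ x, (x, t₀) ∈ N x) {g : X → X → X × T → ℂ}
    (hg : ∀ x y, ContinuousOn (g x y) (N x ∩ N y))
    (hgt : ∀ x y, ∀ q ∈ N x ∩ N y, DifferentiableAt ℂ (fun t => g x y (q.1, t)) q.2)
    (hg1 : ∀ x y p, (p, t₀) ∈ N x ∩ N y → g x y (p, t₀) = 1) {u : X → X × T → ℂ}
    (hu : ∀ x, ∀ q ∈ N x, q.1 ∈ (chartAt E x).source →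
      DifferentiableAt ℂ (fun z => u x ((chartAt E x).symm z, q.2)) (chartAt E x q.1))
    (hug : ∀ x y, ∀ q ∈ N x ∩ N y, u x q = g x y q * u y q) {β : X → X}
    (hβ : ∀ x, x ∈ connectedComponent (β x)) (hββ : ∀ x, β (β x) = β x)
    (hu1 : ∀ x t, (β x, t) ∈ N (β x) → u (β x) (β x, t) = 1) (p₀ : X) :
    ContDiffAt ℂ ∞ (fun q : E × T => u p₀ ((chartAt E p₀).symm q.1, q.2)) (chartAt E p₀ p₀, t₀) := by
  classical
  have : ProperSpace E := FiniteDimensional.proper ℂ E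
  choose r hr0 hrt hrN using fun x => exists_chart_radius (E := E) ((hN x).mem_nhds (hmem x))
  have hsub : ∀ x, ball (chartAt E x x) (r x) ⊆ (chartAt E x).target := fun x =>
    ball_subset_closedBall.trans (hrt x)
  have hsub4 : ∀ x, ball (chartAt E x x) (r x / 4) ⊆ (chartAt E x).target := fun x =>
    (ball_subset_ball (by linarith [hr0 x])).trans (hsub x)
  obtain ⟨F₀, hF₀⟩ := CompactSpace.elim_nhds_subcover (fun x : X => chartBall E x (r x / 4))
    (fun x => (isOpen_chartBall (hsub4 x)).mem_nhds (mem_chartBall_self (by linarith [hr0 x])))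
  set F₁ := insert p₀ F₀ with hF₁
  -- The finite index set contains `p₀`, where the conclusion is wanted, and is stable under `β`, so
  -- that the normalization at the base points is visible to the estimate.
  set F := F₁ ∪ F₁.image β with hF
  have hp₀F : p₀ ∈ F := by simp [hF, hF₁]
  have hβF : ∀ x ∈ F, β x ∈ F := by
    intro x hx
    rcases Finset.mem_union.1 hx with h | h
    · exact Finset.mem_union_right _ (Finset.mem_image_of_mem _ h)
    · obtain ⟨y, hy, rfl⟩ := Finset.mem_image.1 h
      rw [hββ]
      exact hx
  have hcov : ∀ p, ∃ x ∈ F, p ∈ chartBall E x (r x / 4) := fun p => by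
    have : p ∈ ⋃ x ∈ F₀, chartBall E x (r x / 4) := hF₀ ▸ Set.mem_univ p
    obtain ⟨x, hx, hp⟩ := Set.mem_iUnion₂.1 this
    exact ⟨x, Finset.mem_union_left _ (Finset.mem_insert_of_mem hx), hp⟩
  obtain ⟨C, hC, hest⟩ := exists_norm_bound (F := F) (r := r) (β := β)
    (fun x _ => ⟨hr0 x, hsub x⟩) hcov hβF hβ
  set K : X → Set X := fun x => (chartAt E x).symm '' closedBall (chartAt E x x) (r x) with hK
  have hKc : ∀ x, IsCompact (K x) := fun x =>
    (isCompact_closedBall _ _).image_of_continuousOn ((chartAt E x).continuousOn_symm.mono (hrt x))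
  have hKs : ∀ x, K x ⊆ (chartAt E x).source := fun x => by
    rintro _ ⟨z, hz, rfl⟩
    exact (chartAt E x).map_target (hrt x hz)
  have hKN : ∀ x, ∀ p ∈ K x, ∀ t ∈ ball t₀ (r x), (p, t) ∈ N x := by
    rintro x _ ⟨z, hz, rfl⟩ t ht
    exact hrN x z hz t ht
  have hε : 0 < 1 / (2 * C + 1) := by positivity
  -- Compactness of the closed chart balls makes the transition functions close to their value `1`
  -- at `t₀`, uniformly over the overlaps, for all `t` near `t₀`.
  have hev : ∀ᶠ t in 𝓝 t₀, (∀ x ∈ F, t ∈ ball t₀ (r x)) ∧ ∀ x ∈ F, ∀ y ∈ F, ∀ p ∈ K x ∩ K y,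
      ‖g x y (p, t) - 1‖ < 1 / (2 * C + 1) := by
    refine Filter.Eventually.and ?_ ?_
    · exact (Filter.eventually_all_finset F).2 fun x _ => ball_mem_nhds _ (hr0 x)
    · refine (Filter.eventually_all_finset F).2 fun x _ =>
        (Filter.eventually_all_finset F).2 fun y _ => ?_
      refine ((hKc x).inter (hKc y)).eventually_forall_of_forall_eventually fun p hp => ?_
      have hpN : (p, t₀) ∈ N x ∩ N y :=
        ⟨hKN x p hp.1 t₀ (mem_ball_self (hr0 x)), hKN y p hp.2 t₀ (mem_ball_self (hr0 y))⟩
      have h1 : ContinuousAt (g x y) (p, t₀) :=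
        (hg x y _ hpN).continuousAt (((hN x).inter (hN y)).mem_nhds hpN)
      have h2 : ContinuousAt (fun q : T × X => g x y (q.2, q.1)) (t₀, p) :=
        ContinuousAt.comp (f := fun q : T × X => (q.2, q.1)) (g := g x y) h1 (by fun_prop)
      have h3 := (h2.sub_const 1).norm
      refine h3.eventually (gt_mem_nhds ?_)
      show ‖g x y (p, t₀) - 1‖ < _
      rw [hg1 x y p hpN, sub_self, norm_zero]
      exact hε
  obtain ⟨δ, hδ, hδ'⟩ := Metric.eventually_nhds_iff_ball.1 hev
  -- `D x` is empty unless `x ∈ F`; this encodes the finite cover while indexing by all of `X`.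
  set D : X → Set X := fun x => {p | x ∈ F ∧ p ∈ chartBall E x (r x)} with hD
  have hDK : ∀ x, D x ⊆ K x := fun x p hp => Set.image_mono ball_subset_closedBall hp.2
  have hDN : ∀ x, ∀ p ∈ D x, ∀ t ∈ ball t₀ δ, (p, t) ∈ N x := fun x p hp t ht =>
    hKN x p (hDK x hp) t ((hδ' t ht).1 x hp.1)
  have hudiff : ∀ x ∈ F, ∀ t ∈ ball t₀ δ, ∀ z ∈ closedBall (chartAt E x x) (r x),
      DifferentiableAt ℂ (fun z => u x ((chartAt E x).symm z, t)) z := fun x hx t ht z hz => by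
    have h1 : (chartAt E x).symm z ∈ K x := ⟨z, hz, rfl⟩
    have := hu x ((chartAt E x).symm z, t) (hKN x _ h1 t ((hδ' t ht).1 x hx)) (hKs x h1)
    rwa [(chartAt E x).right_inv (hrt x hz)] at this
  have hbdd : ∀ t ∈ ball t₀ δ, ∃ M, ∀ x ∈ F, ∀ p ∈ chartBall E x (r x), ‖u x (p, t)‖ ≤ M := by
    intro t ht
    have h1 : ∀ x : X, ∃ M : ℝ, 0 ≤ M ∧ (x ∈ F → ∀ p ∈ chartBall E x (r x), ‖u x (p, t)‖ ≤ M) := by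
      intro x
      by_cases hx : x ∈ F
      · obtain ⟨M, hM⟩ := (isCompact_closedBall (chartAt E x x) (r x)).exists_bound_of_continuousOn
          (f := fun z => u x ((chartAt E x).symm z, t))
          (fun z hz => (hudiff x hx t ht z hz).continuousAt.continuousWithinAt)
        refine ⟨|M|, abs_nonneg M, ?_⟩
        rintro _ _ ⟨z, hz, rfl⟩
        exact (hM z (ball_subset_closedBall hz)).trans (le_abs_self M)
      · exact ⟨0, le_rfl, fun h => absurd h hx⟩
    choose M hM0 hM using h1
    exact ⟨∑ x ∈ F, M x, fun x hx p hp => (hM x hx p hp).trans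
      (Finset.single_le_sum (fun x _ => hM0 x) hx)⟩
  have hP : ParamGluing D (normalizedCochains E F r β) C (ball t₀ δ) (fun x y p t => g x y (p, t))
      (fun t x p => u x (p, t)) := by
    refine ⟨hC, fun f ⟨_, ⟨M, hM⟩, _⟩ => ⟨M, fun x p hp => hM x hp.1 p hp.2⟩, ?_, ?_, ?_, ?_, ?_⟩
    · rintro f ⟨h1, h2, h3⟩ η hη h4 x p hp
      exact hest f η hη ⟨h1, fun x hx y hy p hp => h4 x y p ⟨⟨hx, hp.1⟩, ⟨hy, hp.2⟩⟩⟩ h2 h3 x hp.1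
        p hp.2
    · exact fun x y p hp t ht => hgt x y (p, t) ⟨hDN x p hp.1 t ht, hDN y p hp.2 t ht⟩
    · exact fun x y p hp t ht =>
        ((hδ' t ht).2 x hp.1.1 y hp.2.1 p ⟨hDK x hp.1, hDK y hp.2⟩).le
    · intro t ht
      obtain ⟨M, hM⟩ := hbdd t ht
      refine ⟨fun x hx z hz => ?_, ⟨M + 1, fun x hx p hp => ?_⟩, fun x hx => ?_⟩
      · exact ((hudiff x hx t ht z (ball_subset_closedBall hz)).sub_const 1).differentiableWithinAt
      · refine (norm_sub_le _ _).trans (add_le_add (hM x hx p hp) ?_)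
        simp
      · simp only [Pi.sub_apply, Pi.one_apply]
        rw [hu1 x t (hDN _ _ ⟨hβF x hx, mem_chartBall_self (hr0 _)⟩ t ht), sub_self]
    · exact fun t ht x y p hp => hug x y (p, t) ⟨hDN x p hp.1 t ht, hDN y p hp.2 t ht⟩
  set Ω : Set (E × T) := ball (chartAt E p₀ p₀) (r p₀) ×ˢ ball t₀ δ with hΩ
  have hΩo : IsOpen Ω := isOpen_ball.prod isOpen_ball
  -- A basis adapted to the product: separate holomorphy splits into holomorphy along `X`, which is
  -- given, and along `T`, which comes from the difference quotients.
  set b := ((Module.finBasis ℂ E).prod (Module.finBasis ℂ T)).reindex finSumFinEquiv with hb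
  have hsep : SepHol b (fun q : E × T => u p₀ ((chartAt E p₀).symm q.1, q.2)) Ω := by
    have hin : ∀ z ∈ ball (chartAt E p₀ p₀) (r p₀), (chartAt E p₀).symm z ∈ D p₀ := fun z hz =>
      ⟨hp₀F, z, hz, rfl⟩
    constructor
    · rintro ⟨z, t⟩ ⟨hz, ht⟩
      refine ContinuousAt.continuousWithinAt ?_
      obtain ⟨ρ, hρ, hρB⟩ := Metric.isOpen_iff.1 (isOpen_ball (x := t₀) (ε := δ)) t ht
      -- Joint continuity: the Lipschitz bound in `t` is uniform in the point of `X`, and for fixed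
      -- `t` the section is continuous.
      have h1 : Filter.Tendsto (fun q : E × T => u p₀ ((chartAt E p₀).symm q.1, q.2) -
          u p₀ ((chartAt E p₀).symm q.1, t)) (𝓝 (z, t)) (𝓝 0) := by
        refine squeeze_zero_norm' (a := fun q : E × T => 2 * C * (4 / ρ * ‖q.2 - t‖)) ?_ ?_
        · filter_upwards [(isOpen_ball.prod isOpen_ball).mem_nhds
            (show (z, t) ∈ ball (chartAt E p₀ p₀) (r p₀) ×ˢ ball t ρ from ⟨hz, mem_ball_self hρ⟩)]
            with q hq
          exact hP.lipschitz hρB hq.2 (hin _ hq.1)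
        · have : Continuous (fun q : E × T => 2 * C * (4 / ρ * ‖q.2 - t‖)) := by fun_prop
          have h2 := this.tendsto (z, t)
          simpa using h2
      have h2 : ContinuousAt (fun q : E × T => u p₀ ((chartAt E p₀).symm q.1, t)) (z, t) :=
        ContinuousAt.comp (f := Prod.fst) (g := fun z => u p₀ ((chartAt E p₀).symm z, t))
          (hudiff p₀ hp₀F t ht z (ball_subset_closedBall hz)).continuousAt continuousAt_fst
      have h3 := h1.add h2
      simp only [sub_add_cancel, zero_add] at h3
      exact h3
    · rintro ⟨z, t⟩ ⟨hz, ht⟩ i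
      rw [hb, Module.Basis.reindex_apply]
      rcases finSumFinEquiv.symm i with j | j
      · simp only [Module.Basis.prod_apply, Sum.elim_inl, Function.comp, LinearMap.inl_apply,
          Prod.smul_mk, Prod.mk_add_mk, smul_zero, add_zero]
        refine DifferentiableAt.fun_comp' (g := fun w => u p₀ ((chartAt E p₀).symm w, t))
          (f := fun ζ : ℂ => z + ζ • Module.finBasis ℂ E j) 0 ?_ (by fun_prop)
        simpa using hudiff p₀ hp₀F t ht z (ball_subset_closedBall hz)
      · simp only [Module.Basis.prod_apply, Sum.elim_inr, Function.comp, LinearMap.inr_apply,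
          Prod.smul_mk, Prod.mk_add_mk, smul_zero, add_zero]
        exact hP.differentiableAt_line isOpen_ball ht _ (hin z hz)
  exact (hsep.contDiffOn b hΩo).contDiffAt
    (hΩo.mem_nhds ⟨mem_ball_self (hr0 p₀), mem_ball_self hδ⟩)

end Core

/-! ## The operator `∂∂̄` -/

section Ddbar

variable {m : ℕ} {φ ψ : EuclideanSpace ℂ (Fin m) → ℂ} {z : EuclideanSpace ℂ (Fin m)}

theorem dzbar_congr (h : φ =ᶠ[𝓝 z] ψ) (b : Fin m) : dzbar b φ =ᶠ[𝓝 z] dzbar b ψ := by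
  filter_upwards [h.eventuallyEq_nhds] with w hw
  simp only [dzbar, hw.fderiv_eq]

theorem ddbar_congr (h : φ =ᶠ[𝓝 z] ψ) : ddbar φ z = ddbar ψ z := by
  ext a b
  simp only [ddbar, Matrix.of_apply, dz, (dzbar_congr h b).fderiv_eq]

theorem contDiffAt_fderiv_apply (h : ContDiffAt ℝ 2 φ z) (v : EuclideanSpace ℂ (Fin m)) :
    DifferentiableAt ℝ (fun w => fderiv ℝ φ w v) z :=
  ((h.fderiv_right (m := 1) (by norm_num)).differentiableAt (by norm_num)).clm_apply
    (differentiableAt_const v)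

theorem differentiableAt_dzbar (h : ContDiffAt ℝ 2 φ z) (b : Fin m) :
    DifferentiableAt ℝ (dzbar b φ) z := by
  unfold dzbar
  exact ((contDiffAt_fderiv_apply h _).add ((contDiffAt_fderiv_apply h _).const_mul _)).mul_const _

theorem eventually_differentiableAt (h : ContDiffAt ℝ 2 φ z) :
    ∀ᶠ w in 𝓝 z, DifferentiableAt ℝ φ w :=
  (h.eventually (by simp)).mono fun _ hw => hw.differentiableAt (by norm_num)

theorem ddbar_add (hφ : ContDiffAt ℝ 2 φ z) (hψ : ContDiffAt ℝ 2 ψ z) :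
    ddbar (fun w => φ w + ψ w) z = ddbar φ z + ddbar ψ z := by
  ext a b
  have h : dzbar b (fun w => φ w + ψ w) =ᶠ[𝓝 z] fun w => dzbar b φ w + dzbar b ψ w := by
    filter_upwards [eventually_differentiableAt hφ, eventually_differentiableAt hψ] with w h1 h2
    simp only [dzbar, fderiv_fun_add h1 h2, add_apply]
    ring
  simp only [ddbar, Matrix.of_apply, dz, Matrix.add_apply, h.fderiv_eq,
    fderiv_fun_add (differentiableAt_dzbar hφ b) (differentiableAt_dzbar hψ b), add_apply]
  ring

theorem ddbar_const_mul (hφ : ContDiffAt ℝ 2 φ z) (c : ℂ) :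
    ddbar (fun w => c * φ w) z = c • ddbar φ z := by
  ext a b
  have h : dzbar b (fun w => c * φ w) =ᶠ[𝓝 z] fun w => c * dzbar b φ w := by
    filter_upwards [eventually_differentiableAt hφ] with w h1
    simp only [dzbar, fderiv_const_mul h1, smul_apply, smul_eq_mul]
    ring
  simp only [ddbar, Matrix.of_apply, dz, Matrix.smul_apply, h.fderiv_eq,
    fderiv_const_mul (differentiableAt_dzbar hφ b), smul_apply, smul_eq_mul]
  ring

theorem single_I (a : Fin m) :
    (EuclideanSpace.single a Complex.I : EuclideanSpace ℂ (Fin m)) =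
      Complex.I • EuclideanSpace.single a 1 := by
  ext i
  by_cases h : i = a
  · subst h; simp
  · simp [h]

/-- Real parts of holomorphic functions are pluriharmonic. -/
theorem ddbar_re {F : EuclideanSpace ℂ (Fin m) → ℂ} (hF : AnalyticAt ℂ F z) :
    ddbar (fun w => ((F w).re : ℂ)) z = 0 := by
  ext a b
  have h : dzbar b (fun w => ((F w).re : ℂ)) =ᶠ[𝓝 z]
      fun w => (1 / 2 : ℂ) * Complex.conjCLE (fderiv ℂ F w (EuclideanSpace.single b 1)) := by
    filter_upwards [hF.eventually_analyticAt] with w hw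
    have h1 : HasFDerivAt (fun w => ((F w).re : ℂ)) ((Complex.ofRealCLM.comp Complex.reCLM).comp
        ((fderiv ℂ F w).restrictScalars ℝ)) w :=
      (Complex.ofRealCLM.comp Complex.reCLM).hasFDerivAt.comp w
        (hw.differentiableAt.hasFDerivAt.restrictScalars ℝ)
    simp only [dzbar, h1.fderiv, ContinuousLinearMap.comp_apply,
      ContinuousLinearMap.coe_restrictScalars', single_I, map_smul]
    apply Complex.ext <;> simp <;> ring
  have h2 : DifferentiableAt ℂ (fun w => fderiv ℂ F w (EuclideanSpace.single b 1)) z :=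
    hF.fderiv.differentiableAt.clm_apply (differentiableAt_const _)
  have h3 : HasFDerivAt
      (fun w => (1 / 2 : ℂ) * Complex.conjCLE (fderiv ℂ F w (EuclideanSpace.single b 1)))
      ((1 / 2 : ℂ) • ((Complex.conjCLE : ℂ →L[ℝ] ℂ).comp
        ((fderiv ℂ (fun w => fderiv ℂ F w (EuclideanSpace.single b 1)) z).restrictScalars ℝ))) z :=
    ((Complex.conjCLE : ℂ →L[ℝ] ℂ).hasFDerivAt.comp z
      (h2.hasFDerivAt.restrictScalars ℝ)).const_mul _
  simp only [ddbar, Matrix.of_apply, dz, h.fderiv_eq, h3.fderiv, smul_apply,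
    ContinuousLinearMap.comp_apply, ContinuousLinearMap.coe_restrictScalars', single_I, map_smul]
  apply Complex.ext <;> simp

theorem AnalyticAt.contDiffAt_re {F : EuclideanSpace ℂ (Fin m) → ℂ} (hF : AnalyticAt ℂ F z) :
    ContDiffAt ℝ 2 (fun w => ((F w).re : ℂ)) z :=
  (Complex.ofRealCLM.comp Complex.reCLM).contDiff.contDiffAt.comp z
    (hF.contDiffAt.restrict_scalars ℝ)

theorem log_norm_eventuallyEq {F : EuclideanSpace ℂ (Fin m) → ℂ} (hF : AnalyticAt ℂ F z)
    (h0 : F z ≠ 0) : ∃ G : EuclideanSpace ℂ (Fin m) → ℂ, AnalyticAt ℂ G z ∧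
      (fun w => ((Real.log ‖F w‖ : ℝ) : ℂ)) =ᶠ[𝓝 z] fun w => ((G w).re : ℂ) := by
  -- Dividing by `F z` moves the value at `z` to `1`, inside the slit plane, so the principal branch
  -- is available.
  refine ⟨fun w => Complex.log (F w / F z) + (Real.log ‖F z‖ : ℝ), ?_, ?_⟩
  · refine AnalyticAt.add (AnalyticAt.clog (hF.div analyticAt_const h0) ?_) analyticAt_const
    rw [div_self h0]
    exact Complex.one_mem_slitPlane
  · filter_upwards [hF.continuousAt.eventually_ne h0] with w hw
    congr 1
    rw [Complex.add_re, Complex.log_re, Complex.ofReal_re, norm_div, Real.log_div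
      (norm_ne_zero_iff.2 hw) (norm_ne_zero_iff.2 h0), sub_add_cancel]

/-- Logarithms of absolute values of holomorphic functions are pluriharmonic. -/
theorem ddbar_log_norm {F : EuclideanSpace ℂ (Fin m) → ℂ} (hF : AnalyticAt ℂ F z)
    (h0 : F z ≠ 0) : ddbar (fun w => ((Real.log ‖F w‖ : ℝ) : ℂ)) z = 0 := by
  obtain ⟨G, hG, h⟩ := log_norm_eventuallyEq hF h0
  rw [ddbar_congr h, ddbar_re hG]

theorem contDiffAt_log_norm {F : EuclideanSpace ℂ (Fin m) → ℂ} (hF : AnalyticAt ℂ F z)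
    (h0 : F z ≠ 0) : ContDiffAt ℝ 2 (fun w => ((Real.log ‖F w‖ : ℝ) : ℂ)) z := by
  obtain ⟨G, hG, h⟩ := log_norm_eventuallyEq hF h0
  exact (AnalyticAt.contDiffAt_re hG).congr_of_eventuallyEq h

end Ddbar

/-! ## Real and complex differentiability on manifolds -/

section RealComplex

variable {E H : Type*} [NormedAddCommGroup E] [NormedSpace ℂ E]
  [TopologicalSpace H] {M : Type*} [TopologicalSpace M] [ChartedSpace H M]

/-- `J` is the real model with corners underlying the complex one `I`. -/
def IsUnderlying (I : ModelWithCorners ℂ E H) (J : ModelWithCorners ℝ E H) : Prop :=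
  (∀ x, J x = I x) ∧ ∀ z, J.symm z = I.symm z

theorem isUnderlying_self (E : Type*) [NormedAddCommGroup E] [NormedSpace ℂ E] :
    IsUnderlying 𝓘(ℂ, E) 𝓘(ℝ, E) := ⟨fun _ => rfl, fun _ => rfl⟩

theorem isUnderlying_prod (E E' : Type*) [NormedAddCommGroup E] [NormedSpace ℂ E]
    [NormedAddCommGroup E'] [NormedSpace ℂ E'] :
    IsUnderlying (𝓘(ℂ, E).prod 𝓘(ℂ, E')) (𝓘(ℝ, E).prod 𝓘(ℝ, E')) := ⟨fun _ => rfl, fun _ => rfl⟩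

/-- The two models have the same extended charts as functions, so the statement in charts is
restriction of scalars. -/
theorem IsUnderlying.contMDiffOn {I : ModelWithCorners ℂ E H} {J : ModelWithCorners ℝ E H}
    (h : IsUnderlying I J) {f : M → ℂ} {s : Set M} (hf : ContMDiffOn I 𝓘(ℂ, ℂ) ω f s) :
    ContMDiffOn J 𝓘(ℝ, ℂ) ∞ f s := by
  intro x hx
  have h1 := contMDiffWithinAt_iff.1 (hf x hx)
  rw [contMDiffWithinAt_iff]
  refine ⟨h1.1, ?_⟩
  have h2 := (h1.2.restrict_scalars ℝ).of_le (m := ∞) le_top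
  have e1 : (extChartAt J x : M → E) = extChartAt I x := by
    ext y; simp [extChartAt, h.1]
  have e2 : ((extChartAt J x).symm : E → M) = (extChartAt I x).symm := by
    ext y; simp [extChartAt, h.2]
  have e3 : Set.range J = Set.range I := by
    congr 1; ext y; exact h.1 y
  rw [e1, e2, e3]
  exact h2

end RealComplex

section RealManifold

variable {E H : Type*} [NormedAddCommGroup E] [NormedSpace ℂ E]
  [TopologicalSpace H] {M : Type*} [TopologicalSpace M] [ChartedSpace H M]

theorem IsUnderlying.isManifold {I : ModelWithCorners ℂ E H} {J : ModelWithCorners ℝ E H}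
    (h : IsUnderlying I J) [IsManifold I ω M] : IsManifold J ∞ M := by
  refine isManifold_of_contDiffOn J ∞ M fun e e' he he' => ?_
  have h1 := (contDiffGroupoid ω I).compatible he he'
  rw [contDiffGroupoid, mem_groupoid_of_pregroupoid] at h1
  have h2 := (ContDiffOn.restrict_scalars ℝ h1.1).of_le (m := ∞) le_top
  have e1 : (J : H → E) = I := funext h.1
  have e2 : (J.symm : E → H) = I.symm := funext h.2
  rw [e1, e2]
  exact h2

end RealManifold

/-! ## Matrix-valued functions -/

section MatrixFunctions

/-- Stated for both scalar fields at once: the matrix lemmas below serve holomorphic transition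
functions (`𝕜 = ℂ`) and smooth metrics (`𝕜 = ℝ`). -/
instance {𝕜 : Type*} [NontriviallyNormedField 𝕜] [NormedAlgebra 𝕜 ℂ] {k : WithTop ℕ∞} :
    ContMDiffMul 𝓘(𝕜, ℂ) k ℂ where
  contMDiff_mul := by
    rw [contMDiff_iff]
    refine ⟨continuous_mul, fun x y => ?_⟩
    simp only [mfld_simps, chartAt_self_eq]
    rw [contDiffOn_univ]
    exact contDiff_mul

variable {𝕜 : Type*} [NontriviallyNormedField 𝕜] [NormedAlgebra 𝕜 ℂ] {E H : Type*}
  [NormedAddCommGroup E] [NormedSpace 𝕜 E] [TopologicalSpace H] {I : ModelWithCorners 𝕜 E H}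
  {M : Type*} [TopologicalSpace M] [ChartedSpace H M] {n : ℕ} {k : WithTop ℕ∞}

theorem contMDiffOn_matrix_mul {A B : M → Matrix (Fin n) (Fin n) ℂ} {s : Set M}
    (hA : ∀ a b, ContMDiffOn I 𝓘(𝕜, ℂ) k (fun p => A p a b) s)
    (hB : ∀ a b, ContMDiffOn I 𝓘(𝕜, ℂ) k (fun p => B p a b) s) (a b : Fin n) :
    ContMDiffOn I 𝓘(𝕜, ℂ) k (fun p => (A p * B p) a b) s := by
  simp only [Matrix.mul_apply]
  exact contMDiffOn_finsetSum fun c _ => (hA a c).mul (hB c b)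

theorem contMDiffOn_matrix_det {A : M → Matrix (Fin n) (Fin n) ℂ} {s : Set M}
    (hA : ∀ a b, ContMDiffOn I 𝓘(𝕜, ℂ) k (fun p => A p a b) s) :
    ContMDiffOn I 𝓘(𝕜, ℂ) k (fun p => (A p).det) s := by
  simp only [Matrix.det_apply']
  exact contMDiffOn_finsetSum fun σ _ =>
    contMDiffOn_const.mul (contMDiffOn_finsetProd fun a _ => hA (σ a) a)

end MatrixFunctions

/-! ## Hermitian metrics -/

section Metrics

variable {E H : Type*} [NormedAddCommGroup E] [NormedSpace ℂ E]
  [TopologicalSpace H] {I : ModelWithCorners ℂ E H}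
  {J : ModelWithCorners ℝ E H} {M : Type*} [TopologicalSpace M] [ChartedSpace H M] {n : ℕ}

namespace HolBundle

variable {A : HolBundle I M n}

theorem isOpen_U (A : HolBundle I M n) (i : M) : IsOpen (A.U i) := (A.cover i).1

theorem mem_U (A : HolBundle I M n) (i : M) : i ∈ A.U i := (A.cover i).2

theorem det_mul_det (A : HolBundle I M n) {i j k p : M} (hi : p ∈ A.U i) (hj : p ∈ A.U j)
    (hk : p ∈ A.U k) : (A.trans i j p).det * (A.trans j k p).det = (A.trans i k p).det := by
  rw [← Matrix.det_mul, A.cocycle i j k p ⟨⟨hi, hj⟩, hk⟩]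

theorem det_ne_zero (A : HolBundle I M n) {i j p : M} (hi : p ∈ A.U i) (hj : p ∈ A.U j) :
    (A.trans i j p).det ≠ 0 := by
  intro h
  have := A.det_mul_det hi hj hi
  rw [h, zero_mul, A.self i p hi, Matrix.det_one] at this
  exact zero_ne_one this

theorem det_self (A : HolBundle I M n) {i p : M} (hi : p ∈ A.U i) : (A.trans i i p).det = 1 := by
  rw [A.self i p hi, Matrix.det_one]

theorem mulVec_injective (A : HolBundle I M n) {i j p : M} (hi : p ∈ A.U i) (hj : p ∈ A.U j) :
    Function.Injective (A.trans i j p).mulVec :=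
  Matrix.mulVec_injective_iff_isUnit.2
    (((A.trans i j p).isUnit_iff_isUnit_det).2 (isUnit_iff_ne_zero.2 (A.det_ne_zero hi hj)))

end HolBundle

theorem IsUnderlying.contMDiffOn_trans (h : IsUnderlying I J) (A : HolBundle I M n) (i j : M)
    (a b : Fin n) :
    ContMDiffOn J 𝓘(ℝ, ℂ) ∞ (fun p => A.trans i j p a b) (A.U i ∩ A.U j) :=
  h.contMDiffOn (A.hol i j a b)

theorem contMDiffOn_star {f : M → ℂ} {s : Set M} (hf : ContMDiffOn J 𝓘(ℝ, ℂ) ∞ f s) :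
    ContMDiffOn J 𝓘(ℝ, ℂ) ∞ (fun p => star (f p)) s :=
  (Complex.conjCLE.contDiff (n := ∞)).contMDiff.comp_contMDiffOn hf

/-- Local hermitian metrics can be glued to a global one. -/
theorem exists_hermMetric [FiniteDimensional ℝ E] [T2Space M] [SigmaCompactSpace M]
    [IsManifold I ω M] (hIJ : IsUnderlying I J) (A : HolBundle I M n) (N : M → Set M)
    (hN : IsPointCover N) (hNA : ∀ x, N x ⊆ A.U x) (G : M → M → Matrix (Fin n) (Fin n) ℂ)
    (hG : ∀ x a b, ContMDiffOn J 𝓘(ℝ, ℂ) ∞ (fun p => G x p a b) (N x))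
    (hpos : ∀ x, ∀ p ∈ N x, (G x p).PosDef) :
    ∃ g : HermMetric J A, ∀ i, ∀ p ∈ A.U i, ∀ Q,
      (∀ x, p ∈ N x → (A.trans x i p)ᴴ * G x p * A.trans x i p = Q) → g.gram i p = Q := by
  have : IsManifold J ∞ M := hIJ.isManifold
  obtain ⟨ρ, hρ⟩ := SmoothPartitionOfUnity.exists_isSubordinate J (isClosed_univ (X := M)) N
    (fun x => (hN x).1) (fun x _ => Set.mem_iUnion.2 ⟨x, (hN x).2⟩)
  set P : M → M → M → Matrix (Fin n) (Fin n) ℂ := fun i x p =>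
    (A.trans x i p)ᴴ * G x p * A.trans x i p with hP
  have hmem : ∀ x p, ρ x p ≠ 0 → p ∈ N x := fun x p h =>
    hρ x (subset_tsupport _ (Function.mem_support.2 h))
  have hsum : ∀ i p, (Matrix.of fun a b => ∑ᶠ x, ρ x p • P i x p a b) =
      ∑ x ∈ ρ.finsupport p, ρ x p • P i x p := by
    intro i p
    ext a b
    rw [Matrix.of_apply, ← ρ.sum_finsupport_smul_eq_finsum p (fun x p => P i x p a b),
      Matrix.sum_apply]
    rfl
  have hmem' : ∀ p, ∀ x ∈ ρ.finsupport p, p ∈ N x := fun p x hx =>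
    hmem x p (by simpa using (ρ.mem_finsupport p).1 hx)
  have hPpos : ∀ i, ∀ p ∈ A.U i, ∀ x, p ∈ N x → (P i x p).PosDef := fun i p hp x hx =>
    (hpos x p hx).conjTranspose_mul_mul_same (A.mulVec_injective (hNA x hx) hp)
  refine ⟨⟨fun i p => Matrix.of fun a b => ∑ᶠ x, ρ x p • P i x p a b, ?_, ?_, ?_⟩, ?_⟩
  · intro i a b p hp
    refine ContMDiffAt.contMDiffWithinAt ?_
    simp only [Matrix.of_apply]
    refine ρ.contMDiffAt_finsum fun x hx => ?_
    have hpx : p ∈ N x := hρ x hx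
    have hT : ∀ a b, ContMDiffOn J 𝓘(ℝ, ℂ) ∞ (fun p => A.trans x i p a b) (N x ∩ A.U i) :=
      fun a b => (hIJ.contMDiffOn_trans A x i a b).mono
        (Set.inter_subset_inter_left _ (hNA x))
    have h1 := contMDiffOn_matrix_mul (contMDiffOn_matrix_mul
      (A := fun p => (A.trans x i p)ᴴ) (fun a b => contMDiffOn_star (hT b a))
      (fun a b => (hG x a b).mono Set.inter_subset_left)) hT a b
    exact h1.contMDiffAt (((hN x).1.inter (A.isOpen_U i)).mem_nhds ⟨hpx, hp⟩)
  · intro i p hp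
    rw [hsum]
    obtain ⟨x, hx⟩ : ∃ x, 0 < ρ x p := ρ.exists_pos_of_mem (Set.mem_univ p)
    have hxs : x ∈ ρ.finsupport p := (ρ.mem_finsupport p).2 (Function.mem_support.2 hx.ne')
    classical
    rw [← Finset.add_sum_erase _ _ hxs]
    refine Matrix.PosDef.add_posSemidef ((hPpos i p hp x (hmem x p hx.ne')).smul hx) ?_
    exact Matrix.posSemidef_sum _ fun y hy =>
      ((hPpos i p hp y (hmem' p y (Finset.mem_of_mem_erase hy))).posSemidef).smul (ρ.nonneg y p)
  · intro i j p hp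
    rw [hsum, hsum, Finset.mul_sum, Finset.sum_mul]
    refine Finset.sum_congr rfl fun x hx => ?_
    have hpx := hNA x (hmem' p x hx)
    rw [Matrix.mul_smul, Matrix.smul_mul]
    congr 1
    simp only [hP, ← A.cocycle x i j p ⟨⟨hpx, hp.1⟩, hp.2⟩, Matrix.conjTranspose_mul,
      Matrix.mul_assoc]
  -- Where all local metrics defined at `p` agree, their average is the common value. This is what
  -- allows a metric to be prescribed along one fibre.
  · intro i p hp Q hQ
    show (Matrix.of fun a b => ∑ᶠ x, ρ x p • P i x p a b) = Q
    rw [hsum, Finset.sum_congr rfl (fun x hx => by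
      rw [show P i x p = Q from hQ x (hmem' p x hx)]), ← Finset.sum_smul,
      ρ.sum_finsupport p (Set.mem_univ p), one_smul]

theorem exists_hermMetric' [FiniteDimensional ℝ E] [T2Space M] [SigmaCompactSpace M]
    [IsManifold I ω M] (hIJ : IsUnderlying I J) (A : HolBundle I M n) : Nonempty (HermMetric J A) := by
  obtain ⟨g, -⟩ := exists_hermMetric hIJ A A.U A.cover (fun _ => subset_rfl) (fun _ _ => 1)
    (fun _ _ _ => contMDiffOn_const) (fun _ _ _ => Matrix.PosDef.one)
  exact ⟨g⟩

namespace HermMetric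

variable {A : HolBundle I M n} (g : HermMetric J A)

/-- The determinant of the Gram matrix as a real number. -/
def detRe (i p : M) : ℝ := (g.gram i p).det.re

theorem det_eq {i p : M} (hp : p ∈ A.U i) : (g.gram i p).det = (g.detRe i p : ℂ) := by
  have := (g.posDef i p hp).det_pos
  exact Complex.ext rfl (by simpa using (Complex.pos_iff.1 this).2.symm)

theorem detRe_pos {i p : M} (hp : p ∈ A.U i) : 0 < g.detRe i p :=
  (Complex.pos_iff.1 (g.posDef i p hp).det_pos).1

theorem detRe_compat {i j p : M} (hi : p ∈ A.U i) (hj : p ∈ A.U j) :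
    g.detRe j p = ‖(A.trans i j p).det‖ ^ 2 * g.detRe i p := by
  have h := congrArg Matrix.det (g.compat i j p ⟨hi, hj⟩)
  rw [Matrix.det_mul, Matrix.det_mul, Matrix.det_conjTranspose, g.det_eq hi, g.det_eq hj] at h
  have h2 : star (A.trans i j p).det * (A.trans i j p).det =
      ((‖(A.trans i j p).det‖ ^ 2 : ℝ) : ℂ) := by
    rw [Complex.star_def, Complex.conj_mul']
    push_cast
    rfl
  have h3 : (g.detRe j p : ℂ) = ((‖(A.trans i j p).det‖ ^ 2 * g.detRe i p : ℝ) : ℂ) := by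
    rw [h, Complex.ofReal_mul, ← h2]
    ring
  exact_mod_cast h3

theorem contMDiffOn_detRe (i : M) : ContMDiffOn J 𝓘(ℝ, ℝ) ∞ (g.detRe i) (A.U i) :=
  (Complex.reCLM.contDiff (n := ∞)).contMDiff.comp_contMDiffOn
    (contMDiffOn_matrix_det (g.smooth i))

/-- Multiplication of a metric by a positive function. -/
def scale (c : M → ℝ) (hc : ContMDiff J 𝓘(ℝ, ℝ) ∞ c) (hpos : ∀ p, 0 < c p) : HermMetric J A where
  gram i p := c p • g.gram i p
  smooth i a b := by
    have h1 : ContMDiffOn J 𝓘(ℝ, ℂ) ∞ (fun p => (c p : ℂ)) (A.U i) :=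
      (Complex.ofRealCLM.contDiff (n := ∞)).contMDiff.comp_contMDiffOn hc.contMDiffOn
    refine (h1.mul (g.smooth i a b)).congr fun p _ => ?_
    simp
  posDef i p hp := (g.posDef i p hp).smul (hpos p)
  compat i j p hp := by
    rw [g.compat i j p hp, Matrix.mul_smul, Matrix.smul_mul]

theorem detRe_scale (c : M → ℝ) (hc : ContMDiff J 𝓘(ℝ, ℝ) ∞ c) (hpos : ∀ p, 0 < c p) (i p : M) :
    (g.scale c hc hpos).detRe i p = c p ^ n * g.detRe i p := by
  have : c p • g.gram i p = (c p : ℂ) • g.gram i p := by ext; simp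
  simp only [detRe, scale, this, Matrix.det_smul, Fintype.card_fin]
  rw [← Complex.ofReal_pow, Complex.re_ofReal_mul]

end HermMetric

end Metrics

/-! ## Reading functions in charts -/

section Charts

variable {m : ℕ} {X : Type*} [TopologicalSpace X] [ChartedSpace (EuclideanSpace ℂ (Fin m)) X]

theorem contDiffAt_chart {f : X → ℝ} {x : X}
    (hf : ContMDiffAt 𝓘(ℝ, EuclideanSpace ℂ (Fin m)) 𝓘(ℝ, ℝ) ∞ f x) :
    ContDiffAt ℝ ∞ (fun z => f ((chartAt (EuclideanSpace ℂ (Fin m)) x).symm z))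
      (chartAt (EuclideanSpace ℂ (Fin m)) x x) := by
  have h := (contMDiffAt_iff.1 hf).2
  simp only [mfld_simps, contDiffWithinAt_univ] at h
  exact h

theorem analyticAt_chart {f : X → ℂ} {x : X}
    (hf : ContMDiffAt 𝓘(ℂ, EuclideanSpace ℂ (Fin m)) 𝓘(ℂ, ℂ) ω f x) :
    AnalyticAt ℂ (fun z => f ((chartAt (EuclideanSpace ℂ (Fin m)) x).symm z))
      (chartAt (EuclideanSpace ℂ (Fin m)) x x) := by
  have h := (contMDiffAt_iff.1 hf).2
  simp only [mfld_simps, contDiffWithinAt_univ] at h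
  exact analyticWithinAt_univ.1
    (contDiffWithinAt_omega_iff_analyticWithinAt.1 h.contDiffWithinAt)

theorem contDiffAt_log_chart {f : X → ℝ} {x : X} {s : Set X} (hs : IsOpen s) (hx : x ∈ s)
    (hf : ContMDiffOn 𝓘(ℝ, EuclideanSpace ℂ (Fin m)) 𝓘(ℝ, ℝ) ∞ f s) (hpos : 0 < f x) :
    ContDiffAt ℝ 2 (fun z => ((Real.log (f ((chartAt (EuclideanSpace ℂ (Fin m)) x).symm z)) : ℝ) : ℂ))
      (chartAt (EuclideanSpace ℂ (Fin m)) x x) := by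
  have h1 := (contDiffAt_chart (hf.contMDiffAt (hs.mem_nhds hx))).of_le (m := 2)
    (WithTop.coe_le_coe.2 (le_top : (2 : ℕ∞) ≤ ⊤))
  have h2 := h1.log (by
    simp only [(chartAt (EuclideanSpace ℂ (Fin m)) x).left_inv (mem_chart_source _ x)]
    exact hpos.ne')
  exact (Complex.ofRealCLM.contDiff).contDiffAt.comp _ h2

theorem eventually_chart_symm {x : X} {s : Set X} (hs : s ∈ 𝓝 x) :
    ∀ᶠ z in 𝓝 (chartAt (EuclideanSpace ℂ (Fin m)) x x),
      (chartAt (EuclideanSpace ℂ (Fin m)) x).symm z ∈ s := by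
  have hx := mem_chart_source (EuclideanSpace ℂ (Fin m)) x
  refine ((chartAt (EuclideanSpace ℂ (Fin m)) x).continuousAt_symm
    ((chartAt (EuclideanSpace ℂ (Fin m)) x).map_source hx)).eventually_mem ?_
  rwa [(chartAt (EuclideanSpace ℂ (Fin m)) x).left_inv hx]

/-- The curvature of a metric whose determinant is locally the product of the determinant of another
metric and powers of functions with pluriharmonic logarithm. -/
theorem curvature_eq_of_detRe {n n' : ℕ} {A : HolBundle 𝓘(ℂ, EuclideanSpace ℂ (Fin m)) X n}
    {B : HolBundle 𝓘(ℂ, EuclideanSpace ℂ (Fin m)) X n'}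
    (g : HermMetric 𝓘(ℝ, EuclideanSpace ℂ (Fin m)) A)
    (g' : HermMetric 𝓘(ℝ, EuclideanSpace ℂ (Fin m)) B) {x : X} {f : X → ℝ} {d : ℕ}
    (hpos : ∀ᶠ p in 𝓝 x, 0 < f p)
    (hf : ContDiffAt ℝ 2
      (fun z => ((Real.log (f ((chartAt (EuclideanSpace ℂ (Fin m)) x).symm z)) : ℝ) : ℂ))
      (chartAt (EuclideanSpace ℂ (Fin m)) x x))
    (hflat : ddbar
      (fun z => ((Real.log (f ((chartAt (EuclideanSpace ℂ (Fin m)) x).symm z)) : ℝ) : ℂ))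
      (chartAt (EuclideanSpace ℂ (Fin m)) x x) = 0)
    (h : ∀ᶠ p in 𝓝 x, g.detRe x p = f p ^ d * g'.detRe x p) :
    curvature g x = curvature g' x := by
  have hB := (B.isOpen_U x).mem_nhds (B.mem_U x)
  have hg' := contDiffAt_log_chart (B.isOpen_U x) (B.mem_U x) (g'.contMDiffOn_detRe x)
    (g'.detRe_pos (B.mem_U x))
  have h1 : (fun z => ((Real.log (g.detRe x ((chartAt (EuclideanSpace ℂ (Fin m)) x).symm z)) : ℝ) : ℂ))
      =ᶠ[𝓝 (chartAt (EuclideanSpace ℂ (Fin m)) x x)] fun z =>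
      (d : ℂ) * ((Real.log (f ((chartAt (EuclideanSpace ℂ (Fin m)) x).symm z)) : ℝ) : ℂ) +
      ((Real.log (g'.detRe x ((chartAt (EuclideanSpace ℂ (Fin m)) x).symm z)) : ℝ) : ℂ) := by
    filter_upwards [eventually_chart_symm hB, eventually_chart_symm hpos,
      eventually_chart_symm h] with z hz1 hz2 hz3
    change g.detRe x _ = _ at hz3
    change 0 < f _ at hz2
    rw [hz3, Real.log_mul (pow_ne_zero _ hz2.ne') (g'.detRe_pos hz1).ne', Real.log_pow]
    push_cast
    rfl
  unfold curvature
  refine (ddbar_congr h1).trans ?_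
  rw [ddbar_add (contDiffAt_const.mul hf) hg', ddbar_const_mul hf, hflat, smul_zero,
    zero_add]
  rfl

end Charts

/-! ## Twisting by scalar cocycles -/

section Twist

variable {E H : Type*} [NormedAddCommGroup E] [NormedSpace ℂ E] [TopologicalSpace H]
  {I : ModelWithCorners ℂ E H} {J : ModelWithCorners ℝ E H} {M : Type*} [TopologicalSpace M]
  [ChartedSpace H M] {n : ℕ}

/-- A holomorphic line bundle with a metric, in terms of scalar transition functions. -/
structure MetricLine (I : ModelWithCorners ℂ E H) (J : ModelWithCorners ℝ E H) (M : Type*)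
    [TopologicalSpace M] [ChartedSpace H M] where
  V : M → Set M
  cover : IsPointCover V
  c : M → M → M → ℂ
  hol : ∀ i j, ContMDiffOn I 𝓘(ℂ, ℂ) ω (c i j) (V i ∩ V j)
  self : ∀ i, ∀ p ∈ V i, c i i p = 1
  cocycle : ∀ i j k, ∀ p ∈ V i ∩ V j ∩ V k, c i j p * c j k p = c i k p
  μ : M → M → ℝ
  smooth : ∀ i, ContMDiffOn J 𝓘(ℝ, ℝ) ∞ (μ i) (V i)
  pos : ∀ i, ∀ p ∈ V i, 0 < μ i p
  compat : ∀ i j, ∀ p ∈ V i ∩ V j, μ j p = ‖c i j p‖ ^ 2 * μ i p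

/-- The tensor product of a vector bundle with a line bundle. -/
def HolBundle.twist (B : HolBundle I M n) (L : MetricLine I J M) : HolBundle I M n where
  U i := B.U i ∩ L.V i
  cover := B.cover.inter L.cover
  trans i j p := L.c i j p • B.trans i j p
  hol i j a b := ((L.hol i j).mono fun _ hp => ⟨hp.1.2, hp.2.2⟩).mul
    ((B.hol i j a b).mono fun _ hp => ⟨hp.1.1, hp.2.1⟩)
  self i p hp := by rw [L.self i p hp.2, B.self i p hp.1, one_smul]
  cocycle i j k p hp := by
    rw [Matrix.smul_mul, Matrix.mul_smul, smul_smul,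
      L.cocycle i j k p ⟨⟨hp.1.1.2, hp.1.2.2⟩, hp.2.2⟩,
      B.cocycle i j k p ⟨⟨hp.1.1.1, hp.1.2.1⟩, hp.2.1⟩]

/-- The tensor product of metrics. -/
def HermMetric.twist {B : HolBundle I M n} (g : HermMetric J B) (L : MetricLine I J M) :
    HermMetric J (B.twist L) where
  gram i p := L.μ i p • g.gram i p
  smooth i a b := by
    have h1 : ContMDiffOn J 𝓘(ℝ, ℂ) ∞ (fun p => (L.μ i p : ℂ)) (L.V i) :=
      (Complex.ofRealCLM.contDiff (n := ∞)).contMDiff.comp_contMDiffOn (L.smooth i)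
    refine ((h1.mono fun _ hp => hp.2).mul ((g.smooth i a b).mono fun _ hp => hp.1)).congr
      fun p _ => ?_
    simp
  posDef i p hp := (g.posDef i p hp.1).smul (L.pos i p hp.2)
  compat i j p hp := by
    rw [g.compat i j p ⟨hp.1.1, hp.2.1⟩, L.compat i j p ⟨hp.1.2, hp.2.2⟩]
    simp only [HolBundle.twist, Matrix.conjTranspose_smul, Matrix.smul_mul, Matrix.mul_smul]
    ext a b
    simp only [Matrix.smul_apply, Complex.real_smul, smul_eq_mul]
    push_cast
    rw [← Complex.conj_mul', Complex.star_def]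
    ring

theorem HermMetric.detRe_twist {B : HolBundle I M n} (g : HermMetric J B) (L : MetricLine I J M)
    (i p : M) : (g.twist L).detRe i p = L.μ i p ^ n * g.detRe i p := by
  have : L.μ i p • g.gram i p = (L.μ i p : ℂ) • g.gram i p := by ext; simp
  simp only [HermMetric.detRe, HermMetric.twist, this, Matrix.det_smul, Fintype.card_fin]
  rw [← Complex.ofReal_pow, Complex.re_ofReal_mul]

end Twist

/-! ### Twists of a Ricci-rigid bundle by fibrewise flat line bundles. -/

section Rigid

variable {m k n : ℕ} {X U : Type*} [TopologicalSpace X]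
  [ChartedSpace (EuclideanSpace ℂ (Fin m)) X] [TopologicalSpace U]
  [ChartedSpace (EuclideanSpace ℂ (Fin k)) U]

/-- The constant metric on the constant family. -/
def HermMetric.const {A : HolBundle 𝓘(ℂ, EuclideanSpace ℂ (Fin m)) X n}
    (g : HermMetric 𝓘(ℝ, EuclideanSpace ℂ (Fin m)) A) (k : ℕ) (U : Type*) [TopologicalSpace U]
    [ChartedSpace (EuclideanSpace ℂ (Fin k)) U] : FamilyMetric (A.const k U) where
  gram i p := g.gram i.1 p.1
  smooth i a b := (g.smooth i.1 a b).comp contMDiff_fst.contMDiffOn (fun _ hp => hp)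
  posDef i p hp := g.posDef i.1 p.1 hp
  compat i j p hp := g.compat i.1 j.1 p.1 hp

/-- Metric line bundles on `X × U`. -/
abbrev MetricLineFamily (m k : ℕ) (X U : Type*) [TopologicalSpace X]
    [ChartedSpace (EuclideanSpace ℂ (Fin m)) X] [TopologicalSpace U]
    [ChartedSpace (EuclideanSpace ℂ (Fin k)) U] : Type _ :=
  MetricLine (𝓘(ℂ, EuclideanSpace ℂ (Fin m)).prod 𝓘(ℂ, EuclideanSpace ℂ (Fin k)))
    (𝓘(ℝ, EuclideanSpace ℂ (Fin m)).prod 𝓘(ℝ, EuclideanSpace ℂ (Fin k))) (X × U)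

/-- The twist multiplies the determinant of the metric by `μ ^ n`, and `log μ` is pluriharmonic on
each fibre. -/
theorem curvature_twist_const {E₀ : HolBundle 𝓘(ℂ, EuclideanSpace ℂ (Fin m)) X n}
    (g : HermMetric 𝓘(ℝ, EuclideanSpace ℂ (Fin m)) E₀) (L : MetricLineFamily m k X U)
    (hflat : ∀ x t, ddbar
      (fun z => ((Real.log (L.μ (x, t) ((chartAt (EuclideanSpace ℂ (Fin m)) x).symm z, t)) : ℝ) : ℂ))
      (chartAt (EuclideanSpace ℂ (Fin m)) x x) = 0) (t : U) (x : X) :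
    curvature (FamilyMetric.fiber ((g.const k U).twist L) t) x = curvature g x := by
  have hc : ContMDiff 𝓘(ℝ, EuclideanSpace ℂ (Fin m))
      (𝓘(ℝ, EuclideanSpace ℂ (Fin m)).prod 𝓘(ℝ, EuclideanSpace ℂ (Fin k))) ∞
      (fun p : X => (p, t)) := contMDiff_id.prodMk contMDiff_const
  have hopen : IsOpen {p : X | (p, t) ∈ L.V (x, t)} := (L.cover (x, t)).1.preimage hc.continuous
  have hx : x ∈ {p : X | (p, t) ∈ L.V (x, t)} := (L.cover (x, t)).2
  refine curvature_eq_of_detRe _ _ (f := fun p => L.μ (x, t) (p, t)) (d := n) ?_ ?_ (hflat x t) ?_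
  · filter_upwards [hopen.mem_nhds hx] with p hp using L.pos _ _ hp
  · exact contDiffAt_log_chart hopen hx
      ((L.smooth (x, t)).comp hc.contMDiffOn fun _ hp => hp) (L.pos _ _ hx)
  · exact Filter.Eventually.of_forall fun p => HermMetric.detRe_twist _ L (x, t) (p, t)

/-- A small deformation of the trivial line bundle with a fibrewise flat metric becomes trivial
after taking the `n`-th tensor power, when there is a Ricci-rigid bundle of rank `n`. -/
theorem HolBundle.RicciRigid.exists_trivialization [CompactSpace X] [T2Space X]
    [IsManifold 𝓘(ℂ, EuclideanSpace ℂ (Fin m)) ω X]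
    {E₀ : HolBundle 𝓘(ℂ, EuclideanSpace ℂ (Fin m)) X n} (hE : E₀.RicciRigid)
    {S : TopologicalSpace.Opens (EuclideanSpace ℂ (Fin k))} (h0 : (0 : EuclideanSpace ℂ (Fin k)) ∈ S)
    (L : MetricLineFamily m k X S)
    (hL : ∀ x y p, (p, ⟨0, h0⟩) ∈ L.V (x, ⟨0, h0⟩) ∩ L.V (y, ⟨0, h0⟩) →
      L.c (x, ⟨0, h0⟩) (y, ⟨0, h0⟩) (p, ⟨0, h0⟩) = 1)
    (hflat : ∀ x t, ddbar
      (fun z => ((Real.log (L.μ (x, t) ((chartAt (EuclideanSpace ℂ (Fin m)) x).symm z, t)) : ℝ) : ℂ))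
      (chartAt (EuclideanSpace ℂ (Fin m)) x x) = 0) :
    ∃ N : X → Set (X × S), (∀ x, IsOpen (N x) ∧ (x, ⟨0, h0⟩) ∈ N x ∧ N x ⊆ L.V (x, ⟨0, h0⟩)) ∧
      ∃ φ : X → X × S → ℂ,
        (∀ x, ContMDiffOn (𝓘(ℂ, EuclideanSpace ℂ (Fin m)).prod 𝓘(ℂ, EuclideanSpace ℂ (Fin k)))
          𝓘(ℂ, ℂ) ω (φ x) (N x)) ∧ (∀ x, ∀ p ∈ N x, φ x p ≠ 0) ∧
        ∀ x y, ∀ p ∈ N x ∩ N y,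
          φ x p * L.c (x, ⟨0, h0⟩) (y, ⟨0, h0⟩) p ^ n = φ y p := by
  obtain ⟨g⟩ := exists_hermMetric' (isUnderlying_self (EuclideanSpace ℂ (Fin m))) E₀
  set o : S := ⟨0, h0⟩ with ho
  -- Over the base point the twisting cocycle is `1`, so the identity matrices give an isomorphism.
  have hiso : (Family.fiber ((E₀.const k S).twist L) o).Iso E₀ := by
    refine ⟨fun _ _ => 1, fun i a b => contMDiffOn_const, fun i p _ => isUnit_one,
      fun i j p hp => ?_⟩
    rw [one_mul, mul_one]
    show L.c (i, o) (j, o) (p, o) • E₀.trans i j p = _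
    rw [hL i j p ⟨hp.1.1.1.2, hp.1.2.1.2⟩, one_smul]
  obtain ⟨W, hWo, h0W, h, hhol, hunit, hrel⟩ := hE k S h0 ((E₀.const k S).twist L) hiso
    ⟨(g.const k S).twist L, fun t x => by
      rw [curvature_twist_const g L hflat t x, curvature_twist_const g L hflat _ x]⟩
  refine ⟨fun x => (Prod.fst ⁻¹' E₀.U x ∩ L.V (x, o)) ∩ Set.univ ×ˢ W, fun x => ⟨?_, ?_, ?_⟩,
    fun x p => (h (x, o) p).det, fun x => ?_, fun x p hp => ?_, fun x y p hp => ?_⟩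
  · exact (((E₀.isOpen_U x).preimage continuous_fst).inter (L.cover (x, o)).1).inter
      (isOpen_univ.prod hWo)
  · exact ⟨⟨E₀.mem_U x, (L.cover (x, o)).2⟩, ⟨trivial, h0W⟩⟩
  · exact fun p hp => hp.1.2
  · exact contMDiffOn_matrix_det fun a b => (hhol (x, o) a b).mono
      fun p hp => ⟨⟨hp.1, hp.1.1⟩, hp.2⟩
  · exact ((Matrix.isUnit_iff_isUnit_det _).1
      (hunit (x, o) p ⟨⟨hp.1, hp.1.1⟩, hp.2⟩)).ne_zero
  -- In the determinant of the gluing relation the factor `det E₀` occurs on both sides and cancels,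
  -- leaving the `n`-th power of the cocycle of `L`.
  · have := congrArg Matrix.det (hrel (x, o) (y, o) p
      ⟨⟨⟨hp.1.1, hp.1.1.1⟩, ⟨hp.2.1, hp.2.1.1⟩⟩, hp.1.2⟩)
    rw [Matrix.det_mul, Matrix.det_mul] at this
    have h1 : (((E₀.const k S).twist L).trans (x, o) (y, o) p).det =
        L.c (x, o) (y, o) p ^ n * (E₀.trans x y p.1).det := by
      show (L.c (x, o) (y, o) p • E₀.trans x y p.1).det = _
      rw [Matrix.det_smul, Fintype.card_fin]
    rw [h1] at this
    have h2 := E₀.det_ne_zero (i := x) (j := y) hp.1.1.1 hp.2.1.1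
    have h3 : ((E₀.const k S).trans (x, o) (y, o) p).det = (E₀.trans x y p.1).det := rfl
    rw [h3] at this
    refine mul_right_cancel₀ h2 ?_
    linear_combination this

end Rigid

/-! ### Differentiation in the parameter. -/

section PartialDerivative

variable {m k : ℕ} {X U : Type*} [TopologicalSpace X]
  [ChartedSpace (EuclideanSpace ℂ (Fin m)) X] [IsManifold 𝓘(ℂ, EuclideanSpace ℂ (Fin m)) ω X]
  [TopologicalSpace U] [ChartedSpace (EuclideanSpace ℂ (Fin k)) U]

theorem analyticAt_chart_prod {T : Type*} [NormedAddCommGroup T] [NormedSpace ℂ T]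
    {Φ : X × U → ℂ} {N : Set (X × U)} (hN : IsOpen N)
    (hΦ : ContMDiffOn (𝓘(ℂ, EuclideanSpace ℂ (Fin m)).prod 𝓘(ℂ, EuclideanSpace ℂ (Fin k)))
      𝓘(ℂ, ℂ) ω Φ N) {j : T → U} {t : T}
    (hj : ContMDiffAt 𝓘(ℂ, T) 𝓘(ℂ, EuclideanSpace ℂ (Fin k)) ω j t) {p x : X}
    (hpx : p ∈ (chartAt (EuclideanSpace ℂ (Fin m)) x).source) (hp : (p, j t) ∈ N) :
    AnalyticAt ℂ (fun q : EuclideanSpace ℂ (Fin m) × T =>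
      Φ ((chartAt (EuclideanSpace ℂ (Fin m)) x).symm q.1, j q.2))
      (chartAt (EuclideanSpace ℂ (Fin m)) x p, t) := by
  set e := chartAt (EuclideanSpace ℂ (Fin m)) x with he
  have h1 : ContMDiffAt 𝓘(ℂ, EuclideanSpace ℂ (Fin m)) 𝓘(ℂ, EuclideanSpace ℂ (Fin m)) ω e.symm
      (e p) := (contMDiffOn_chart_symm (x := x)).contMDiffAt
        (e.open_target.mem_nhds (e.map_source hpx))
  have h2 : ContMDiffAt 𝓘(ℂ, EuclideanSpace ℂ (Fin m) × T) 𝓘(ℂ, EuclideanSpace ℂ (Fin m)) ω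
      (fun q : EuclideanSpace ℂ (Fin m) × T => e.symm q.1) (e p, t) :=
    ContMDiffAt.comp (e p, t) (f := Prod.fst) h1 contDiff_fst.contMDiff.contMDiffAt
  have h3 : ContMDiffAt 𝓘(ℂ, EuclideanSpace ℂ (Fin m) × T) 𝓘(ℂ, EuclideanSpace ℂ (Fin k)) ω
      (fun q : EuclideanSpace ℂ (Fin m) × T => j q.2) (e p, t) :=
    ContMDiffAt.comp (e p, t) (f := Prod.snd) hj contDiff_snd.contMDiff.contMDiffAt
  have h4 : ContMDiffAt (𝓘(ℂ, EuclideanSpace ℂ (Fin m)).prod 𝓘(ℂ, EuclideanSpace ℂ (Fin k)))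
      𝓘(ℂ, ℂ) ω Φ (e.symm (e p), j t) := by
    rw [e.left_inv hpx]
    exact hΦ.contMDiffAt (hN.mem_nhds hp)
  have h5 := ContMDiffAt.comp (e p, t)
    (f := fun q : EuclideanSpace ℂ (Fin m) × T => (e.symm q.1, j q.2)) h4 (h2.prodMk h3)
  exact analyticWithinAt_univ.1 (contDiffWithinAt_omega_iff_analyticWithinAt.1
    (contMDiffAt_iff_contDiffAt.1 h5).contDiffWithinAt)

/-- Derivatives of holomorphic functions with respect to a parameter are holomorphic. -/
theorem contMDiffOn_deriv {Φ : X × U → ℂ} {N : Set (X × U)} (hN : IsOpen N)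
    (hΦ : ContMDiffOn (𝓘(ℂ, EuclideanSpace ℂ (Fin m)).prod 𝓘(ℂ, EuclideanSpace ℂ (Fin k)))
      𝓘(ℂ, ℂ) ω Φ N) {j : ℂ → U} (hj : ContMDiff 𝓘(ℂ, ℂ) 𝓘(ℂ, EuclideanSpace ℂ (Fin k)) ω j) :
    ContMDiffOn 𝓘(ℂ, EuclideanSpace ℂ (Fin m)) 𝓘(ℂ, ℂ) ω
      (fun p => deriv (fun ζ => Φ (p, j ζ)) 0) {p | (p, j 0) ∈ N} := by
  intro p hp
  refine ContMDiffAt.contMDiffWithinAt ?_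
  set e := chartAt (EuclideanSpace ℂ (Fin m)) p with he
  have hps : p ∈ e.source := mem_chart_source _ p
  have hG := analyticAt_chart_prod hN hΦ (hj.contMDiffAt (x := 0)) hps hp
  set G : EuclideanSpace ℂ (Fin m) × ℂ → ℂ := fun q => Φ (e.symm q.1, j q.2) with hGdef
  have hD : AnalyticAt ℂ (fun z => fderiv ℂ G (z, 0) (0, 1)) (e p) := by
    have h1 : AnalyticAt ℂ (fun z : EuclideanSpace ℂ (Fin m) => (z, (0 : ℂ))) (e p) :=
      analyticAt_id.prod analyticAt_const
    have h2 := AnalyticAt.fun_comp (f := fun z : EuclideanSpace ℂ (Fin m) => (z, (0 : ℂ))) hG.fderiv h1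
    exact ((ContinuousLinearMap.apply ℂ ℂ
      ((0, 1) : EuclideanSpace ℂ (Fin m) × ℂ)).analyticAt _).fun_comp h2
  have h3 : ContMDiffAt 𝓘(ℂ, EuclideanSpace ℂ (Fin m)) 𝓘(ℂ, EuclideanSpace ℂ (Fin m)) ω e p :=
    contMDiffOn_chart.contMDiffAt (e.open_source.mem_nhds hps)
  have h4 := ContMDiffAt.comp p hD.contDiffAt.contMDiffAt h3
  refine h4.congr_of_eventuallyEq ?_
  have h5 : ∀ᶠ q in 𝓝 p, AnalyticAt ℂ G (e q, 0) := by
    have : ContinuousAt (fun q => (e q, (0 : ℂ))) p :=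
      (e.continuousAt hps).prodMk continuousAt_const
    exact this.eventually hG.eventually_analyticAt
  filter_upwards [h5, e.open_source.mem_nhds hps] with q hq hqs
  have h6 : HasDerivAt (fun ζ : ℂ => (e q, ζ)) ((0, 1) : EuclideanSpace ℂ (Fin m) × ℂ) 0 :=
    (hasDerivAt_const (0 : ℂ) (e q)).prodMk (hasDerivAt_id 0)
  have h7 := (hq.differentiableAt.hasFDerivAt.comp_hasDerivAt (0 : ℂ) h6).deriv
  simp only [Function.comp_def, hGdef, e.left_inv hqs] at h7
  exact h7

end PartialDerivative

/-! ## The maximal complex subspace -/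

section MaxComplexSubspace

open Complex

variable {m n : ℕ} {X : Type*} [TopologicalSpace X] [ChartedSpace (EuclideanSpace ℂ (Fin m)) X]

/-- The underlying cocycle identity for a class coming from real constants. -/
theorem exists_real_of_mem_range {c : (holSheaf m X).cocycles}
    (h : (Submodule.Quotient.mk c : H1O m X) ∈ Set.range (realToH1O m X)) :
    ∃ (a : X → X → X → ℝ) (U : X → Set X) (f : X → X → ℂ), IsPointCover U ∧
      (∀ x, f x ∈ (holSheaf m X).sec (U x)) ∧
      ∀ x y, ∀ p ∈ U x ∩ U y, c.1 x y p = (a x y p : ℂ) + (f y p - f x p) := by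
  obtain ⟨α, hα⟩ := h
  obtain ⟨a, rfl⟩ := Submodule.Quotient.mk_surjective _ α
  have h1 := (Submodule.Quotient.eq _).1 hα.symm
  obtain ⟨U, hU, f, hf, hc⟩ := h1
  refine ⟨a.1, U, f, hU, hf, fun x y p hp => ?_⟩
  have h2 := hc x y p hp
  rw [← h2]
  show _ = _ + (c.1 x y p - (a.1 x y p : ℂ))
  ring

/-- The parameter value `ζ` as a point of the line `ℂ¹`. -/
def lineMap (ζ : ℂ) : (⊤ : TopologicalSpace.Opens (EuclideanSpace ℂ (Fin 1))) :=
  ⟨EuclideanSpace.single 0 ζ, trivial⟩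

theorem contMDiff_lineMap : ContMDiff 𝓘(ℂ, ℂ) 𝓘(ℂ, EuclideanSpace ℂ (Fin 1)) ω lineMap := by
  intro ζ
  refine (ChartedSpace.liftPropWithinAt_subtypeVal_comp_iff lineMap Set.univ ζ).1 ?_
  suffices h : ContDiff ℂ ω (Subtype.val ∘ lineMap) from h.contMDiff ζ
  rw [contDiff_euclidean]
  intro i
  obtain rfl := Subsingleton.elim i 0
  have : (fun ζ : ℂ => (Subtype.val ∘ lineMap) ζ 0) = id := by
    ext ζ
    simp [lineMap]
  rw [this]
  exact contDiff_id

/-- The coordinate on `ℂ¹`. -/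
def lineCoord (s : (⊤ : TopologicalSpace.Opens (EuclideanSpace ℂ (Fin 1)))) : ℂ := s.1 0

theorem contMDiff_lineCoord : ContMDiff 𝓘(ℂ, EuclideanSpace ℂ (Fin 1)) 𝓘(ℂ, ℂ) ω lineCoord :=
  (EuclideanSpace.proj (𝕜 := ℂ) (0 : Fin 1)).contDiff.contMDiff.comp contMDiff_subtype_val

theorem lineCoord_lineMap (ζ : ℂ) : lineCoord (lineMap ζ) = ζ := by simp [lineCoord, lineMap]

/-- The family of flat unitary line bundles with transition functions `exp (i t c)`. -/
def expLine (U : X → Set X) (hU : IsPointCover U) (c : X → X → X → ℂ)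
    (hc : ∀ x y, c x y ∈ (holSheaf m X).sec (U x ∩ U y))
    (hcc : ∀ x y z, ∀ p ∈ U x ∩ U y ∩ U z, c x y p + c y z p = c x z p)
    (a b : X → X → X → ℝ) (f g : X → X → ℂ) (hf : ∀ x, f x ∈ (holSheaf m X).sec (U x))
    (hg : ∀ x, g x ∈ (holSheaf m X).sec (U x))
    (ha : ∀ x y, ∀ p ∈ U x ∩ U y, c x y p = (a x y p : ℂ) + (f y p - f x p))
    (hb : ∀ x y, ∀ p ∈ U x ∩ U y, I * c x y p = (b x y p : ℂ) + (g y p - g x p)) :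
    MetricLineFamily m 1 X (⊤ : TopologicalSpace.Opens (EuclideanSpace ℂ (Fin 1))) where
  V i := Prod.fst ⁻¹' U i.1
  cover i := ⟨(hU i.1).1.preimage continuous_fst, (hU i.1).2⟩
  c i j p := exp (I * lineCoord p.2 * c i.1 j.1 p.1)
  hol i j := by
    have h1 : ContMDiffOn (𝓘(ℂ, EuclideanSpace ℂ (Fin m)).prod 𝓘(ℂ, EuclideanSpace ℂ (Fin 1)))
        𝓘(ℂ, ℂ) ω (fun p : X × (⊤ : TopologicalSpace.Opens (EuclideanSpace ℂ (Fin 1))) =>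
          c i.1 j.1 p.1) (Prod.fst ⁻¹' U i.1 ∩ Prod.fst ⁻¹' U j.1) :=
      (hc i.1 j.1).comp contMDiff_fst.contMDiffOn fun _ hp => hp
    exact contDiff_exp.contMDiff.comp_contMDiffOn
      ((contMDiffOn_const.mul (contMDiff_lineCoord.comp contMDiff_snd).contMDiffOn).mul h1)
  self i p hp := by
    have := hcc i.1 i.1 i.1 p.1 ⟨⟨hp, hp⟩, hp⟩
    rw [add_eq_left] at this
    rw [this, mul_zero, exp_zero]
  cocycle i j k p hp := by rw [← exp_add, ← mul_add, hcc i.1 j.1 k.1 p.1 hp]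
  -- For `t = σ + i τ` one has `t c = σ c + τ (i c)`. The real constants `a`, `b` have no imaginary
  -- part, so `|exp (i t c)|²` is `exp (-2 (σ Im f + τ Im g))` at index `j` divided by the same
  -- expression at index `i`.
  μ i p := Real.exp (-2 * ((lineCoord p.2).re * (f i.1 p.1).im + (lineCoord p.2).im * (g i.1 p.1).im))
  smooth i := by
    have him : ∀ {f : X → X → ℂ}, (∀ x, f x ∈ (holSheaf m X).sec (U x)) →
        ContMDiffOn (𝓘(ℝ, EuclideanSpace ℂ (Fin m)).prod 𝓘(ℝ, EuclideanSpace ℂ (Fin 1)))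
        𝓘(ℝ, ℝ) ∞ (fun p : X × (⊤ : TopologicalSpace.Opens (EuclideanSpace ℂ (Fin 1))) =>
          (f i.1 p.1).im) (Prod.fst ⁻¹' U i.1) := fun hf =>
      (imCLM.contDiff (n := ∞)).contMDiff.comp_contMDiffOn
        (((isUnderlying_self _).contMDiffOn (hf i.1)).comp contMDiff_fst.contMDiffOn
          fun _ hp => hp)
    have hs : ContMDiff (𝓘(ℝ, EuclideanSpace ℂ (Fin m)).prod 𝓘(ℝ, EuclideanSpace ℂ (Fin 1)))
        𝓘(ℝ, ℂ) ∞ (fun p : X × (⊤ : TopologicalSpace.Opens (EuclideanSpace ℂ (Fin 1))) =>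
          lineCoord p.2) := by
      have h1 := (isUnderlying_self _).contMDiffOn contMDiff_lineCoord.contMDiffOn (s := Set.univ)
      exact (contMDiffOn_univ.1 h1).comp contMDiff_snd
    have hre := ((reCLM.contDiff (n := ∞)).contMDiff.comp hs).contMDiffOn
      (s := Prod.fst ⁻¹' U i.1)
    have hims := ((imCLM.contDiff (n := ∞)).contMDiff.comp hs).contMDiffOn
      (s := Prod.fst ⁻¹' U i.1)
    exact Real.contDiff_exp.contMDiff.comp_contMDiffOn
      (contMDiffOn_const.mul ((hre.mul (him hf)).add (hims.mul (him hg))))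
  pos i p _ := Real.exp_pos _
  compat i j p hp := by
    rw [norm_exp, ← Real.exp_nat_mul, ← Real.exp_add]
    congr 1
    have h1 := congrArg im (ha i.1 j.1 p.1 hp)
    have h2 := congrArg im (hb i.1 j.1 p.1 hp)
    simp at h1 h2
    simp
    rw [h1, h2]
    ring

/-- The deformation argument in infinitesimal form: the family `exp (i t c)` has trivial `n`-th
power near `t = 0`, and differentiating its trivialization at `t = 0` bounds `c`. Both reality
hypotheses are needed for a flat metric at all complex `t`. -/
theorem eq_zero_of_mem_range [CompactSpace X] [T2Space X]
    [IsManifold 𝓘(ℂ, EuclideanSpace ℂ (Fin m)) ω X]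
    {E₀ : HolBundle 𝓘(ℂ, EuclideanSpace ℂ (Fin m)) X n} (hE : E₀.RicciRigid) (hn : 0 < n)
    {v : H1O m X} (h1 : v ∈ Set.range (realToH1O m X))
    (h2 : I • v ∈ Set.range (realToH1O m X)) : v = 0 := by
  obtain ⟨c, rfl⟩ := Submodule.Quotient.mk_surjective _ v
  obtain ⟨U₀, hU₀, hc, hcc⟩ := c.2
  obtain ⟨a, U₁, f, hU₁, hf, ha⟩ := exists_real_of_mem_range h1
  obtain ⟨b, U₂, g, hU₂, hg, hb⟩ := exists_real_of_mem_range (c := I • c) h2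
  set U : X → Set X := fun x => U₀ x ∩ U₁ x ∩ U₂ x with hUdef
  have hU : IsPointCover U := (hU₀.inter hU₁).inter hU₂
  have s0 : ∀ x, U x ⊆ U₀ x := fun x p hp => hp.1.1
  have s1 : ∀ x, U x ⊆ U₁ x := fun x p hp => hp.1.2
  have s2 : ∀ x, U x ⊆ U₂ x := fun x p hp => hp.2
  set L := expLine (m := m) U hU c.1
    (fun x y => (holSheaf m X).anti (Set.inter_subset_inter (s0 x) (s0 y)) (hc x y))
    (fun x y z p hp => hcc x y z p ⟨⟨s0 x hp.1.1, s0 y hp.1.2⟩, s0 z hp.2⟩) a b f g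
    (fun x => (holSheaf m X).anti (s1 x) (hf x)) (fun x => (holSheaf m X).anti (s2 x) (hg x))
    (fun x y p hp => ha x y p ⟨s1 x hp.1, s1 y hp.2⟩)
    (fun x y p hp => hb x y p ⟨s2 x hp.1, s2 y hp.2⟩) with hL
  set o : (⊤ : TopologicalSpace.Opens (EuclideanSpace ℂ (Fin 1))) := ⟨0, trivial⟩ with ho
  have hLc : ∀ i j p, L.c i j p = exp (I * lineCoord p.2 * c.1 i.1 j.1 p.1) := fun _ _ _ => rfl
  have ho0 : lineMap 0 = o := Subtype.ext (by simp [lineMap, ho])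
  obtain ⟨N, hN, φ, hφ, hφ0, hφc⟩ := hE.exists_trivialization o.2 L
    (fun x y p _ => by rw [hLc, show (⟨o.1, o.2⟩ : (⊤ : TopologicalSpace.Opens _)) = lineMap 0 from ho0.symm, lineCoord_lineMap]; simp) (fun x t => by
      have hFX : ContMDiffOn 𝓘(ℂ, EuclideanSpace ℂ (Fin m)) 𝓘(ℂ, ℂ) ω (fun p : X =>
          2 * I * ((lineCoord t).re * f x p + (lineCoord t).im * g x p)) (U x) :=
        contMDiffOn_const.mul ((contMDiffOn_const.mul (ContMDiffOn.mono (hf x) (s1 x))).add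
          (contMDiffOn_const.mul (ContMDiffOn.mono (hg x) (s2 x))))
      -- The logarithm of the weight is the real part of the holomorphic function `2 i (σ f + τ g)`.
      rw [← ddbar_re (analyticAt_chart (hFX.contMDiffAt ((hU x).1.mem_nhds (hU x).2)))]
      congr 1
      ext z
      congr 1
      show Real.log (Real.exp _) = _
      rw [Real.log_exp]
      simp)
  change ∀ x y, ∀ p ∈ N x ∩ N y, φ x p * L.c (x, o) (y, o) p ^ n = φ y p at hφc
  change ∀ x, IsOpen (N x) ∧ (x, o) ∈ N x ∧ N x ⊆ L.V (x, o) at hN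
  have hnI : (n : ℂ) * I ≠ 0 := mul_ne_zero (by exact_mod_cast hn.ne') I_ne_zero
  set W : X → Set X := fun x => {p | (p, lineMap 0) ∈ N x} with hW
  have hWc : IsPointCover W := fun x =>
    ⟨(hN x).1.preimage (by fun_prop), by rw [hW, Set.mem_ofPred_eq, ho0]; exact (hN x).2.1⟩
  -- The logarithmic derivative of `φ x` at `t = 0` divided by `n i`; the factor `n i` comes from
  -- differentiating `exp (n i t c)`.
  set F : X → X → ℂ := fun x p =>
    deriv (fun ζ => φ x (p, lineMap ζ)) 0 * (φ x (p, lineMap 0) * (n * I))⁻¹ with hF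
  refine (Submodule.Quotient.mk_eq_zero _).2 ⟨W, hWc, F, fun x => ?_, fun x y p hp => ?_⟩
  · have h3 := contMDiffOn_deriv (hN x).1 (hφ x) contMDiff_lineMap
    have h4 : ContMDiffOn 𝓘(ℂ, EuclideanSpace ℂ (Fin m)) 𝓘(ℂ, ℂ) ω
        (fun p => φ x (p, lineMap 0) * (n * I)) (W x) :=
      ((hφ x).comp (contMDiff_id.prodMk contMDiff_const).contMDiffOn fun _ hp => hp).mul
        contMDiffOn_const
    refine ContMDiffOn.mul h3 fun p hp => ?_
    exact (h4 p hp).inv₀ (mul_ne_zero (hφ0 x _ hp) hnI)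
  · have hda : ∀ x, p ∈ W x → DifferentiableAt ℂ (fun ζ => φ x (p, lineMap ζ)) 0 := fun x hx => by
      have h5 : ContMDiffAt 𝓘(ℂ, ℂ)
          (𝓘(ℂ, EuclideanSpace ℂ (Fin m)).prod 𝓘(ℂ, EuclideanSpace ℂ (Fin 1))) ω
          (fun ζ => (p, lineMap ζ)) 0 := (contMDiff_const.prodMk contMDiff_lineMap).contMDiffAt
      have h6 := ((hφ x).contMDiffAt ((hN x).1.mem_nhds hx)).comp (0 : ℂ) h5
      exact (contMDiffAt_iff_contDiffAt.1 h6).differentiableAt (by simp)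
    have hev : (fun ζ => φ x (p, lineMap ζ) * exp (n * (I * ζ * c.1 x y p))) =ᶠ[𝓝 0]
        fun ζ => φ y (p, lineMap ζ) := by
      have hcont : Continuous fun ζ : ℂ => (p, lineMap ζ) :=
        continuous_const.prodMk contMDiff_lineMap.continuous
      filter_upwards [(((hN x).1.inter (hN y).1).preimage hcont).mem_nhds hp] with ζ hζ
      rw [← hφc x y _ hζ, hLc, ← exp_nat_mul]
      simp only [lineCoord_lineMap]
    have hde : HasDerivAt (fun ζ : ℂ => exp (n * (I * ζ * c.1 x y p)))
        (exp (n * (I * 0 * c.1 x y p)) * (n * (I * 1 * c.1 x y p))) 0 :=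
      ((((hasDerivAt_id (0 : ℂ)).const_mul I).mul_const _).const_mul (n : ℂ)).cexp
    have hprod := ((hda x hp.1).hasDerivAt.mul hde).deriv
    have hev' := hev.deriv_eq
    rw [show deriv (fun ζ => φ x (p, lineMap ζ) * exp (n * (I * ζ * c.1 x y p))) 0 = _ from hprod]
      at hev'
    have hval := hev.self_of_nhds
    simp only [mul_zero, zero_mul, exp_zero, mul_one, one_mul] at hval hev'
    show c.1 x y p = F y p - F x p
    simp only [hF, ← hev', ← hval]
    have := hφ0 x _ hp.1
    field_simp
    ring

end MaxComplexSubspace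

/-! ## Holomorphic germs in the real torus -/

section Torus

/-- The countably many vectors involve only countably many basis elements, numbered injectively by
`e`. Sending the basis element `i` to `s ^ e i` turns each `w k` into the value at `s` of a nonzero
polynomial; some real `s` avoids the countably many roots. -/
theorem exists_dual_forall_ne_zero {W : Type*} [AddCommGroup W] [Module ℝ W] {w : ℕ → W}
    (hw : ∀ k, w k ≠ 0) : ∃ μ : W →ₗ[ℝ] ℝ, ∀ k, μ (w k) ≠ 0 := by
  classical
  set b := Module.Basis.ofVectorSpace ℝ W with hb
  have hC : (⋃ k, ((b.repr (w k)).support : Set (Module.Basis.ofVectorSpaceIndex ℝ W))).Countable :=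
    Set.countable_iUnion fun k => (b.repr (w k)).support.countable_toSet
  obtain ⟨e, he⟩ := Set.countable_iff_exists_injOn.1 hC
  set P : ℕ → Polynomial ℝ := fun k =>
    ∑ i ∈ (b.repr (w k)).support, Polynomial.C (b.repr (w k) i) * Polynomial.X ^ e i with hP
  have hP0 : ∀ k, P k ≠ 0 := by
    intro k h
    have hne : b.repr (w k) ≠ 0 := fun h => hw k (by simpa using h)
    obtain ⟨i, hi⟩ := Finsupp.support_nonempty_iff.2 hne
    have h1 := congrArg (fun p => Polynomial.coeff p (e i)) h
    simp only [hP, Polynomial.finsetSum_coeff, Polynomial.coeff_C_mul_X_pow,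
      Polynomial.coeff_zero] at h1
    rw [Finset.sum_eq_single_of_mem i hi (fun j hj hji => if_neg fun hij => hji
      (he (Set.mem_iUnion.2 ⟨k, hj⟩) (Set.mem_iUnion.2 ⟨k, hi⟩) hij.symm)), if_pos rfl] at h1
    exact (Finsupp.mem_support_iff.1 hi) h1
  have hroots : (⋃ k, {s : ℝ | (P k).IsRoot s}).Countable :=
    Set.countable_iUnion fun k => (Polynomial.finite_setOfPred_isRoot (hP0 k)).countable
  obtain ⟨s, hs⟩ := (hroots.dense_compl ℝ).nonempty
  refine ⟨b.constr ℝ fun i => s ^ e i, fun k hk => hs (Set.mem_iUnion.2 ⟨k, ?_⟩)⟩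
  rw [Module.Basis.constr_apply] at hk
  show (P k).eval s = 0
  rw [← hk]
  simp [hP, Polynomial.eval_finsetSum, Finsupp.sum]

/-- Countably many nonzero vectors of a totally real subspace are detected by a functional which is
imaginary on the subspace. -/
theorem exists_dual_re_eq_zero {V : Type*} [AddCommGroup V] [Module ℂ V] (R : Submodule ℝ V)
    (hR : ∀ v ∈ R, Complex.I • v ∈ R → v = 0) {w : ℕ → V} (hwR : ∀ k, w k ∈ R)
    (hw : ∀ k, w k ≠ 0) :
    ∃ ℓ : Module.Dual ℂ V, (∀ r ∈ R, (ℓ r).re = 0) ∧ ∀ k, ℓ (w k) ≠ 0 := by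
  obtain ⟨μ, hμ⟩ := exists_dual_forall_ne_zero (w := fun k => (⟨w k, hwR k⟩ : R))
    (fun k h => hw k (congrArg Subtype.val h))
  have hII : ∀ v : V, Complex.I • Complex.I • v = -v := fun v => by
    rw [smul_smul, Complex.I_mul_I, neg_one_smul]
  have hIr : ∀ (a : ℝ) (v : V), Complex.I • a • v = a • Complex.I • v := fun a v => smul_comm _ _ _
  -- As `R` is totally real, `(r, s) ↦ r + i s` is injective. Through a left inverse, the real
  -- functional `r + i s ↦ -μ s` extends to `V` as `lam`, and `ℓ v = lam v - i lam (i v)` is complex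
  -- linear and equal to `i μ` on `R`.
  let T : R × R →ₗ[ℝ] V :=
    { toFun := fun q => q.1 + Complex.I • (q.2 : V)
      map_add' := fun q q' => by simp only [Prod.fst_add, Prod.snd_add, Submodule.coe_add, smul_add]; abel
      map_smul' := fun a q => by
        simp only [Prod.smul_fst, Prod.smul_snd, Submodule.coe_smul, RingHom.id_apply, smul_add, hIr] }
  have hT : LinearMap.ker T = ⊥ := by
    rw [LinearMap.ker_eq_bot']
    rintro ⟨r, s⟩ h
    have h1 : (r : V) + Complex.I • (s : V) = 0 := h
    have hs : (s : V) = 0 := by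
      refine hR s s.2 ?_
      rw [← neg_eq_of_add_eq_zero_right h1]
      exact R.neg_mem r.2
    have hr : (r : V) = 0 := by rwa [hs, smul_zero, add_zero] at h1
    exact Prod.ext (Subtype.ext hr) (Subtype.ext hs)
  obtain ⟨S, hS⟩ := T.exists_leftInverse_of_injective hT
  let lam : V →ₗ[ℝ] ℝ := -(μ.comp ((LinearMap.snd ℝ R R).comp S))
  have hlam : ∀ q, lam (T q) = -μ q.2 := fun q => by
    have : S (T q) = q := LinearMap.congr_fun hS q
    simp [lam, this]
  have hlam1 : ∀ r : R, lam (r : V) = 0 := fun r => by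
    have := hlam (r, 0)
    simpa [T] using this
  have hlam2 : ∀ r : R, lam (Complex.I • (r : V)) = -μ r := fun r => by
    have := hlam (0, r)
    simpa [T] using this
  let ℓ : V →ₗ[ℂ] ℂ :=
    { toFun := fun v => (lam v : ℂ) - Complex.I * lam (Complex.I • v)
      map_add' := fun v v' => by simp only [smul_add, map_add, Complex.ofReal_add]; ring
      map_smul' := fun z v => by
        have h1 : z • v = z.re • v + z.im • Complex.I • v := by
          conv_lhs => rw [← Complex.re_add_im z, add_smul, mul_smul]
          rfl
        have h2 : Complex.I • z • v = z.re • Complex.I • v - z.im • v := by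
          rw [h1, smul_add, hIr, hIr, hII, smul_neg, sub_eq_add_neg]
        rw [h2, h1]
        simp only [map_add, map_sub, map_smul, smul_eq_mul, RingHom.id_apply]
        apply Complex.ext
        · simp
        · simp
          ring }
  have hℓ : ∀ r : R, ℓ (r : V) = Complex.I * μ r := fun r => by
    show (lam (r : V) : ℂ) - Complex.I * lam (Complex.I • (r : V)) = _
    rw [hlam1, hlam2]
    push_cast
    ring
  refine ⟨ℓ, fun r hr => ?_, fun k => ?_⟩
  · rw [hℓ ⟨r, hr⟩]
    simp
  · rw [hℓ ⟨w k, hwR k⟩]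
    exact mul_ne_zero Complex.I_ne_zero (by exact_mod_cast hμ k)

variable {m : ℕ} {X : Type*} [TopologicalSpace X] [ChartedSpace (EuclideanSpace ℂ (Fin m)) X]

/-- The image of `H¹(X, ℝ)` as a real subspace. -/
def realRange (m : ℕ) (X : Type*) [TopologicalSpace X]
    [ChartedSpace (EuclideanSpace ℂ (Fin m)) X] : Submodule ℝ (H1O m X) where
  carrier := Set.range (realToH1O m X)
  zero_mem' := ⟨0, map_zero _⟩
  add_mem' := by
    rintro _ _ ⟨a, rfl⟩ ⟨b, rfl⟩
    exact ⟨a + b, map_add _ _ _⟩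
  smul_mem' := by
    rintro r _ ⟨a, rfl⟩
    refine ⟨r • a, ?_⟩
    rw [LinearMap.map_smulₛₗ]
    rfl

theorem intToH1O_mem_realRange (α : (constSheaf ℤ X).H1) : intToH1O m X α ∈ realRange m X := by
  obtain ⟨a, rfl⟩ := Submodule.Quotient.mk_surjective _ α
  obtain ⟨a, U, hU, ha, haa⟩ := a
  refine ⟨Submodule.Quotient.mk ⟨fun x y p => (a x y p : ℝ), U, hU, fun x y p hp => ?_,
    fun x y z p hp => ?_⟩, ?_⟩
  · filter_upwards [ha x y p hp] with q hq
    rw [hq]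
  · show ((a x y p : ℝ)) + a y z p = a x z p
    exact_mod_cast haa x y z p hp
  · refine congrArg Submodule.Quotient.mk (Subtype.ext ?_)
    ext x y p
    show ((a x y p : ℝ) : ℂ) = (a x y p : ℂ)
    push_cast
    rfl

/-- Two lifts of a point of `Pic⁰` differ by an integral class, and integral classes are real; so
any lift of a point of the real torus lies in the real subspace. -/
theorem mem_realRange_of_mem_realTorus {v : H1O m X}
    (h : (QuotientAddGroup.mk v : Pic0 m X) ∈ realTorus m X) : v ∈ realRange m X := by
  obtain ⟨w, ⟨α, rfl⟩, hw⟩ := h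
  obtain ⟨β, hβ⟩ := QuotientAddGroup.eq.1 hw
  have h1 : v = realToH1O m X α + intToH1O m X β := by
    have : intToH1O m X β = -realToH1O m X α + v := hβ
    rw [this]
    abel
  rw [h1]
  exact (realRange m X).add_mem ⟨α, rfl⟩ (intToH1O_mem_realRange β)

/-- A nonconstant germ is open, but the imaginary axis contains no neighbourhood of any of its
points. -/
theorem eventually_eq_of_re_eq_zero {g : ℂ → ℂ} (hg : AnalyticAt ℂ g 0)
    (h : ∀ᶠ t in 𝓝 0, (g t).re = 0) : ∀ᶠ t in 𝓝 0, g t = g 0 := by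
  refine hg.eventually_constant_or_nhds_le_map_nhds.resolve_right fun hle => ?_
  have h1 : {z : ℂ | z.re = 0} ∈ 𝓝 (g 0) := hle h
  have h2 : (g 0).re = 0 := h.self_of_nhds
  have h3 : Filter.Tendsto (fun r : ℝ => g 0 + r) (𝓝[≠] 0) (𝓝 (g 0)) := by
    have : Continuous fun r : ℝ => g 0 + r := by fun_prop
    have h4 := (this.tendsto 0).mono_left (nhdsWithin_le_nhds (s := {0}ᶜ))
    simpa using h4
  obtain ⟨r, hr, hr0⟩ := ((h3.eventually_mem h1).and self_mem_nhdsWithin).exists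
  exact hr0 (by simpa [h2] using hr)

/-- Each functional is constant along the lift only on a neighbourhood depending on that functional.
If the lift were not locally constant, a sequence `t k → 0` with `F (t k) ≠ F 0` would exist, and a
single functional nonzero on all these differences contradicts its own local constancy. -/
theorem eventually_eq_of_isHolGerm
    (hV : ∀ v ∈ realRange m X, Complex.I • v ∈ realRange m X → v = 0) {f : ℂ → Pic0 m X}
    (hf : IsHolGerm f) (hr : ∀ᶠ t in 𝓝 (0 : ℂ), f t ∈ realTorus m X) :
    ∀ᶠ t in 𝓝 (0 : ℂ), f t = f 0 := by
  obtain ⟨F, hF, hfF⟩ := hf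
  have hFR : ∀ᶠ t in 𝓝 (0 : ℂ), F t ∈ realRange m X := by
    filter_upwards [hr, hfF] with t h1 h2
    rw [h2] at h1
    exact mem_realRange_of_mem_realTorus h1
  have key : ∀ᶠ t in 𝓝 (0 : ℂ), F t = F 0 := by
    by_contra hne
    have hfreq : ∃ᶠ t in 𝓝 (0 : ℂ), F t ≠ F 0 ∧ F t ∈ realRange m X :=
      (Filter.not_eventually.1 hne).and_eventually hFR
    obtain ⟨t, ht, htp⟩ := Filter.exists_seq_forall_of_frequently hfreq
    obtain ⟨ℓ, hℓ, hℓw⟩ := exists_dual_re_eq_zero (realRange m X) hV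
      (w := fun k => F (t k) - F 0)
      (fun k => (realRange m X).sub_mem (htp k).2 hFR.self_of_nhds)
      (fun k => sub_ne_zero.2 (htp k).1)
    have h1 := eventually_eq_of_re_eq_zero (hF ℓ) (hFR.mono fun s hs => hℓ _ hs)
    obtain ⟨k, hk⟩ := (ht.eventually h1).exists
    exact hℓw k (by rw [map_sub, hk, sub_self])
  filter_upwards [key, hfF] with t h1 h2
  rw [h2, h1, hfF.self_of_nhds]

theorem maxComplexSubspace_eq_bot
    (hV : ∀ v ∈ realRange m X, Complex.I • v ∈ realRange m X → v = 0) :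
    maxComplexSubspace m X = ⊥ :=
  eq_bot_iff.2 (sSup_le fun S hS v hv =>
    (Submodule.mem_bot ℂ).2 (hV v (hS hv) (hS (S.smul_mem Complex.I hv))))

end Torus

/-! ## Roots of trivializations -/

section Root

open Complex

variable {m k n : ℕ} {X : Type*} [TopologicalSpace X]
  [ChartedSpace (EuclideanSpace ℂ (Fin m)) X]

/-- The roots of unity form a finite, hence discrete set, and a continuous map from a preconnected
set into it is constant. -/
theorem eq_one_of_pow_eq_one {S : Type*} [TopologicalSpace S] {W : Set S} (hW : IsPreconnected W)
    (hn : 0 < n) {f : S → ℂ} (hf : ContinuousOn f W) (hpow : ∀ s ∈ W, f s ^ n = 1) {o s : S}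
    (ho : o ∈ W) (h1 : f o = 1) (hs : s ∈ W) : f s = 1 := by
  have hfin : {z : ℂ | z ^ n = 1}.Finite := by
    refine (Polynomial.nthRootsFinset n (1 : ℂ)).finite_toSet.subset fun z hz => ?_
    exact (Polynomial.mem_nthRootsFinset hn (1 : ℂ)).2 hz
  rw [← h1]
  exact hW.constant_of_mapsTo hfin.isDiscrete hf (fun s hs => hpow s hs) hs ho

/-- A small deformation of the trivial line bundle with a fibrewise flat metric is fibrewise trivial
when there is a Ricci-rigid bundle of positive rank. -/
theorem HolBundle.RicciRigid.exists_root [CompactSpace X] [T2Space X]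
    [IsManifold 𝓘(ℂ, EuclideanSpace ℂ (Fin m)) ω X]
    {E₀ : HolBundle 𝓘(ℂ, EuclideanSpace ℂ (Fin m)) X n} (hE : E₀.RicciRigid) (hn : 0 < n)
    {S : TopologicalSpace.Opens (EuclideanSpace ℂ (Fin k))} (h0 : (0 : EuclideanSpace ℂ (Fin k)) ∈ S)
    (L : MetricLineFamily m k X S)
    (hL : ∀ x y p, (p, ⟨0, h0⟩) ∈ L.V (x, ⟨0, h0⟩) ∩ L.V (y, ⟨0, h0⟩) →
      L.c (x, ⟨0, h0⟩) (y, ⟨0, h0⟩) (p, ⟨0, h0⟩) = 1)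
    (hflat : ∀ x t, ddbar
      (fun z => ((Real.log (L.μ (x, t) ((chartAt (EuclideanSpace ℂ (Fin m)) x).symm z, t)) : ℝ) : ℂ))
      (chartAt (EuclideanSpace ℂ (Fin m)) x x) = 0) :
    ∃ (W : Set S) (D : X → Set X) (θ : X → X × S → ℂ), IsOpen W ∧ ⟨0, h0⟩ ∈ W ∧
      (∀ x, IsOpen (D x)) ∧ (∀ p, ∃ x, p ∈ D x) ∧
      (∀ x, ∀ p ∈ D x, ∀ s ∈ W, (p, s) ∈ L.V (x, ⟨0, h0⟩)) ∧
      (∀ x, ∀ s ∈ W, ContMDiffOn 𝓘(ℂ, EuclideanSpace ℂ (Fin m)) 𝓘(ℂ, ℂ) ω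
        (fun p => θ x (p, s)) (D x)) ∧
      (∀ x p, θ x p ≠ 0) ∧
      ∀ x y, ∀ p ∈ D x ∩ D y, ∀ s ∈ W,
        θ x (p, s) * L.c (x, ⟨0, h0⟩) (y, ⟨0, h0⟩) (p, s) = θ y (p, s) := by
  classical
  obtain ⟨N, hN, φ, hφ, hφ0, hφc⟩ := hE.exists_trivialization h0 L hL hflat
  set o : S := ⟨0, h0⟩ with ho
  -- Normalized to `1` at `o`. The gluing relation of `φ` survives because the cocycle of `L` is `1`
  -- there, and near `o` the principal `n`-th root of `χ` is defined.
  set χ : X → X × S → ℂ := fun x q => φ x q / φ x (q.1, o) with hχ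
  have hoc : Continuous fun q : X × S => (q.1, o) := by fun_prop
  set N' : X → Set (X × S) := fun x => N x ∩ (fun q : X × S => (q.1, o)) ⁻¹' N x with hN'
  have hN'o : ∀ x, IsOpen (N' x) := fun x => (hN x).1.inter ((hN x).1.preimage hoc)
  have hχc : ∀ x, ContinuousOn (χ x) (N' x) := fun x =>
    ((hφ x).continuousOn.mono Set.inter_subset_left).div
      ((hφ x).continuousOn.comp hoc.continuousOn fun _ hq => hq.2) fun q hq => hφ0 x _ hq.2
  have hχ1 : ∀ x p, (p, o) ∈ N x → χ x (p, o) = 1 := fun x p hp => div_self (hφ0 x _ hp)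
  have hprod : ∀ x, ∃ (D : Set X) (W : Set S), IsOpen D ∧ IsOpen W ∧ x ∈ D ∧ o ∈ W ∧
      ∀ q ∈ D ×ˢ W, q ∈ N' x ∧ ‖χ x q - 1‖ < 1 := by
    intro x
    have hx : (x, o) ∈ N' x := ⟨(hN x).2.1, (hN x).2.1⟩
    have h1 : {q | q ∈ N' x ∧ ‖χ x q - 1‖ < 1} ∈ 𝓝 (x, o) := by
      refine Filter.inter_mem ((hN'o x).mem_nhds hx) ?_
      have h2 := (((hχc x).continuousAt ((hN'o x).mem_nhds hx)).sub_const 1).norm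
      refine h2.eventually (gt_mem_nhds ?_)
      show ‖χ x (x, o) - 1‖ < 1
      rw [hχ1 x x hx.1, sub_self, norm_zero]
      exact one_pos
    obtain ⟨D, W, hD, hxD, hW, hoW, hDW⟩ := mem_nhds_prod_iff'.1 h1
    exact ⟨D, W, hD, hW, hxD, hoW, fun q hq => hDW hq⟩
  choose D W hD hW hxD hoW hDW using hprod
  obtain ⟨F, hF⟩ := CompactSpace.elim_nhds_subcover D fun x => (hD x).mem_nhds (hxD x)
  have hW₀ : IsOpen (⋂ x ∈ F, W x) := isOpen_biInter_finset fun x _ => hW x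
  have hoW₀ : o ∈ ⋂ x ∈ F, W x := Set.mem_iInter₂.2 fun x _ => hoW x
  have : LocallyConnectedSpace S := ChartedSpace.locallyConnectedSpace (EuclideanSpace ℂ (Fin k)) S
  -- Finitely many product neighbourhoods give one parameter neighbourhood; its connected component
  -- is taken so that an `n`-th root of unity equal to `1` at `o` stays `1`.
  set W' := connectedComponentIn (⋂ x ∈ F, W x) o with hW'
  have hW'o : IsOpen W' := hW₀.connectedComponentIn
  have hoW' : o ∈ W' := mem_connectedComponentIn hoW₀
  have hW'sub : ∀ x ∈ F, W' ⊆ W x := fun x hx s hs =>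
    Set.mem_iInter₂.1 (connectedComponentIn_subset _ _ hs) x hx
  set D' : X → Set X := fun x => {p | x ∈ F ∧ p ∈ D x} with hD'
  have hD'W : ∀ x, ∀ p ∈ D' x, ∀ s ∈ W', (p, s) ∈ N' x ∧ ‖χ x (p, s) - 1‖ < 1 := fun x p hp s hs =>
    hDW x _ ⟨hp.2, hW'sub x hp.1 hs⟩
  have hslit : ∀ x, ∀ p ∈ D' x, ∀ s ∈ W', χ x (p, s) ∈ slitPlane := fun x p hp s hs => by
    have := mem_slitPlane_of_norm_lt_one (hD'W x p hp s hs).2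
    rwa [add_sub_cancel] at this
  set θ : X → X × S → ℂ := fun x q => exp (log (χ x q) / n) with hθ
  have hn0 : (n : ℂ) ≠ 0 := by exact_mod_cast hn.ne'
  have hθn : ∀ x, ∀ p ∈ D' x, ∀ s ∈ W', θ x (p, s) ^ n = χ x (p, s) := fun x p hp s hs => by
    rw [hθ, ← exp_nat_mul, mul_div_cancel₀ _ hn0, exp_log (slitPlane_ne_zero (hslit x p hp s hs))]
  have hθo : ∀ x, ∀ p ∈ D' x, θ x (p, o) = 1 := fun x p hp => by
    simp only [hθ]
    rw [hχ1 x p (hD'W x p hp o hoW').1.1, log_one, zero_div, exp_zero]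
  have hθc : ∀ x, ∀ p ∈ D' x, ContinuousOn (fun s => θ x (p, s)) W' := fun x p hp => by
    have h1 : ContinuousOn (fun s => χ x (p, s)) W' :=
      (hχc x).comp (by fun_prop) fun s hs => (hD'W x p hp s hs).1
    exact ((h1.clog fun s hs => hslit x p hp s hs).div_const _).cexp
  refine ⟨W', D', θ, hW'o, hoW', fun x => ?_, fun p => ?_, fun x p hp s hs => ?_,
    fun x s hs => ?_, fun x p => exp_ne_zero _, fun x y p hp s hs => ?_⟩
  · by_cases hx : x ∈ F
    · simpa [hD', hx] using hD x
    · simp [hD', hx]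
  · have : p ∈ ⋃ x ∈ F, D x := hF ▸ Set.mem_univ p
    obtain ⟨x, hx, hp⟩ := Set.mem_iUnion₂.1 this
    exact ⟨x, hx, hp⟩
  · exact (hN x).2.2 (hD'W x p hp s hs).1.1
  · have h1 : ∀ t : S, ContMDiffOn 𝓘(ℂ, EuclideanSpace ℂ (Fin m)) 𝓘(ℂ, ℂ) ω
        (fun p => φ x (p, t)) {p | (p, t) ∈ N x} := fun t =>
      (hφ x).comp (contMDiff_id.prodMk contMDiff_const).contMDiffOn fun _ hp => hp
    intro p hp
    have h2 : ContMDiffWithinAt 𝓘(ℂ, EuclideanSpace ℂ (Fin m)) 𝓘(ℂ, ℂ) ω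
        (fun p => χ x (p, s)) (D' x) p := by
      simp only [hχ, div_eq_mul_inv]
      exact ((h1 s).mono (fun p hp => (hD'W x p hp s hs).1.1) p hp).mul
        (((h1 o).mono (fun p hp => (hD'W x p hp s hs).1.2) p hp).inv₀
          (hφ0 x _ (hD'W x p hp s hs).1.2))
    have h3 : ContDiffAt ℂ ω (fun z => exp (log z / n)) (χ x (p, s)) :=
      ((contDiffAt_log (hslit x p hp s hs)).div_const _).cexp
    exact ContMDiffAt.comp_contMDiffWithinAt (g := fun z => exp (log z / n)) p h3.contMDiffAt h2
  · have hVx : ∀ s ∈ W', (p, s) ∈ N x := fun s hs => (hD'W x p hp.1 s hs).1.1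
    have hVy : ∀ s ∈ W', (p, s) ∈ N y := fun s hs => (hD'W y p hp.2 s hs).1.1
    have hc : ContinuousOn (fun s => L.c (x, o) (y, o) (p, s)) W' :=
      (L.hol (x, o) (y, o)).continuousOn.comp (by fun_prop) fun s hs =>
        ⟨(hN x).2.2 (hVx s hs), (hN y).2.2 (hVy s hs)⟩
    have h1 := eq_one_of_pow_eq_one (isPreconnected_connectedComponentIn) hn
      (f := fun s => θ x (p, s) * L.c (x, o) (y, o) (p, s) / θ y (p, s))
      (((hθc x p hp.1).mul hc).div (hθc y p hp.2) fun s _ => exp_ne_zero _)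
      (fun s hs => by
        rw [div_pow, mul_pow, hθn x p hp.1 s hs, hθn y p hp.2 s hs]
        have h2 := hφc x y (p, s) ⟨hVx s hs, hVy s hs⟩
        have h3 := hφc x y (p, o) ⟨hVx o hoW', hVy o hoW'⟩
        rw [hL x y p ⟨(hN x).2.2 (hVx o hoW'), (hN y).2.2 (hVy o hoW')⟩, one_pow, mul_one] at h3
        have h4 := hφ0 y _ (hVy s hs)
        have h5 := hφ0 y _ (hVy o hoW')
        simp only [hχ]
        rw [h3, div_mul_eq_mul_div, h2]
        exact div_self (div_ne_zero h4 h5))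
      hoW' (by
        have := hL x y p ⟨(hN x).2.2 (hVx o hoW'), (hN y).2.2 (hVy o hoW')⟩
        simp only [hθo x p hp.1, hθo y p hp.2]
        rw [this]
        norm_num) hs
    exact eq_of_div_eq_one h1

end Root

/-! ## Isomorphisms of determinant bundles -/

section DetIso

variable {E H : Type*} [NormedAddCommGroup E] [NormedSpace ℂ E] [TopologicalSpace H]
  {I : ModelWithCorners ℂ E H} {M : Type*} [TopologicalSpace M] [ChartedSpace H M] {n : ℕ}
  {A B C : HolBundle I M n}

namespace HolBundle

theorem contMDiffOn_det (A : HolBundle I M n) (i j : M) :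
    ContMDiffOn I 𝓘(ℂ, ℂ) ω (fun p => (A.trans i j p).det) (A.U i ∩ A.U j) :=
  contMDiffOn_matrix_det (A.hol i j)

theorem det_iso_iff : A.det.Iso B.det ↔ ∃ h : M → M → ℂ,
    (∀ i, ContMDiffOn I 𝓘(ℂ, ℂ) ω (h i) (A.U i ∩ B.U i)) ∧
    (∀ i, ∀ p ∈ A.U i ∩ B.U i, h i p ≠ 0) ∧
    ∀ i j, ∀ p ∈ (A.U i ∩ B.U i) ∩ (A.U j ∩ B.U j),
      h i p * (A.trans i j p).det = (B.trans i j p).det * h j p := by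
  constructor
  · rintro ⟨h, h1, h2, h3⟩
    refine ⟨fun i p => h i p 0 0, fun i => (h1 i 0 0).mono fun p hp => ⟨hp, trivial⟩,
      fun i p hp => ?_, fun i j p hp => ?_⟩
    · have := (Matrix.isUnit_iff_isUnit_det _).1 (h2 i p ⟨hp, trivial⟩)
      rw [Matrix.det_fin_one] at this
      exact this.ne_zero
    · have := congrFun (congrFun (h3 i j p ⟨hp, trivial⟩) 0) 0
      simpa [Matrix.mul_apply, det] using this
  · rintro ⟨h, h1, h2, h3⟩
    refine ⟨fun i p => Matrix.of fun _ _ => h i p, fun i a b => (h1 i).mono fun p hp => hp.1,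
      fun i p hp => ?_, fun i j p hp => ?_⟩
    · rw [Matrix.isUnit_iff_isUnit_det, Matrix.det_fin_one]
      exact isUnit_iff_ne_zero.2 (h2 i p hp.1)
    · ext a b
      simpa [Matrix.mul_apply, det] using h3 i j p hp.1

/-- Isomorphisms of determinant bundles in terms of their coefficients at `p` in the trivializations
of index `p`. -/
theorem det_iso_of_diagonal (l : M → ℂ) (h0 : ∀ p, l p ≠ 0)
    (hl : ∀ x, ContMDiffAt I 𝓘(ℂ, ℂ) ω
      (fun p => (B.trans x p p).det * l p * (A.trans p x p).det) x) : A.det.Iso B.det := by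
  refine det_iso_iff.2 ⟨fun i p => (B.trans i p p).det * l p * (A.trans p i p).det,
    fun i x hx => ?_, fun i p hp => ?_, fun i j p hp => ?_⟩
  · refine ContMDiffAt.contMDiffWithinAt ?_
    have h1 := ((B.contMDiffOn_det i x).contMDiffAt
      (((B.isOpen_U i).inter (B.isOpen_U x)).mem_nhds ⟨hx.2, B.mem_U x⟩))
    have h2 := ((A.contMDiffOn_det x i).contMDiffAt
      (((A.isOpen_U x).inter (A.isOpen_U i)).mem_nhds ⟨A.mem_U x, hx.1⟩))
    refine ((h1.mul (hl x)).mul h2).congr_of_eventuallyEq ?_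
    filter_upwards [(A.isOpen_U i).mem_nhds hx.1, (B.isOpen_U i).mem_nhds hx.2,
      (A.isOpen_U x).mem_nhds (A.mem_U x), (B.isOpen_U x).mem_nhds (B.mem_U x)] with p a1 a2 a3 a4
    rw [← A.det_mul_det (A.mem_U p) a3 a1, ← B.det_mul_det a2 a4 (B.mem_U p)]
    simp only [Pi.mul_apply]
    ring
  · exact mul_ne_zero (mul_ne_zero (B.det_ne_zero hp.2 (B.mem_U p)) (h0 p))
      (A.det_ne_zero (A.mem_U p) hp.1)
  · dsimp only
    rw [← A.det_mul_det (A.mem_U p) hp.1.1 hp.2.1, ← B.det_mul_det hp.1.2 hp.2.2 (B.mem_U p)]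
    ring

theorem det_iso_symm (h : A.det.Iso B.det) : B.det.Iso A.det := by
  obtain ⟨h, h1, h2, h3⟩ := det_iso_iff.1 h
  refine det_iso_iff.2 ⟨fun i p => (h i p)⁻¹, fun i p hp => ?_, fun i p hp => ?_, fun i j p hp => ?_⟩
  · exact ((h1 i).mono fun p hp => ⟨hp.2, hp.1⟩).inv₀ (fun p hp => h2 i p ⟨hp.2, hp.1⟩) p hp
  · exact inv_ne_zero (h2 i p ⟨hp.2, hp.1⟩)
  · have a1 := h2 i p ⟨hp.1.2, hp.1.1⟩
    have a2 := h2 j p ⟨hp.2.2, hp.2.1⟩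
    have a3 := h3 i j p ⟨⟨hp.1.2, hp.1.1⟩, ⟨hp.2.2, hp.2.1⟩⟩
    field_simp
    linear_combination -a3

/-- Composing in trivializations of a fixed index `i` works only on `B.U i`, which need not contain
`A.U i ∩ C.U i`. The coefficients at `p` in index `p` are always defined, so the composite is given
by those. -/
theorem det_iso_trans (h : A.det.Iso B.det) (h' : B.det.Iso C.det) : A.det.Iso C.det := by
  obtain ⟨h, h1, h2, h3⟩ := det_iso_iff.1 h
  obtain ⟨h', h1', h2', h3'⟩ := det_iso_iff.1 h'
  refine det_iso_of_diagonal (fun p => h' p p * h p p) (fun p => mul_ne_zero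
    (h2' p p ⟨B.mem_U p, C.mem_U p⟩) (h2 p p ⟨A.mem_U p, B.mem_U p⟩)) fun x => ?_
  have a1 := (A.isOpen_U x).mem_nhds (A.mem_U x)
  have a2 := (B.isOpen_U x).mem_nhds (B.mem_U x)
  have a3 := (C.isOpen_U x).mem_nhds (C.mem_U x)
  refine (((h1' x).contMDiffAt (Filter.inter_mem a2 a3)).mul
    ((h1 x).contMDiffAt (Filter.inter_mem a1 a2))).congr_of_eventuallyEq ?_
  filter_upwards [a1, a2, a3] with p b1 b2 b3
  have e1 := h3 p x p ⟨⟨A.mem_U p, B.mem_U p⟩, ⟨b1, b2⟩⟩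
  have e2 := h3' p x p ⟨⟨B.mem_U p, C.mem_U p⟩, ⟨b2, b3⟩⟩
  have e3 := C.det_mul_det b3 (C.mem_U p) b3
  rw [C.det_self b3] at e3
  simp only [Pi.mul_apply]
  linear_combination (C.trans x p p).det * h' p p * e1 + (C.trans x p p).det * h x p * e2 +
    h' x p * h x p * e3

end HolBundle

end DetIso

/-! ## Determinants of Ricci-flat families -/

section DetLine

variable {E H : Type*} [NormedAddCommGroup E] [NormedSpace ℂ E] [TopologicalSpace H]
  {I : ModelWithCorners ℂ E H} {J : ModelWithCorners ℝ E H} {M : Type*} [TopologicalSpace M]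
  [ChartedSpace H M]
  {E' H' : Type*} [NormedAddCommGroup E'] [NormedSpace ℂ E'] [TopologicalSpace H']
  {I' : ModelWithCorners ℂ E' H'} {J' : ModelWithCorners ℝ E' H'} {M' : Type*}
  [TopologicalSpace M'] [ChartedSpace H' M'] {n : ℕ} {A B : HolBundle I M n}

/-- Pullback of a metric. -/
def HermMetric.pullback (g : HermMetric J A) (f : M' → M) (hf : ContMDiff I' I ω f)
    (hf' : ContMDiff J' J ∞ f) : HermMetric J' (A.pullback f hf) where
  gram i p := g.gram (f i) (f p)
  smooth i a b := (g.smooth (f i) a b).comp hf'.contMDiffOn (fun _ hp => hp)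
  posDef i p hp := g.posDef (f i) (f p) hp
  compat i j p hp := g.compat (f i) (f j) (f p) hp

/-- The line bundle `det A ⊗ (det B)⁻¹` with the induced metric. -/
def MetricLine.detDiv (g : HermMetric J A) (g' : HermMetric J B) : MetricLine I J M where
  V i := A.U i ∩ B.U i
  cover := A.cover.inter B.cover
  c i j p := (A.trans i j p).det * ((B.trans i j p).det)⁻¹
  hol i j := ((A.contMDiffOn_det i j).mono fun p hp => ⟨hp.1.1, hp.2.1⟩).mul
    (((B.contMDiffOn_det i j).mono fun p hp => ⟨hp.1.2, hp.2.2⟩).inv₀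
      fun p hp => B.det_ne_zero hp.1.2 hp.2.2)
  self i p hp := by rw [A.det_self hp.1, B.det_self hp.2, inv_one, mul_one]
  cocycle i j k p hp := by
    rw [← A.det_mul_det hp.1.1.1 hp.1.2.1 hp.2.1, ← B.det_mul_det hp.1.1.2 hp.1.2.2 hp.2.2,
      mul_inv]
    ring
  μ i p := g.detRe i p * (g'.detRe i p)⁻¹
  smooth i := ((g.contMDiffOn_detRe i).mono Set.inter_subset_left).mul
    (((g'.contMDiffOn_detRe i).mono Set.inter_subset_right).inv₀
      fun p hp => (g'.detRe_pos hp.2).ne')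
  pos i p hp := mul_pos (g.detRe_pos hp.1) (inv_pos.2 (g'.detRe_pos hp.2))
  compat i j p hp := by
    rw [g.detRe_compat hp.1.1 hp.2.1, g'.detRe_compat hp.1.2 hp.2.2, norm_mul, norm_inv]
    rw [mul_inv]
    ring

end DetLine

/-! ### Ricci-flat families have constant determinant. -/

section Local

variable {m k n r : ℕ} {X : Type*} [TopologicalSpace X]
  [ChartedSpace (EuclideanSpace ℂ (Fin m)) X] {U : Type*} [TopologicalSpace U]
  [ChartedSpace (EuclideanSpace ℂ (Fin k)) U]

/-- The domain of the centered chart at `t₀`. -/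
def centeredDomain (t₀ : U) : TopologicalSpace.Opens (EuclideanSpace ℂ (Fin k)) where
  carrier := {z | z + chartAt (EuclideanSpace ℂ (Fin k)) t₀ t₀ ∈
    (chartAt (EuclideanSpace ℂ (Fin k)) t₀).target}
  is_open' := (chartAt (EuclideanSpace ℂ (Fin k)) t₀).open_target.preimage (by fun_prop)

/-- The inverse of the centered chart at `t₀`. -/
def centeredSymm (t₀ : U) (z : centeredDomain (k := k) t₀) : U :=
  (chartAt (EuclideanSpace ℂ (Fin k)) t₀).symm (z.1 + chartAt (EuclideanSpace ℂ (Fin k)) t₀ t₀)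

theorem zero_mem_centeredDomain (t₀ : U) :
    (0 : EuclideanSpace ℂ (Fin k)) ∈ centeredDomain (k := k) t₀ := by
  show 0 + chartAt (EuclideanSpace ℂ (Fin k)) t₀ t₀ ∈
    (chartAt (EuclideanSpace ℂ (Fin k)) t₀).target
  rw [zero_add]
  exact mem_chart_target _ _

theorem centeredSymm_zero (t₀ : U) :
    centeredSymm t₀ ⟨0, zero_mem_centeredDomain (k := k) t₀⟩ = t₀ := by
  simp only [centeredSymm, zero_add]
  exact (chartAt (EuclideanSpace ℂ (Fin k)) t₀).left_inv (mem_chart_source _ _)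

theorem contMDiff_centeredSymm {𝕜 : Type*} [NontriviallyNormedField 𝕜]
    [NormedSpace 𝕜 (EuclideanSpace ℂ (Fin k))] {l : WithTop ℕ∞}
    [IsManifold 𝓘(𝕜, EuclideanSpace ℂ (Fin k)) l U] (t₀ : U) :
    ContMDiff 𝓘(𝕜, EuclideanSpace ℂ (Fin k)) 𝓘(𝕜, EuclideanSpace ℂ (Fin k)) l
      (centeredSymm (k := k) t₀) := by
  have h1 : ContMDiff 𝓘(𝕜, EuclideanSpace ℂ (Fin k)) 𝓘(𝕜, EuclideanSpace ℂ (Fin k)) l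
      (fun z : centeredDomain (k := k) t₀ => z.1 + chartAt (EuclideanSpace ℂ (Fin k)) t₀ t₀) :=
    (contDiff_id.add contDiff_const).contMDiff.comp contMDiff_subtype_val
  exact contMDiffOn_chart_symm.comp_contMDiff h1 fun z => z.2

theorem centeredSymm_mem_nhds (t₀ : U) {W : Set (centeredDomain (k := k) t₀)} (hW : IsOpen W)
    (h0 : ⟨0, zero_mem_centeredDomain t₀⟩ ∈ W) : centeredSymm t₀ '' W ∈ 𝓝 t₀ := by
  set e := chartAt (EuclideanSpace ℂ (Fin k)) t₀ with he
  have ht : t₀ ∈ e.source := mem_chart_source _ _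
  have h1 : (Subtype.val '' W : Set (EuclideanSpace ℂ (Fin k))) ∈ 𝓝 0 :=
    ((centeredDomain t₀).isOpen.isOpenMap_subtype_val W hW).mem_nhds ⟨_, h0, rfl⟩
  have h2 : Filter.Tendsto (fun t => e t - e t₀) (𝓝 t₀) (𝓝 0) := by
    have : Filter.Tendsto (fun t => e t - e t₀) (𝓝 t₀) (𝓝 (e t₀ - e t₀)) :=
      (e.continuousAt ht).sub_const (e t₀)
    rwa [sub_self] at this
  filter_upwards [h2 h1, e.open_source.mem_nhds ht] with t ⟨z, hz, hzt⟩ hts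
  refine ⟨z, hz, ?_⟩
  show e.symm (z.1 + e t₀) = t
  rw [hzt, sub_add_cancel, e.left_inv hts]

/-- The determinant is locally constant in a Ricci-flat family when there is a Ricci-rigid bundle. -/
theorem HolBundle.RicciRigid.eventually_det_iso [CompactSpace X] [T2Space X]
    [IsManifold 𝓘(ℂ, EuclideanSpace ℂ (Fin m)) ω X]
    [IsManifold 𝓘(ℂ, EuclideanSpace ℂ (Fin k)) ω U]
    {E₀ : HolBundle 𝓘(ℂ, EuclideanSpace ℂ (Fin m)) X n} (hE : E₀.RicciRigid) (hn : 0 < n)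
    {A : Family m k X U r} (g : FamilyMetric A) {t₀ : U} (hg : FamilyMetric.RicciFlat g t₀) :
    ∀ᶠ t in 𝓝 t₀, (Family.fiber A t).det.Iso (Family.fiber A t₀).det := by
  have : IsManifold 𝓘(ℝ, EuclideanSpace ℂ (Fin k)) ∞ U :=
    (isUnderlying_self (EuclideanSpace ℂ (Fin k))).isManifold
  set S := centeredDomain (k := k) t₀ with hS
  set ψ : S → U := centeredSymm (k := k) t₀ with hψ
  have h0 := zero_mem_centeredDomain (k := k) t₀
  have hψ0 : ψ ⟨0, h0⟩ = t₀ := centeredSymm_zero t₀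
  have hψC : ContMDiff 𝓘(ℂ, EuclideanSpace ℂ (Fin k)) 𝓘(ℂ, EuclideanSpace ℂ (Fin k)) ω ψ :=
    contMDiff_centeredSymm t₀
  have hψR : ContMDiff 𝓘(ℝ, EuclideanSpace ℂ (Fin k)) 𝓘(ℝ, EuclideanSpace ℂ (Fin k)) ∞ ψ :=
    contMDiff_centeredSymm t₀
  -- The line bundle `det 𝓔_{ψ s} ⊗ (det 𝓔_{t₀})⁻¹`, with parameters read in a chart centred at
  -- `t₀`. The logarithm of its weight is a difference of logarithms of determinants, so
  -- Ricci-flatness says exactly that it is fibrewise pluriharmonic.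
  set L : MetricLineFamily m k X S := MetricLine.detDiv
    (g.pullback (fun q : X × S => (q.1, ψ q.2))
      (contMDiff_fst.prodMk (hψC.comp contMDiff_snd))
      (contMDiff_fst.prodMk (hψR.comp contMDiff_snd)))
    (g.pullback (fun q : X × S => (q.1, t₀)) (contMDiff_fst.prodMk contMDiff_const)
      (contMDiff_fst.prodMk contMDiff_const)) with hL
  obtain ⟨W, D, θ, hW, h0W, hD, hcov, hDV, hθ, hθ0, hθc⟩ := hE.exists_root hn h0 L
    (fun x y p hp => by
      have hp1 : (p, t₀) ∈ A.U (x, t₀) := hp.1.2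
      have hp2 : (p, t₀) ∈ A.U (y, t₀) := hp.2.2
      show (A.trans (x, ψ ⟨0, h0⟩) (y, ψ ⟨0, h0⟩) (p, ψ ⟨0, h0⟩)).det *
        ((A.trans (x, t₀) (y, t₀) (p, t₀)).det)⁻¹ = 1
      rw [hψ0]
      exact mul_inv_cancel₀ (A.det_ne_zero hp1 hp2))
    (fun x s => by
      have key : ∀ t : U, ContDiffAt ℝ 2 (fun z => ((Real.log ((FamilyMetric.fiber g t).detRe x
          ((chartAt (EuclideanSpace ℂ (Fin m)) x).symm z)) : ℝ) : ℂ))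
          (chartAt (EuclideanSpace ℂ (Fin m)) x x) := fun t =>
        contDiffAt_log_chart ((Family.fiber A t).isOpen_U x) ((Family.fiber A t).mem_U x)
          ((FamilyMetric.fiber g t).contMDiffOn_detRe x)
          ((FamilyMetric.fiber g t).detRe_pos ((Family.fiber A t).mem_U x))
      have h1 : (fun z => ((Real.log (L.μ (x, s)
          ((chartAt (EuclideanSpace ℂ (Fin m)) x).symm z, s)) : ℝ) : ℂ)) =ᶠ[
          𝓝 (chartAt (EuclideanSpace ℂ (Fin m)) x x)] fun z =>
          ((Real.log ((FamilyMetric.fiber g (ψ s)).detRe x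
            ((chartAt (EuclideanSpace ℂ (Fin m)) x).symm z)) : ℝ) : ℂ) + (-1 : ℂ) *
          ((Real.log ((FamilyMetric.fiber g t₀).detRe x
            ((chartAt (EuclideanSpace ℂ (Fin m)) x).symm z)) : ℝ) : ℂ) := by
        filter_upwards [eventually_chart_symm
          (((Family.fiber A (ψ s)).isOpen_U x).mem_nhds ((Family.fiber A (ψ s)).mem_U x)),
          eventually_chart_symm
          (((Family.fiber A t₀).isOpen_U x).mem_nhds ((Family.fiber A t₀).mem_U x))] with z hz1 hz2
        have e1 := (FamilyMetric.fiber g (ψ s)).detRe_pos hz1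
        have e2 := (FamilyMetric.fiber g t₀).detRe_pos hz2
        rw [← Complex.ofReal_one, ← Complex.ofReal_neg, ← Complex.ofReal_mul, ← Complex.ofReal_add,
          neg_one_mul, ← Real.log_inv, ← Real.log_mul e1.ne' (inv_ne_zero e2.ne')]
        rfl
      rw [ddbar_congr h1, ddbar_add (key _) (contDiffAt_const.mul (key _)),
        ddbar_const_mul (key _)]
      have h2 := hg (ψ s) x
      simp only [curvature] at h2
      change ddbar (fun z => ((Real.log ((FamilyMetric.fiber g (ψ s)).detRe x
        ((chartAt (EuclideanSpace ℂ (Fin m)) x).symm z)) : ℝ) : ℂ)) _ =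
        ddbar (fun z => ((Real.log ((FamilyMetric.fiber g t₀).detRe x
        ((chartAt (EuclideanSpace ℂ (Fin m)) x).symm z)) : ℝ) : ℂ)) _ at h2
      rw [h2, neg_one_smul, add_neg_cancel])
  filter_upwards [centeredSymm_mem_nhds t₀ hW h0W] with t ht
  obtain ⟨s, hs, rfl⟩ := ht
  change (Family.fiber A (ψ s)).det.Iso (Family.fiber A t₀).det
  -- `D x` need not contain `x`, so an index `κ p` with `p ∈ D (κ p)` is chosen. The diagonal
  -- coefficient is `θ (κ p)` transported to the trivializations of index `p`; the gluing of `θ`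
  -- makes the result independent of `κ`.
  choose κ hκ using hcov
  have hV : ∀ x, ∀ p ∈ D x, (p, ψ s) ∈ A.U (x, t₀) ∧ (p, t₀) ∈ A.U (x, t₀) := fun x p hp => by
    have h1 : (p, ψ s) ∈ A.U (x, ψ ⟨0, h0⟩) := (hDV x p hp s hs).1
    rw [hψ0] at h1
    exact ⟨h1, (hDV x p hp s hs).2⟩
  have hc : ∀ x y, ∀ p ∈ D x ∩ D y, θ x (p, s) * ((A.trans (x, t₀) (y, t₀) (p, ψ s)).det *
      ((A.trans (x, t₀) (y, t₀) (p, t₀)).det)⁻¹) = θ y (p, s) := fun x y p hp => by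
    have h1 : θ x (p, s) * ((A.trans (x, ψ ⟨0, h0⟩) (y, ψ ⟨0, h0⟩) (p, ψ s)).det *
      ((A.trans (x, t₀) (y, t₀) (p, t₀)).det)⁻¹) = θ y (p, s) := hθc x y p hp s hs
    rwa [hψ0] at h1
  refine HolBundle.det_iso_of_diagonal (fun p => (A.trans (p, t₀) (κ p, t₀) (p, t₀)).det *
    θ (κ p) (p, s) * (A.trans (κ p, t₀) (p, ψ s) (p, ψ s)).det) (fun p => ?_) fun x => ?_
  · have := hV _ p (hκ p)
    exact mul_ne_zero (mul_ne_zero (A.det_ne_zero (A.mem_U _) this.2) (hθ0 _ _))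
      (A.det_ne_zero this.1 (A.mem_U _))
  · set y := κ x with hy
    have hx := hV y x (hκ x)
    have hι : ∀ t : U, ContMDiff 𝓘(ℂ, EuclideanSpace ℂ (Fin m))
      (𝓘(ℂ, EuclideanSpace ℂ (Fin m)).prod 𝓘(ℂ, EuclideanSpace ℂ (Fin k))) ω
      (fun p : X => (p, t)) := fun t => contMDiff_id.prodMk contMDiff_const
    have h1 : ContMDiffAt 𝓘(ℂ, EuclideanSpace ℂ (Fin m)) 𝓘(ℂ, ℂ) ω
        (fun p => (A.trans (x, t₀) (y, t₀) (p, t₀)).det) x :=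
      ContMDiffAt.comp x (f := fun p : X => (p, t₀)) ((A.contMDiffOn_det (x, t₀) (y, t₀)).contMDiffAt (((A.isOpen_U _).inter
        (A.isOpen_U _)).mem_nhds ⟨A.mem_U _, hx.2⟩)) (hι t₀).contMDiffAt
    have h2 : ContMDiffAt 𝓘(ℂ, EuclideanSpace ℂ (Fin m)) 𝓘(ℂ, ℂ) ω
        (fun p => (A.trans (y, t₀) (x, ψ s) (p, ψ s)).det) x :=
      ContMDiffAt.comp x (f := fun p : X => (p, ψ s)) ((A.contMDiffOn_det (y, t₀) (x, ψ s)).contMDiffAt (((A.isOpen_U _).inter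
        (A.isOpen_U _)).mem_nhds ⟨hx.1, A.mem_U _⟩)) (hι (ψ s)).contMDiffAt
    have h3 := (hθ y s hs).contMDiffAt ((hD y).mem_nhds (hκ x))
    refine ((h1.mul h3).mul h2).congr_of_eventuallyEq ?_
    filter_upwards [(hD y).mem_nhds (hκ x),
      ((A.isOpen_U (x, t₀)).preimage (hι t₀).continuous).mem_nhds (A.mem_U (x, t₀)),
      ((A.isOpen_U (x, ψ s)).preimage (hι (ψ s)).continuous).mem_nhds (A.mem_U (x, ψ s))]
      with p hp b1 b2
    change (p, t₀) ∈ A.U (x, t₀) at b1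
    change (p, ψ s) ∈ A.U (x, ψ s) at b2
    have c1 := hV _ p (hκ p)
    have c2 := hV _ p hp
    show (A.trans (x, t₀) (p, t₀) (p, t₀)).det * ((A.trans (p, t₀) (κ p, t₀) (p, t₀)).det *
      θ (κ p) (p, s) * (A.trans (κ p, t₀) (p, ψ s) (p, ψ s)).det) *
      (A.trans (p, ψ s) (x, ψ s) (p, ψ s)).det = _
    have e1 := A.det_mul_det b1 (A.mem_U (p, t₀)) c1.2
    have e2 := A.det_mul_det c1.1 (A.mem_U (p, ψ s)) b2
    have e3 := hc y (κ p) p ⟨hp, hκ p⟩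
    have e4 := A.det_mul_det b1 c2.2 c1.2
    have e5 := A.det_mul_det c2.1 c1.1 b2
    have e6 := A.det_ne_zero c2.2 c1.2
    calc _ = ((A.trans (x, t₀) (p, t₀) (p, t₀)).det * (A.trans (p, t₀) (κ p, t₀) (p, t₀)).det) *
        θ (κ p) (p, s) * ((A.trans (κ p, t₀) (p, ψ s) (p, ψ s)).det *
        (A.trans (p, ψ s) (x, ψ s) (p, ψ s)).det) := by ring
      _ = _ := by
        rw [e1, e2, ← e3, ← e4]
        simp only [Pi.mul_apply]
        rw [← e5]
        field_simp

/-- Ricci-flat families over a connected base have constant determinant when there is a Ricci-rigid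
bundle. -/
theorem HolBundle.RicciRigid.preservesDet [CompactSpace X] [T2Space X] [ConnectedSpace U]
    [IsManifold 𝓘(ℂ, EuclideanSpace ℂ (Fin m)) ω X]
    [IsManifold 𝓘(ℂ, EuclideanSpace ℂ (Fin k)) ω U]
    {E₀ : HolBundle 𝓘(ℂ, EuclideanSpace ℂ (Fin m)) X n} (hE : E₀.RicciRigid) (hn : 0 < n)
    {A : Family m k X U r} (g : FamilyMetric A) {o : U} (hg : FamilyMetric.RicciFlat g o) :
    Family.PreservesDet A o := by
  -- Equality of all curvature forms makes the family Ricci-flat relative to every point, not only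
  -- `o`.
  have hloc : ∀ t₀ : U, ∀ᶠ t in 𝓝 t₀, (Family.fiber A t).det.Iso (Family.fiber A t₀).det :=
    fun t₀ => hE.eventually_det_iso hn g fun t x => (hg t x).trans (hg t₀ x).symm
  have hclopen : IsClopen {t : U | (Family.fiber A t).det.Iso (Family.fiber A o).det} := by
    constructor
    · rw [← isOpen_compl_iff, isOpen_iff_mem_nhds]
      intro t₀ h₀
      filter_upwards [hloc t₀] with t ht ht'
      exact h₀ (HolBundle.det_iso_trans (HolBundle.det_iso_symm ht) ht')
    · rw [isOpen_iff_mem_nhds]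
      intro t₀ h₀
      filter_upwards [hloc t₀] with t ht
      exact HolBundle.det_iso_trans ht h₀
  have huniv := hclopen.eq_univ ⟨o, (hloc o).self_of_nhds⟩
  exact fun t => Set.eq_univ_iff_forall.1 huniv t

end Local

/-! ## Families with constant determinant -/

section Extension

variable {m k r : ℕ} {X U : Type*} [TopologicalSpace X]
  [ChartedSpace (EuclideanSpace ℂ (Fin m)) X] [TopologicalSpace U]
  [ChartedSpace (EuclideanSpace ℂ (Fin k)) U]

/-- A metric on a member of a family extends to the family. -/
theorem exists_familyMetric_agree [CompactSpace X] [T2Space X] [T2Space U] [SigmaCompactSpace U]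
    [IsManifold 𝓘(ℂ, EuclideanSpace ℂ (Fin m)) ω X] [IsManifold 𝓘(ℂ, EuclideanSpace ℂ (Fin k)) ω U]
    (A : Family m k X U r) (o : U)
    (g₀ : HermMetric 𝓘(ℝ, EuclideanSpace ℂ (Fin m)) (Family.fiber A o)) :
    ∃ g : FamilyMetric A, (FamilyMetric.fiber g o).Agree g₀ := by
  classical
  have hι : Continuous fun q : X × U => (q.1, o) := by fun_prop
  have hNo : ∀ {i : X × U}, i.2 = o → A.U i = A.U (i.1, o) := fun {i} h => by rw [← h]
  obtain ⟨g, hg⟩ := exists_hermMetric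
    (isUnderlying_prod (EuclideanSpace ℂ (Fin m)) (EuclideanSpace ℂ (Fin k))) A
    -- Neighbourhoods of points off the fibre over `o` are shrunk to avoid it. At points over `o`
    -- only copies of `g₀` contribute, and they agree after change of trivialization, so the glued
    -- metric restricts to `g₀`.
    (fun i => A.U i ∩ if i.2 = o then (fun q : X × U => (q.1, o)) ⁻¹' A.U (i.1, o) else {q | q.2 ≠ o})
    (fun i => by
      by_cases hi : i.2 = o
      · simp only [hi, if_true]
        refine ⟨(A.isOpen_U i).inter ((A.isOpen_U _).preimage hι), A.mem_U i, A.mem_U (i.1, o)⟩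
      · simp only [hi, if_false]
        exact ⟨(A.isOpen_U i).inter (isOpen_ne.preimage continuous_snd), A.mem_U i, hi⟩)
    (fun i => Set.inter_subset_left)
    (fun i q => if i.2 = o then g₀.gram i.1 q.1 else 1)
    (fun i a b => by
      by_cases hi : i.2 = o
      · simp only [hi, if_true]
        exact (g₀.smooth i.1 a b).comp contMDiff_fst.contMDiffOn fun q hq => hq.2
      · simp only [hi, if_false]
        exact contMDiffOn_const)
    (fun i q hq => by
      by_cases hi : i.2 = o
      · simp only [hi, if_true] at hq ⊢
        exact g₀.posDef i.1 q.1 hq.2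
      · simp only [hi, if_false]
        exact Matrix.PosDef.one)
  refine ⟨g, fun i p hp => hg (i, o) (p, o) hp _ fun x hx => ?_⟩
  obtain ⟨x, t⟩ := x
  by_cases ht : t = o
  · subst ht
    simp only [if_true] at hx ⊢
    exact (g₀.compat x i p ⟨hx.2, hp⟩).symm
  · simp only [ht, if_false] at hx
    exact absurd rfl hx.2

/-- Isomorphisms of `det 𝓔_t` with `det 𝓔_o`, equal to the identity for `t = o`. -/
structure DetIsoFamily (A : Family m k X U r) (o : U) where
  h : U → X → X → ℂ
  hol : ∀ t i, ContMDiffOn 𝓘(ℂ, EuclideanSpace ℂ (Fin m)) 𝓘(ℂ, ℂ) ω (h t i)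
    ((Family.fiber A t).U i ∩ (Family.fiber A o).U i)
  ne_zero : ∀ t i p, (p, t) ∈ A.U (i, t) → (p, o) ∈ A.U (i, o) → h t i p ≠ 0
  rel : ∀ t i j p, (p, t) ∈ A.U (i, t) → (p, o) ∈ A.U (i, o) → (p, t) ∈ A.U (j, t) →
    (p, o) ∈ A.U (j, o) → h t i p * (A.trans (i, t) (j, t) (p, t)).det =
      (A.trans (i, o) (j, o) (p, o)).det * h t j p
  one : ∀ i p, h o i p = 1

theorem Family.PreservesDet.nonempty_detIsoFamily {A : Family m k X U r} {o : U}
    (hA : Family.PreservesDet A o) : Nonempty (DetIsoFamily A o) := by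
  have H : ∀ t, ∃ h : X → X → ℂ,
      ((∀ i, ContMDiffOn 𝓘(ℂ, EuclideanSpace ℂ (Fin m)) 𝓘(ℂ, ℂ) ω (h i)
        ((Family.fiber A t).U i ∩ (Family.fiber A o).U i)) ∧
      (∀ i, ∀ p ∈ (Family.fiber A t).U i ∩ (Family.fiber A o).U i, h i p ≠ 0) ∧
      ∀ i j, ∀ p ∈ ((Family.fiber A t).U i ∩ (Family.fiber A o).U i) ∩
        ((Family.fiber A t).U j ∩ (Family.fiber A o).U j),
        h i p * ((Family.fiber A t).trans i j p).det =
          ((Family.fiber A o).trans i j p).det * h j p) ∧ (t = o → ∀ i p, h i p = 1) := by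
    intro t
    -- At `t = o` the identity is chosen, so that the rescaling is trivial on the central fibre. For
    -- other `t` the choice is arbitrary.
    by_cases ht : t = o
    · subst ht
      exact ⟨fun _ _ => 1, ⟨fun _ => contMDiffOn_const, fun _ _ _ => one_ne_zero,
        fun i j p _ => by rw [one_mul, mul_one]⟩, fun _ _ _ => rfl⟩
    · obtain ⟨h, hh⟩ := HolBundle.det_iso_iff.1 (hA t)
      exact ⟨h, hh, fun h => absurd h ht⟩
  choose h hh h1 using H
  exact ⟨⟨h, fun t => (hh t).1, fun t i p hp hp' => (hh t).2.1 i p ⟨hp, hp'⟩,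
    fun t i j p a b c d => (hh t).2.2 i j p ⟨⟨a, b⟩, ⟨c, d⟩⟩, h1 o rfl⟩⟩

theorem contMDiff_mk_right {𝕜 : Type*} [NontriviallyNormedField 𝕜]
    [NormedSpace 𝕜 (EuclideanSpace ℂ (Fin m))] [NormedSpace 𝕜 (EuclideanSpace ℂ (Fin k))]
    {l : WithTop ℕ∞} (t : U) : ContMDiff 𝓘(𝕜, EuclideanSpace ℂ (Fin m))
      (𝓘(𝕜, EuclideanSpace ℂ (Fin m)).prod 𝓘(𝕜, EuclideanSpace ℂ (Fin k))) l
      (fun p : X => (p, t)) :=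
  contMDiff_id.prodMk contMDiff_const

namespace DetIsoFamily

variable {A : Family m k X U r} {o : U} (Φ : DetIsoFamily A o)

/-- The coefficient at `p` in the trivializations of index `p`. -/
def coeff (t : U) (p : X) : ℂ := Φ.h t p p

theorem coeff_ne_zero (t : U) (p : X) : Φ.coeff t p ≠ 0 :=
  Φ.ne_zero t p p (A.mem_U _) (A.mem_U _)

theorem coeff_one (p : X) : Φ.coeff o p = 1 := Φ.one p p

theorem coeff_eq {t : U} {i p : X} (h : (p, t) ∈ A.U (i, t)) (h' : (p, o) ∈ A.U (i, o)) :
    Φ.coeff t p = (A.trans (p, o) (i, o) (p, o)).det * Φ.h t i p *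
      (A.trans (i, t) (p, t) (p, t)).det := by
  have h1 := Φ.rel t p i p (A.mem_U _) (A.mem_U _) h h'
  rw [← h1, mul_assoc, A.det_mul_det (A.mem_U _) h (A.mem_U _), A.det_self (A.mem_U _), mul_one,
    coeff]

/-- The isomorphism over `t` divided by the isomorphism over `t₀`, in the trivialization of index
`(x, t₀)`. -/
def quot (t₀ : U) (x : X) (q : X × U) : ℂ :=
  Φ.coeff q.2 q.1 * (A.trans q (x, t₀) q).det /
    (Φ.coeff t₀ q.1 * (A.trans (q.1, t₀) (x, t₀) (q.1, t₀)).det)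

theorem quot_ne_zero {t₀ : U} {x : X} {q : X × U} (h : q ∈ A.U (x, t₀))
    (h' : (q.1, t₀) ∈ A.U (x, t₀)) : Φ.quot t₀ x q ≠ 0 :=
  div_ne_zero (mul_ne_zero (Φ.coeff_ne_zero _ _) (A.det_ne_zero (A.mem_U _) h))
    (mul_ne_zero (Φ.coeff_ne_zero _ _) (A.det_ne_zero (A.mem_U _) h'))

/-- The diagonal coefficients change their index with the point. Rewriting in a fixed index `i`
makes holomorphy along `X` visible. -/
theorem quot_eq {t₀ : U} {x : X} {q : X × U} (h : q ∈ A.U (x, t₀))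
    (h' : (q.1, t₀) ∈ A.U (x, t₀)) {i : X} (hi : q ∈ A.U (i, q.2)) (hi₀ : (q.1, t₀) ∈ A.U (i, t₀))
    (hio : (q.1, o) ∈ A.U (i, o)) :
    Φ.quot t₀ x q = Φ.h q.2 i q.1 * (A.trans (i, q.2) (x, t₀) q).det *
      (Φ.h t₀ i q.1 * (A.trans (i, t₀) (x, t₀) (q.1, t₀)).det)⁻¹ := by
  have e0 := A.det_ne_zero (A.mem_U (q.1, o)) hio
  have e1 := A.det_mul_det hi (A.mem_U q) h
  have e2 := A.det_mul_det hi₀ (A.mem_U (q.1, t₀)) h'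
  rw [quot, Φ.coeff_eq (t := q.2) (p := q.1) hi hio, Φ.coeff_eq hi₀ hio, ← e1, ← e2]
  have e3 := Φ.ne_zero t₀ i q.1 hi₀ hio
  have e4 := A.det_ne_zero hi₀ (A.mem_U (q.1, t₀))
  have e5 := A.det_ne_zero (A.mem_U (q.1, t₀)) h'
  have e6 : ((q.1, q.2) : X × U) = q := rfl
  rw [e6]
  field_simp

/-- The chosen isomorphisms drop out of the transition function: it depends only on the family, so
it is holomorphic in the parameter as well, and it equals `1` over `t₀`. This is the input for the
gluing estimate. -/
theorem quot_eq_mul {t₀ : U} {x y : X} {q : X × U} (hx : q ∈ A.U (x, t₀))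
    (hx' : (q.1, t₀) ∈ A.U (x, t₀)) (hy : q ∈ A.U (y, t₀)) (hy' : (q.1, t₀) ∈ A.U (y, t₀)) :
    Φ.quot t₀ x q = (A.trans (y, t₀) (x, t₀) q).det *
      ((A.trans (y, t₀) (x, t₀) (q.1, t₀)).det)⁻¹ * Φ.quot t₀ y q := by
  have e1 := A.det_mul_det (A.mem_U q) hy hx
  have e2 := A.det_mul_det (A.mem_U (q.1, t₀)) hy' hx'
  have e3 := A.det_ne_zero hy' hx'
  have e4 := A.det_ne_zero (A.mem_U (q.1, t₀)) hy'
  have e5 := Φ.coeff_ne_zero t₀ q.1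
  rw [quot, quot, ← e1, ← e2]
  field_simp

theorem contMDiffAt_quot_left {t₀ t : U} {x p : X} (h : (p, t) ∈ A.U (x, t₀))
    (h' : (p, t₀) ∈ A.U (x, t₀)) :
    ContMDiffAt 𝓘(ℂ, EuclideanSpace ℂ (Fin m)) 𝓘(ℂ, ℂ) ω (fun p => Φ.quot t₀ x (p, t)) p := by
  have hι : ∀ t : U, ContMDiff 𝓘(ℂ, EuclideanSpace ℂ (Fin m))
    (𝓘(ℂ, EuclideanSpace ℂ (Fin m)).prod 𝓘(ℂ, EuclideanSpace ℂ (Fin k))) ω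
    (fun p : X => (p, t)) := contMDiff_mk_right
  have hnhds : ∀ {t : U} {i : X × U}, (p, t) ∈ A.U i → {p : X | (p, t) ∈ A.U i} ∈ 𝓝 p :=
    fun {t i} h => ((A.isOpen_U i).preimage (hι t).continuous).mem_nhds h
  have hT : ∀ {t : U} {i j : X × U}, (p, t) ∈ A.U i → (p, t) ∈ A.U j →
      ContMDiffAt 𝓘(ℂ, EuclideanSpace ℂ (Fin m)) 𝓘(ℂ, ℂ) ω
        (fun p => (A.trans i j (p, t)).det) p := fun {t i j} hi hj =>
    ContMDiffAt.comp p (f := fun p : X => (p, t)) ((A.contMDiffOn_det i j).contMDiffAt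
      (((A.isOpen_U i).inter (A.isOpen_U j)).mem_nhds ⟨hi, hj⟩)) (hι t).contMDiffAt
  have hh : ∀ t : U, ContMDiffAt 𝓘(ℂ, EuclideanSpace ℂ (Fin m)) 𝓘(ℂ, ℂ) ω (Φ.h t p) p := fun t =>
    (Φ.hol t p).contMDiffAt (Filter.inter_mem (hnhds (A.mem_U (p, t))) (hnhds (A.mem_U (p, o))))
  have h1 := ((hh t).mul (hT (A.mem_U (p, t)) h)).mul
    (((hh t₀).mul (hT (A.mem_U (p, t₀)) h')).inv₀ (mul_ne_zero
      (Φ.ne_zero t₀ p p (A.mem_U _) (A.mem_U _)) (A.det_ne_zero (A.mem_U _) h')))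
  refine h1.congr_of_eventuallyEq ?_
  filter_upwards [hnhds h, hnhds h', hnhds (A.mem_U (p, t)), hnhds (A.mem_U (p, t₀)),
    hnhds (A.mem_U (p, o))] with p' a1 a2 a3 a4 a5
  exact Φ.quot_eq a1 a2 (i := p) a3 a4 a5

end DetIsoFamily

theorem differentiableAt_chart [IsManifold 𝓘(ℂ, EuclideanSpace ℂ (Fin m)) ω X] {f : X → ℂ} {x p : X}
    (hp : p ∈ (chartAt (EuclideanSpace ℂ (Fin m)) x).source)
    (hf : ContMDiffAt 𝓘(ℂ, EuclideanSpace ℂ (Fin m)) 𝓘(ℂ, ℂ) ω f p) :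
    DifferentiableAt ℂ (fun z => f ((chartAt (EuclideanSpace ℂ (Fin m)) x).symm z))
      (chartAt (EuclideanSpace ℂ (Fin m)) x p) := by
  set e := chartAt (EuclideanSpace ℂ (Fin m)) x with he
  have h1 : ContMDiffAt 𝓘(ℂ, EuclideanSpace ℂ (Fin m)) 𝓘(ℂ, EuclideanSpace ℂ (Fin m)) ω e.symm
      (e p) := (contMDiffOn_chart_symm (x := x)).contMDiffAt
        (e.open_target.mem_nhds (e.map_source hp))
  have h2 : ContMDiffAt 𝓘(ℂ, EuclideanSpace ℂ (Fin m)) 𝓘(ℂ, ℂ) ω f (e.symm (e p)) := by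
    rwa [e.left_inv hp]
  exact (contMDiffAt_iff_contDiffAt.1 (ContMDiffAt.comp (e p) h2 h1)).differentiableAt (by simp)

/-- A choice of a point in every connected component. -/
theorem exists_component_base (X : Type*) [TopologicalSpace X] :
    ∃ β : X → X, (∀ x, x ∈ connectedComponent (β x)) ∧
      ∀ x y, y ∈ connectedComponent x → β y = β x := by
  refine ⟨fun x => Function.surjInv ConnectedComponents.surjective_coe (x : ConnectedComponents X),
    fun x => ?_, fun x y h => ?_⟩
  · have h := Function.surjInv_eq ConnectedComponents.surjective_coe (x : ConnectedComponents X)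
    rw [ConnectedComponents.coe_eq_coe.1 h]
    exact mem_connectedComponent
  · have : (y : ConnectedComponents X) = x :=
      ConnectedComponents.coe_eq_coe.2 (connectedComponent_eq h).symm
    dsimp only
    rw [this]

end Extension

/-! ### Smoothness of the normalized isomorphisms and the rescaled metric. -/

section RicciFlatMetric

variable {m k r : ℕ} {X U : Type*} [TopologicalSpace X]
  [ChartedSpace (EuclideanSpace ℂ (Fin m)) X] [TopologicalSpace U]
  [ChartedSpace (EuclideanSpace ℂ (Fin k)) U]

namespace DetIsoFamily

variable {A : Family m k X U r} {o : U} (Φ : DetIsoFamily A o)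

/-- The normalized quotients of isomorphisms are smooth. -/
theorem contMDiffAt_quot [CompactSpace X] [T2Space X]
    [IsManifold 𝓘(ℂ, EuclideanSpace ℂ (Fin m)) ω X] [IsManifold 𝓘(ℂ, EuclideanSpace ℂ (Fin k)) ω U]
    {β : X → X} (hβ : ∀ x, x ∈ connectedComponent (β x))
    (hβ' : ∀ x y, y ∈ connectedComponent x → β y = β x) (t₀ : U) (x₀ : X) :
    ContMDiffAt (𝓘(ℝ, EuclideanSpace ℂ (Fin m)).prod 𝓘(ℝ, EuclideanSpace ℂ (Fin k))) 𝓘(ℝ, ℂ) ∞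
      (fun q : X × U => Φ.quot t₀ x₀ q / Φ.quot t₀ (β x₀) (β x₀, q.2)) (x₀, t₀) := by
  have : IsManifold 𝓘(ℝ, EuclideanSpace ℂ (Fin m)) ∞ X :=
    (isUnderlying_self (EuclideanSpace ℂ (Fin m))).isManifold
  have : IsManifold 𝓘(ℝ, EuclideanSpace ℂ (Fin k)) ∞ U :=
    (isUnderlying_self (EuclideanSpace ℂ (Fin k))).isManifold
  have : LocallyConnectedSpace X := ChartedSpace.locallyConnectedSpace (EuclideanSpace ℂ (Fin m)) X
  have hββ : ∀ x, β (β x) = β x := fun x => (hβ' _ _ (hβ x)).symm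
  set e := chartAt (EuclideanSpace ℂ (Fin k)) t₀ with he
  have ht₀ : t₀ ∈ e.source := mem_chart_source _ _
  -- Besides making both trivializations available, `M x` stays in one connected component of `X`,
  -- where the base point is constant, and keeps the value at the base point defined.
  set M : X → Set (X × U) := fun x => A.U (x, t₀) ∩ (fun q : X × U => (q.1, t₀)) ⁻¹' A.U (x, t₀) ∩
    Prod.fst ⁻¹' connectedComponent x ∩ (fun q : X × U => (β x, q.2)) ⁻¹' A.U (β x, t₀) with hM
  have hMo : ∀ x, IsOpen (M x) := fun x =>
    (((A.isOpen_U _).inter ((A.isOpen_U _).preimage (by fun_prop))).inter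
      (isOpen_connectedComponent.preimage continuous_fst)).inter
      ((A.isOpen_U _).preimage (by fun_prop))
  have hMm : ∀ x, (x, t₀) ∈ M x := fun x =>
    ⟨⟨⟨A.mem_U _, A.mem_U (x, t₀)⟩, mem_connectedComponent⟩, A.mem_U (β x, t₀)⟩
  have hMβ : ∀ x y q, q ∈ M x → q ∈ M y → β x = β y := fun x y q hx hy =>
    (hβ' x q.1 hx.1.2).symm.trans (hβ' y q.1 hy.1.2)
  set j : X × EuclideanSpace ℂ (Fin k) → X × U := fun q => (q.1, e.symm q.2) with hj
  have hjc : ContinuousOn j (Set.univ ×ˢ e.target) :=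
    continuousOn_fst.prodMk (e.continuousOn_symm.comp continuousOn_snd fun q hq => hq.2)
  set N : X → Set (X × EuclideanSpace ℂ (Fin k)) := fun x =>
    (Set.univ ×ˢ e.target) ∩ j ⁻¹' M x with hN
  set γ : X → X → X × U → ℂ := fun x y q => (A.trans (y, t₀) (x, t₀) q).det *
    ((A.trans (y, t₀) (x, t₀) (q.1, t₀)).det)⁻¹ with hγ
  have hγs : ∀ x y, ContMDiffOn (𝓘(ℂ, EuclideanSpace ℂ (Fin m)).prod 𝓘(ℂ, EuclideanSpace ℂ (Fin k)))
      𝓘(ℂ, ℂ) ω (γ x y) (M x ∩ M y) := fun x y =>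
    ((A.contMDiffOn_det _ _).mono fun q hq => ⟨hq.2.1.1.1, hq.1.1.1.1⟩).mul
      (((A.contMDiffOn_det (y, t₀) (x, t₀)).comp
        (contMDiff_fst.prodMk contMDiff_const).contMDiffOn
        fun q hq => ⟨hq.2.1.1.2, hq.1.1.1.2⟩).inv₀
        fun q hq => A.det_ne_zero hq.2.1.1.2 hq.1.1.1.2)
  have core := contDiffAt_of_transition (E := EuclideanSpace ℂ (Fin m)) (t₀ := e t₀) (N := N)
    (fun x => hjc.isOpen_inter_preimage (isOpen_univ.prod e.open_target) (hMo x))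
    (fun x => ⟨⟨trivial, e.map_source ht₀⟩, by
      show (x, e.symm (e t₀)) ∈ M x
      rw [e.left_inv ht₀]
      exact hMm x⟩)
    (g := fun x y q => γ x y (j q))
    (fun x y => (hγs x y).continuousOn.comp (hjc.mono fun q hq => hq.1.1)
      fun q hq => ⟨hq.1.2, hq.2.2⟩)
    (fun x y q hq => by
      have h1 : ContMDiffAt 𝓘(ℂ, EuclideanSpace ℂ (Fin k)) 𝓘(ℂ, EuclideanSpace ℂ (Fin k)) ω
          e.symm q.2 :=
        (contMDiffOn_chart_symm (x := t₀)).contMDiffAt (e.open_target.mem_nhds hq.1.1.2)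
      have hq1 := mem_chart_source (EuclideanSpace ℂ (Fin m)) q.1
      have h2 := (analyticAt_chart_prod ((hMo x).inter (hMo y)) (hγs x y) h1 hq1
        ⟨hq.1.2, hq.2.2⟩).differentiableAt
      have h3 := DifferentiableAt.fun_comp' (f := fun τ : EuclideanSpace ℂ (Fin k) =>
        (chartAt (EuclideanSpace ℂ (Fin m)) q.1 q.1, τ)) q.2 h2 (by fun_prop)
      simp only [(chartAt (EuclideanSpace ℂ (Fin m)) q.1).left_inv hq1] at h3
      exact h3)
    (fun x y p hp => by
      have h1 : (p, e.symm (e t₀)) ∈ M x := hp.1.2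
      have h2 : (p, e.symm (e t₀)) ∈ M y := hp.2.2
      show γ x y (p, e.symm (e t₀)) = 1
      rw [e.left_inv ht₀] at h1 h2 ⊢
      exact mul_inv_cancel₀ (A.det_ne_zero h2.1.1.1 h1.1.1.1))
    -- Division by the value at the base point removes the dependence on the choice of `h t` up to
    -- factors constant on components. It does not alter the transition functions, because members
    -- that meet share their base point.
    (u := fun x q => Φ.quot t₀ x (j q) / Φ.quot t₀ (β x) (β x, e.symm q.2))
    (fun x q hq hqs => by
      have h1 := differentiableAt_chart hqs (f := fun p => Φ.quot t₀ x (p, e.symm q.2))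
        (Φ.contMDiffAt_quot_left hq.2.1.1.1 hq.2.1.1.2)
      have h2 := h1.mul_const (Φ.quot t₀ (β x) (β x, e.symm q.2))⁻¹
      simp only [← div_eq_mul_inv] at h2
      exact h2)
    (fun x y q hq => by
      rw [hMβ x y _ hq.1.2 hq.2.2, mul_div_assoc']
      congr 1
      exact Φ.quot_eq_mul hq.1.2.1.1.1 hq.1.2.1.1.2 hq.2.2.1.1.1 hq.2.2.1.1.2)
    hβ hββ
    (fun x τ h => by
      dsimp only
      have h1 : (β x, e.symm τ) ∈ A.U (β x, t₀) := h.2.1.1.1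
      rw [hββ]
      exact div_self (Φ.quot_ne_zero h1 (A.mem_U (β x, t₀)))) x₀
  have h1 : ContMDiffAt (𝓘(ℝ, EuclideanSpace ℂ (Fin m)).prod 𝓘(ℝ, EuclideanSpace ℂ (Fin k)))
      𝓘(ℝ, EuclideanSpace ℂ (Fin m) × EuclideanSpace ℂ (Fin k)) ∞
      (fun q : X × U => (chartAt (EuclideanSpace ℂ (Fin m)) x₀ q.1, e q.2)) (x₀, t₀) := by
    refine ContMDiffAt.prodMk_space ?_ ?_
    · exact ContMDiffAt.comp (x₀, t₀) (f := Prod.fst) (contMDiffOn_chart.contMDiffAt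
        ((chartAt (EuclideanSpace ℂ (Fin m)) x₀).open_source.mem_nhds (mem_chart_source _ _)))
        contMDiffAt_fst
    · exact ContMDiffAt.comp (x₀, t₀) (f := Prod.snd) (contMDiffOn_chart.contMDiffAt
        (e.open_source.mem_nhds ht₀)) contMDiffAt_snd
  have h2 := ContMDiffAt.comp (x₀, t₀) (f := fun q : X × U =>
    (chartAt (EuclideanSpace ℂ (Fin m)) x₀ q.1, e q.2)) (core.restrict_scalars ℝ).contMDiffAt h1
  refine h2.congr_of_eventuallyEq ?_
  filter_upwards [(((chartAt (EuclideanSpace ℂ (Fin m)) x₀).open_source.preimage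
    continuous_fst).inter (e.open_source.preimage continuous_snd)).mem_nhds
    ⟨mem_chart_source (EuclideanSpace ℂ (Fin m)) x₀, ht₀⟩] with q hq
  simp only [Function.comp, hj]
  rw [(chartAt (EuclideanSpace ℂ (Fin m)) x₀).left_inv hq.1, e.left_inv hq.2]

variable (g : FamilyMetric A)
  (g₀ : HermMetric 𝓘(ℝ, EuclideanSpace ℂ (Fin m)) (Family.fiber A o))

/-- The ratio of the determinants of two metrics, compared by the isomorphisms. -/
def ratio (t : U) (p : X) : ℝ := ‖Φ.coeff t p‖ ^ 2 * g₀.detRe p p * (g.detRe (p, t) (p, t))⁻¹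

theorem ratio_pos (t : U) (p : X) : 0 < Φ.ratio g g₀ t p :=
  mul_pos (mul_pos (pow_pos (norm_pos_iff.2 (Φ.coeff_ne_zero t p)) 2)
    (g₀.detRe_pos ((Family.fiber A o).mem_U p))) (inv_pos.2 (g.detRe_pos (A.mem_U _)))

theorem ratio_base (hg : (FamilyMetric.fiber g o).Agree g₀) (p : X) : Φ.ratio g g₀ o p = 1 := by
  have h1 : g.detRe (p, o) (p, o) = g₀.detRe p p :=
    congrArg (fun Q : Matrix (Fin r) (Fin r) ℂ => Q.det.re) (hg p p ((Family.fiber A o).mem_U p))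
  rw [ratio, Φ.coeff_one, norm_one, one_pow, one_mul, h1]
  exact mul_inv_cancel₀ (g₀.detRe_pos ((Family.fiber A o).mem_U p)).ne'

theorem ratio_eq {t : U} {i p : X} (h : (p, t) ∈ A.U (i, t)) (h' : (p, o) ∈ A.U (i, o)) :
    Φ.ratio g g₀ t p = ‖Φ.h t i p‖ ^ 2 * g₀.detRe i p * (g.detRe (i, t) (p, t))⁻¹ := by
  have h1 : g₀.detRe i p = ‖(A.trans (p, o) (i, o) (p, o)).det‖ ^ 2 * g₀.detRe p p :=
    g₀.detRe_compat (i := p) (j := i) ((Family.fiber A o).mem_U p) h'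
  have h2 := g.detRe_compat h (A.mem_U (p, t))
  have h3 := norm_ne_zero_iff.2 (A.det_ne_zero h (A.mem_U (p, t)))
  have h4 := (g.detRe_pos h).ne'
  rw [ratio, Φ.coeff_eq h h', h1, h2, norm_mul, norm_mul]
  field_simp

/-- Near `t₀` the dependence on `t` is confined to `quot` and the smooth metric `g`; the remaining
factor is frozen at `t₀`. -/
theorem ratio_eq_mul {t₀ t : U} {x p : X} (h : (p, t) ∈ A.U (x, t₀))
    (h' : (p, t₀) ∈ A.U (x, t₀)) : Φ.ratio g g₀ t p = Φ.ratio g g₀ t₀ p *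
      ‖Φ.quot t₀ x (p, t)‖ ^ 2 * (g.detRe (x, t₀) (p, t₀) * (g.detRe (x, t₀) (p, t))⁻¹) := by
  have h1 := g.detRe_compat (A.mem_U (p, t)) h
  have h2 := g.detRe_compat (A.mem_U (p, t₀)) h'
  have h3 := norm_ne_zero_iff.2 (A.det_ne_zero (A.mem_U (p, t)) h)
  have h4 := norm_ne_zero_iff.2 (A.det_ne_zero (A.mem_U (p, t₀)) h')
  have h5 := norm_ne_zero_iff.2 (Φ.coeff_ne_zero t₀ p)
  have h6 := (g.detRe_pos (A.mem_U (p, t))).ne'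
  have h7 := (g.detRe_pos (A.mem_U (p, t₀))).ne'
  rw [ratio, ratio, quot, h1, h2, norm_div, norm_mul, norm_mul]
  field_simp

/-- The ratio itself need not be continuous in `t`, since `h t` is arbitrary up to constants on
components. These cancel against the base point, leaving the normalized quotient and smooth terms.
-/
theorem contMDiff_ratio_div [CompactSpace X] [T2Space X]
    [IsManifold 𝓘(ℂ, EuclideanSpace ℂ (Fin m)) ω X] [IsManifold 𝓘(ℂ, EuclideanSpace ℂ (Fin k)) ω U]
    {β : X → X} (hβ : ∀ x, x ∈ connectedComponent (β x))
    (hβ' : ∀ x y, y ∈ connectedComponent x → β y = β x) :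
    ContMDiff (𝓘(ℝ, EuclideanSpace ℂ (Fin m)).prod 𝓘(ℝ, EuclideanSpace ℂ (Fin k))) 𝓘(ℝ, ℝ) ∞
      (fun q : X × U => Φ.ratio g g₀ q.2 q.1 * (Φ.ratio g g₀ q.2 (β q.1))⁻¹) := by
  have : LocallyConnectedSpace X := ChartedSpace.locallyConnectedSpace (EuclideanSpace ℂ (Fin m)) X
  rintro ⟨x, t₀⟩
  set b := β x with hb
  have hnsq : ∀ {f : X × U → ℂ}, ContMDiffAt
      (𝓘(ℝ, EuclideanSpace ℂ (Fin m)).prod 𝓘(ℝ, EuclideanSpace ℂ (Fin k))) 𝓘(ℝ, ℂ) ∞ f (x, t₀) →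
      ContMDiffAt (𝓘(ℝ, EuclideanSpace ℂ (Fin m)).prod 𝓘(ℝ, EuclideanSpace ℂ (Fin k))) 𝓘(ℝ, ℝ) ∞
        (fun q => ‖f q‖ ^ 2) (x, t₀) := fun hf =>
    ContMDiffAt.comp (x, t₀) ((contDiff_norm_sq ℝ (E := ℂ) (n := ∞)).contMDiff.contMDiffAt) hf
  have hcι : Continuous fun q : X × U => (q.1, t₀) := by fun_prop
  have hcb : Continuous fun q : X × U => (b, q.2) := by fun_prop
  have hco : Continuous fun q : X × U => (q.1, o) := by fun_prop
  have m1 : A.U (x, t₀) ∈ 𝓝 (x, t₀) := (A.isOpen_U _).mem_nhds (A.mem_U _)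
  have m2 : (fun q : X × U => (q.1, t₀)) ⁻¹' A.U (x, t₀) ∈ 𝓝 (x, t₀) :=
    ((A.isOpen_U _).preimage hcι).mem_nhds (A.mem_U (x, t₀))
  have m3 : (fun q : X × U => (b, q.2)) ⁻¹' A.U (b, t₀) ∈ 𝓝 (x, t₀) :=
    ((A.isOpen_U _).preimage hcb).mem_nhds (A.mem_U (b, t₀))
  have m4 : (fun q : X × U => (q.1, o)) ⁻¹' A.U (x, o) ∈ 𝓝 (x, t₀) :=
    ((A.isOpen_U _).preimage hco).mem_nhds (A.mem_U (x, o))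
  have m5 : Prod.fst ⁻¹' connectedComponent x ∈ 𝓝 (x, t₀) :=
    (isOpen_connectedComponent.preimage continuous_fst).mem_nhds
      (show x ∈ connectedComponent x from mem_connectedComponent)
  have s1 := hnsq (Φ.contMDiffAt_quot hβ hβ' t₀ x)
  have s2 : ContMDiffAt (𝓘(ℝ, EuclideanSpace ℂ (Fin m)).prod 𝓘(ℝ, EuclideanSpace ℂ (Fin k))) 𝓘(ℝ, ℝ)
      ∞ (fun q : X × U => g.detRe (x, t₀) q) (x, t₀) := (g.contMDiffOn_detRe _).contMDiffAt m1
  have s3 : ContMDiffAt (𝓘(ℝ, EuclideanSpace ℂ (Fin m)).prod 𝓘(ℝ, EuclideanSpace ℂ (Fin k))) 𝓘(ℝ, ℝ)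
      ∞ (fun q : X × U => g.detRe (x, t₀) (q.1, t₀)) (x, t₀) :=
    ContMDiffAt.comp (x, t₀) (f := fun q : X × U => (q.1, t₀)) s2
      (contMDiff_fst.prodMk contMDiff_const).contMDiffAt
  have s4 : ContMDiffAt (𝓘(ℝ, EuclideanSpace ℂ (Fin m)).prod 𝓘(ℝ, EuclideanSpace ℂ (Fin k))) 𝓘(ℝ, ℝ)
      ∞ (fun q : X × U => g.detRe (b, t₀) (b, q.2)) (x, t₀) :=
    ContMDiffAt.comp (x, t₀) (f := fun q : X × U => (b, q.2))
      ((g.contMDiffOn_detRe (b, t₀)).contMDiffAt ((A.isOpen_U _).mem_nhds (A.mem_U _)))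
      (contMDiff_const.prodMk contMDiff_snd).contMDiffAt
  have s5 : ContMDiffAt (𝓘(ℝ, EuclideanSpace ℂ (Fin m)).prod 𝓘(ℝ, EuclideanSpace ℂ (Fin k))) 𝓘(ℝ, ℝ)
      ∞ (fun q : X × U => g₀.detRe x q.1) (x, t₀) :=
    ContMDiffAt.comp (x, t₀) (f := Prod.fst) ((g₀.contMDiffOn_detRe x).contMDiffAt
      (((Family.fiber A o).isOpen_U x).mem_nhds ((Family.fiber A o).mem_U x))) contMDiffAt_fst
  have s6 : ContMDiffAt (𝓘(ℝ, EuclideanSpace ℂ (Fin m)).prod 𝓘(ℝ, EuclideanSpace ℂ (Fin k))) 𝓘(ℝ, ℂ)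
      ∞ (fun q : X × U => Φ.h t₀ x q.1) (x, t₀) :=
    ContMDiffAt.comp (x, t₀) (f := Prod.fst)
      (((isUnderlying_self (EuclideanSpace ℂ (Fin m))).contMDiffOn (Φ.hol t₀ x)).contMDiffAt
        ((((Family.fiber A t₀).isOpen_U x).inter ((Family.fiber A o).isOpen_U x)).mem_nhds
          ⟨(Family.fiber A t₀).mem_U x, (Family.fiber A o).mem_U x⟩)) contMDiffAt_fst
  have p1 := (g.detRe_pos (A.mem_U (x, t₀))).ne'
  have s7 := ((((hnsq s6).mul s5).mul (s3.inv₀ p1)).mul s1).mul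
    ((s3.mul (s2.inv₀ p1)).mul (s4.mul (contMDiffAt_const
      (c := (g.detRe (b, t₀) (b, t₀))⁻¹ * (Φ.ratio g g₀ t₀ b)⁻¹))))
  refine s7.congr_of_eventuallyEq ?_
  filter_upwards [m1, m2, m3, m4, m5] with q h1 h2 h3 h4 h5
  change (b, q.2) ∈ A.U (b, t₀) at h3
  change (q.1, t₀) ∈ A.U (x, t₀) at h2
  have e1 : β q.1 = b := hβ' x q.1 h5
  simp only [Pi.mul_apply]
  rw [e1, Φ.ratio_eq_mul g g₀ (t₀ := t₀) (x := x) (t := q.2) h1 h2,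
    Φ.ratio_eq_mul g g₀ (t₀ := t₀) (x := b) (t := q.2) h3 (A.mem_U (b, t₀)),
    Φ.ratio_eq g g₀ (t := t₀) (i := x) h2 h4, norm_div]
  have n1 := norm_ne_zero_iff.2 (Φ.quot_ne_zero h3 (A.mem_U (b, t₀)))
  have n2 := (g.detRe_pos h3).ne'
  have n3 := (Φ.ratio_pos g g₀ t₀ b).ne'
  have n4 := (g.detRe_pos (A.mem_U (b, t₀))).ne'
  have n5 := (g.detRe_pos h1).ne'
  have n6 := (g.detRe_pos h2).ne'
  have e2 : ((q.1, q.2) : X × U) = q := rfl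
  rw [e2, ← hb]
  field_simp

end DetIsoFamily

/-- Metrics extend to Ricci-flat metrics when the determinant is constant. -/
theorem Family.PreservesDet.exists_ricciFlat [CompactSpace X] [T2Space X] [T2Space U]
    [SigmaCompactSpace U] [IsManifold 𝓘(ℂ, EuclideanSpace ℂ (Fin m)) ω X]
    [IsManifold 𝓘(ℂ, EuclideanSpace ℂ (Fin k)) ω U] {A : Family m k X U r} {o : U}
    (hA : Family.PreservesDet A o)
    (g₀ : HermMetric 𝓘(ℝ, EuclideanSpace ℂ (Fin m)) (Family.fiber A o)) :
    ∃ g : FamilyMetric A, (FamilyMetric.fiber g o).Agree g₀ ∧ FamilyMetric.RicciFlat g o := by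
  obtain ⟨g, hg⟩ := exists_familyMetric_agree A o g₀
  -- In rank `0` the determinant is `1` and every metric has zero curvature; the exponent `1/r`
  -- below needs `r > 0`.
  rcases Nat.eq_zero_or_pos r with hr | hr
  · subst hr
    refine ⟨g, hg, fun t x => ?_⟩
    simp only [curvature, Matrix.det_fin_zero]
  obtain ⟨Φ⟩ := hA.nonempty_detIsoFamily
  obtain ⟨β, hβ, hβ'⟩ := exists_component_base X
  set ρ : X × U → ℝ := fun q => Φ.ratio g g₀ q.2 q.1 * (Φ.ratio g g₀ q.2 (β q.1))⁻¹ with hρ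
  have hρpos : ∀ q, 0 < ρ q := fun q =>
    mul_pos (Φ.ratio_pos g g₀ _ _) (inv_pos.2 (Φ.ratio_pos g g₀ _ _))
  have hρs := Φ.contMDiff_ratio_div g g₀ hβ hβ'
  -- Scaling by `c` multiplies the determinant by `c ^ r`, so the `r`-th root of the desired factor
  -- is taken.
  set c : X × U → ℝ := fun q => ρ q ^ ((r : ℝ)⁻¹) with hc
  have hcs : ContMDiff (𝓘(ℝ, EuclideanSpace ℂ (Fin m)).prod 𝓘(ℝ, EuclideanSpace ℂ (Fin k)))
      𝓘(ℝ, ℝ) ∞ c := fun q =>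
    ContMDiffAt.comp q (g := fun s : ℝ => s ^ ((r : ℝ)⁻¹))
      (Real.contDiffAt_rpow_const_of_ne (hρpos q).ne').contMDiffAt (hρs q)
  have hcpos : ∀ q, 0 < c q := fun q => Real.rpow_pos_of_pos (hρpos q) _
  have hcr : ∀ q, c q ^ r = ρ q := fun q => Real.rpow_inv_natCast_pow (hρpos q).le hr.ne'
  have hag : (FamilyMetric.fiber (g.scale c hcs hcpos) o).Agree g₀ := by
    intro i p hp
    have h1 : c (p, o) = 1 := by
      simp only [hc, hρ, Φ.ratio_base g g₀ hg, inv_one, mul_one, Real.one_rpow]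
    show c (p, o) • g.gram (i, o) (p, o) = _
    rw [h1, one_smul]
    exact hg i p hp
  have key : ∀ t x, curvature (FamilyMetric.fiber (g.scale c hcs hcpos) t) x = curvature g₀ x := by
    intro t x
    have LC : LocallyConnectedSpace X :=
      ChartedSpace.locallyConnectedSpace (EuclideanSpace ℂ (Fin m)) X
    -- On one component the normalizing factor at fixed `t` is a constant. Its square root is
    -- absorbed into the holomorphic function, so the new determinant is locally `|h C|²` times that
    -- of `g₀`.
    set C : ℝ := √((Φ.ratio g g₀ t (β x))⁻¹) with hC
    have hCpos : 0 < C := Real.sqrt_pos.2 (inv_pos.2 (Φ.ratio_pos g g₀ _ _))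
    have hCsq : C ^ 2 = (Φ.ratio g g₀ t (β x))⁻¹ :=
      Real.sq_sqrt (inv_pos.2 (Φ.ratio_pos g g₀ _ _)).le
    have mt := ((Family.fiber A t).isOpen_U x).mem_nhds ((Family.fiber A t).mem_U x)
    have mo := ((Family.fiber A o).isOpen_U x).mem_nhds ((Family.fiber A o).mem_U x)
    have hF : AnalyticAt ℂ (fun z => Φ.h t x ((chartAt (EuclideanSpace ℂ (Fin m)) x).symm z) *
        (C : ℂ)) (chartAt (EuclideanSpace ℂ (Fin m)) x x) :=
      (analyticAt_chart ((Φ.hol t x).contMDiffAt (Filter.inter_mem mt mo))).mul analyticAt_const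
    have hC0 : (C : ℂ) ≠ 0 := by exact_mod_cast hCpos.ne'
    have hF0 : Φ.h t x ((chartAt (EuclideanSpace ℂ (Fin m)) x).symm
        (chartAt (EuclideanSpace ℂ (Fin m)) x x)) * (C : ℂ) ≠ 0 := by
      rw [(chartAt (EuclideanSpace ℂ (Fin m)) x).left_inv (mem_chart_source _ x)]
      exact mul_ne_zero (Φ.ne_zero t x x (A.mem_U _) (A.mem_U _)) hC0
    refine curvature_eq_of_detRe _ g₀ (f := fun p => ‖Φ.h t x p * (C : ℂ)‖) (d := 2) ?_
      (contDiffAt_log_norm hF hF0) (ddbar_log_norm hF hF0) ?_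
    · filter_upwards [mt, mo] with p h1 h2
      exact norm_pos_iff.2 (mul_ne_zero (Φ.ne_zero t x p h1 h2) hC0)
    · filter_upwards [mt, mo, isOpen_connectedComponent.mem_nhds
        (mem_connectedComponent (x := x))] with p h1 h2 h3
      have e1 : (FamilyMetric.fiber (g.scale c hcs hcpos) t).detRe x p =
          c (p, t) ^ r * g.detRe (x, t) (p, t) := g.detRe_scale c hcs hcpos (x, t) (p, t)
      have n1 := (g.detRe_pos (i := (x, t)) (p := (p, t)) h1).ne'
      rw [e1, hcr, norm_mul, mul_pow, Complex.norm_real, Real.norm_of_nonneg hCpos.le, hCsq]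
      simp only [hρ]
      rw [hβ' x p h3, Φ.ratio_eq g g₀ (i := x) h1 h2]
      field_simp
  exact ⟨g.scale c hcs hcpos, hag, fun t x => (key t x).trans (key o x).symm⟩

end RicciFlatMetric

end RicciDeform

end

theorem mainTheorem9 {m : ℕ} {X : Type*} [TopologicalSpace X] [T2Space X] [CompactSpace X]
    [ChartedSpace (EuclideanSpace ℂ (Fin m)) X] [IsManifold 𝓘(ℂ, EuclideanSpace ℂ (Fin m)) ω X]
    (hX : ∃ (n : ℕ) (E₀ : RicciDeform.HolBundle 𝓘(ℂ, EuclideanSpace ℂ (Fin m)) X n), 0 < n ∧ E₀.RicciRigid) :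
    -- germs of holomorphic maps into the real torus are constant
    (∀ f : ℂ → RicciDeform.Pic0 m X, RicciDeform.IsHolGerm f →
      (∀ᶠ t in 𝓝 (0 : ℂ), f t ∈ RicciDeform.realTorus m X) →
      ∀ᶠ t in 𝓝 (0 : ℂ), f t = f 0) ∧
    -- the Ricci-flat deformations are exactly those with preserved determinant, and then every
    -- metric on the central fibre extends to a Ricci-flat one
    (∀ (k r : ℕ) (U : Type*) [TopologicalSpace U] [T2Space U] [SecondCountableTopology U]
      [ConnectedSpace U] [ChartedSpace (EuclideanSpace ℂ (Fin k)) U] [IsManifold 𝓘(ℂ, EuclideanSpace ℂ (Fin k)) ω U]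
      (o : U) (E : RicciDeform.Family m k X U r),
      ((∃ g : RicciDeform.FamilyMetric E, RicciDeform.FamilyMetric.RicciFlat g o) ↔
        RicciDeform.Family.PreservesDet E o) ∧
      ∀ g₀ : RicciDeform.HermMetric 𝓘(ℝ, EuclideanSpace ℂ (Fin m)) (RicciDeform.Family.fiber E o),
        (∃ g : RicciDeform.FamilyMetric E,
          RicciDeform.HermMetric.Agree (RicciDeform.FamilyMetric.fiber g o) g₀ ∧
          RicciDeform.FamilyMetric.RicciFlat g o) ↔
        RicciDeform.Family.PreservesDet E o) ∧
    -- the maximal complex subspace vanishes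
    RicciDeform.maxComplexSubspace m X = ⊥ := by
  obtain ⟨n, E₀, hn, hE⟩ := hX
  have hV : ∀ v ∈ RicciDeform.realRange m X, Complex.I • v ∈ RicciDeform.realRange m X → v = 0 :=
    fun v h1 h2 => RicciDeform.eq_zero_of_mem_range hE hn h1 h2
  refine ⟨fun f hf hr => RicciDeform.eventually_eq_of_isHolGerm hV hf hr,
    fun k r U _ _ _ _ _ _ o E => ?_, RicciDeform.maxComplexSubspace_eq_bot hV⟩
  -- With second countability this gives σ-compactness, as required for partitions of unity on `X ×
  -- U`.
  have : LocallyCompactSpace U :=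
    ChartedSpace.locallyCompactSpace (EuclideanSpace ℂ (Fin k)) U
  refine ⟨⟨fun ⟨g, hg⟩ => hE.preservesDet hn g hg, fun h => ?_⟩,
    fun g₀ => ⟨fun ⟨g, _, hg⟩ => hE.preservesDet hn g hg, fun h => h.exists_ricciFlat g₀⟩⟩
  obtain ⟨g₀⟩ := RicciDeform.exists_hermMetric'
    (RicciDeform.isUnderlying_self (EuclideanSpace ℂ (Fin m))) (RicciDeform.Family.fiber E o)
  obtain ⟨g, _, hg⟩ := h.exists_ricciFlat g₀
  exact ⟨g, hg⟩
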